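/- Let $\gamma : T \to K$ be a morphism of affine complex algebraic groups whose differential $\mathfrak t \to \mathfrak k$ is injective, where $\mathfrak t$ and $\mathfrak k$ are the Lie algebras of $T$ and $K$. Assume that $T$ is reductive, i.e. that every finite-dimensional algebraic representation of $T$ is completely reducible. A $(\mathfrak k,T)$-module is a $\mathcal U(\mathfrak k)$-module $V$ with an algebraic action $\nu$ of $T$ (i.e. $V$ is a union of finite-dimensional $T$-invariant subspaces on which $T$ acts by algebraic representations) such that $\nu(t)(av) = (\operatorname{Ad}(\gamma(t))a)\,\nu(t)v$ for $t\in T$, $a\in\mathcal U(\mathfrak k)$, $v \in V$, and such that the differential of $\nu$ is the action of $\mathfrak t$ obtained from $\mathfrak t\to\mathfrak k\subset\mathcal U(\mathfrak k)$. Morphisms are the linear maps commuting with $\mathcal U(\mathfrak k)$ and $T$. For a complex Lie algebra $\mathfrak l$ let $N(\mathfrak l)$, $N^{-p}(\mathfrak l)=\mathcal U(\mathfrak l)\otimes\bigwedge^{p}\mathfrak l$, be its standard complex, with the DG algebra structure given by identifying it with the universal enveloping algebra of the DG Lie algebra $\underline{\mathfrak l}$; here $\underline{\mathfrak l}$ is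 the complex $\mathfrak l\xrightarrow{\,1\,}\mathfrak l$ in degrees $-1$ and $0$, with the bracket of $\mathfrak l$ on $\underline{\mathfrak l}^0\times\underline{\mathfrak l}^0$ and $\underline{\mathfrak l}^0\times\underline{\mathfrak l}^{-1}$, and zero bracket on $\underline{\mathfrak l}^{-1}\times\underline{\mathfrak l}^{-1}$. Let $\varepsilon : N(\mathfrak l)\to\mathbb C$ be the counit, the algebra homomorphism that vanishes on $\underline{\mathfrak l}$. Consider the complex $$N(\mathfrak k)\otimes_{N(\mathfrak t)}\mathbb C ,$$ where $N(\mathfrak t)$ acts on $N(\mathfrak k)$ by right multiplication and on $\mathbb C$ through the counit; $\mathfrak k$ acts on it by left multiplication and $T$ by the action induced by the adjoint action. It is a complex of $(\mathfrak k,T)$-modules, in degrees $\le 0$. Then the morphism $$N(\mathfrak k)\otimes_{N(\mathfrak t)}\mathbb C\longrightarrow\mathbb C$$ induced by the counit of $N(\mathfrak k)$ is a resolution of the trivial $(\mathfrak k,T)$-module $\mathbb C$ by projective $(\mathfrak k,T)$-modules that are finitely generated over $\mathcal U(\mathfrak k)$: every component $(N(\mathfrak k)\otimes_{N(\mathfrak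 t)}\mathbb C)^{-p}$, $p\ge 0$, is a projective object of the category of $(\mathfrak k,T)$-modules and a finitely generated $\mathcal U(\mathfrak k)$-module, and the augmented complex $$\cdots\to (N(\mathfrak k)\otimes_{N(\mathfrak t)}\mathbb C)^{-1}\to (N(\mathfrak k)\otimes_{N(\mathfrak t)}\mathbb C)^{0}\to\mathbb C\to 0$$ is exact. -/

import Mathlib

universe u v

/-- An affine (that is, linear) complex algebraic group, not necessarily connected: a group `G`
with a finitely generated algebra `ℂ[G]` of functions on `G`, its regular functions, such that every
`ℂ`-algebra homomorphism `ℂ[G] → ℂ` is the evaluation at exactly one point (so that `G` is the affine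
variety with coordinate ring `ℂ[G]`), and such that multiplication and inversion are morphisms of
varieties. -/
class AlgGroup (G : Type u) [Group G] where
  regular : Subalgebra ℂ (G → ℂ)
  fg : regular.FG
  eval_bijective : Function.Bijective
    (fun g : G => ((Pi.evalAlgHom ℂ (fun _ : G => ℂ) g).comp regular.val : regular →ₐ[ℂ] ℂ))
  mul_regular : ∀ f ∈ regular, ∃ (n : ℕ) (a b : Fin n → regular),
    ∀ x y : G, f (x * y) = ∑ i, (a i : G → ℂ) x * (b i : G → ℂ) y
  inv_regular : ∀ f ∈ regular, (fun x => f x⁻¹) ∈ regular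

namespace AlgGroup

section Basic
variable (G : Type u) [Group G] [AlgGroup G]

/-- The coordinate ring `ℂ[G]`. -/
abbrev Coord : Type u := (AlgGroup.regular : Subalgebra ℂ (G → ℂ))

variable {G}

theorem left_mem (g : G) {f : G → ℂ} (hf : f ∈ (regular : Subalgebra ℂ (G → ℂ))) :
    (fun x => f (g * x)) ∈ (regular : Subalgebra ℂ (G → ℂ)) := by
  obtain ⟨n, a, b, h⟩ := mul_regular f hf
  have : (fun x => f (g * x)) = ∑ i, ((a i : G → ℂ) g) • (b i : G → ℂ) := by
    ext x; simp [h]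
  rw [this]
  exact Subalgebra.sum_mem _ fun i _ => Subalgebra.smul_mem _ (b i).2 _

theorem right_mem (g : G) {f : G → ℂ} (hf : f ∈ (regular : Subalgebra ℂ (G → ℂ))) :
    (fun x => f (x * g)) ∈ (regular : Subalgebra ℂ (G → ℂ)) := by
  obtain ⟨n, a, b, h⟩ := mul_regular f hf
  have : (fun x => f (x * g)) = ∑ i, ((b i : G → ℂ) g) • (a i : G → ℂ) := by
    ext x; simp [h, mul_comm]
  rw [this]
  exact Subalgebra.sum_mem _ fun i _ => Subalgebra.smul_mem _ (a i).2 _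

/-- `(L_g f)(x) = f (g x)`. -/
def leftTrans (g : G) : Coord G →ₐ[ℂ] Coord G where
  toFun f := ⟨fun x => f.1 (g * x), left_mem g f.2⟩
  map_one' := rfl
  map_mul' _ _ := rfl
  map_zero' := rfl
  map_add' _ _ := rfl
  commutes' _ := rfl

/-- `(R_g f)(x) = f (x g)`. -/
def rightTrans (g : G) : Coord G →ₐ[ℂ] Coord G where
  toFun f := ⟨fun x => f.1 (x * g), right_mem g f.2⟩
  map_one' := rfl
  map_mul' _ _ := rfl
  map_zero' := rfl
  map_add' _ _ := rfl
  commutes' _ := rfl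

@[simp] theorem leftTrans_apply (g : G) (f : Coord G) (x : G) :
    (leftTrans g f).1 x = f.1 (g * x) := rfl
@[simp] theorem rightTrans_apply (g : G) (f : Coord G) (x : G) :
    (rightTrans g f).1 x = f.1 (x * g) := rfl

variable (G) in
/-- The left invariant derivations of `ℂ[G]`, as a Lie subalgebra of all derivations. -/
def lieAlg : LieSubalgebra ℂ (Derivation ℂ (Coord G) (Coord G)) where
  carrier := {D | ∀ g f, D (leftTrans g f) = leftTrans g (D f)}
  add_mem' {D E} hD hE g f := by simp [hD g f, hE g f]
  zero_mem' g f := by simp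
  smul_mem' c D hD g f := by simp [hD g f]
  lie_mem' {D E} hD hE g f := by
    simp [Derivation.commutator_apply, hD g _, hE g _]

variable (G) in
/-- The Lie algebra of `G`. -/
abbrev LieAlg : Type u := lieAlg G

theorem LieAlg.apply_eq (D : LieAlg G) (f : Coord G) (x : G) :
    (D.1 f).1 x = (D.1 (leftTrans x f)).1 1 := by
  rw [D.2 x f]; simp

theorem LieAlg.ext_one {D E : LieAlg G} (h : ∀ f : Coord G, (D.1 f).1 1 = (E.1 f).1 1) :
    D = E := by
  apply Subtype.ext
  ext f x
  have := h (leftTrans x f)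
  rwa [← LieAlg.apply_eq, ← LieAlg.apply_eq] at this

/-- The adjoint action: `Ad g (D) = R_g ∘ D ∘ R_g⁻¹`. -/
def adj (g : G) : LieAlg G →ₗ⁅ℂ⁆ LieAlg G where
  toFun D := ⟨Derivation.mk' ((rightTrans g).toLinearMap ∘ₗ D.1.toLinearMap ∘ₗ
      (rightTrans g⁻¹).toLinearMap) (by
        intro a b
        apply Subtype.ext; funext x
        simp [mul_assoc]), by
    intro h f
    apply Subtype.ext; funext x
    have : rightTrans g⁻¹ (leftTrans h f) = leftTrans h (rightTrans g⁻¹ f) := by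
      apply Subtype.ext; funext y; simp [mul_assoc]
    simp [this, D.2 h, mul_assoc]⟩
  map_add' D E := by apply Subtype.ext; ext f x; simp
  map_smul' c D := by apply Subtype.ext; ext f x; simp
  map_lie' {D E} := by
    apply Subtype.ext; ext f x
    have h (f : Coord G) : rightTrans g⁻¹ (rightTrans g f) = f := by
      apply Subtype.ext; funext y; simp [mul_assoc]
    simp [Derivation.commutator_apply, h]
    rfl

theorem adj_apply (g : G) (D : LieAlg G) (f : Coord G) :
    (adj g D).1 f = rightTrans g (D.1 (rightTrans g⁻¹ f)) := rfl

theorem adj_one : adj (1 : G) = LieHom.id := by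
  ext D f x
  have : rightTrans (1 : G)⁻¹ f = f := by apply Subtype.ext; funext y; simp
  rw [adj_apply, this]; simp

theorem adj_mul (g h : G) : adj (g * h) = (adj g).comp (adj h) := by
  ext D f x
  have : rightTrans (g * h)⁻¹ f = rightTrans h⁻¹ (rightTrans g⁻¹ f) := by
    apply Subtype.ext; funext y; simp [mul_assoc]
  rw [adj_apply, this]; simp [adj_apply, mul_assoc]

end Basic

/-- Morphisms of algebraic groups. -/
structure Hom (T K : Type u) [Group T] [AlgGroup T] [Group K] [AlgGroup K] extends T →* K where
  comp_regular : ∀ f ∈ (regular : Subalgebra ℂ (K → ℂ)),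
    (fun t => f (toFun t)) ∈ (regular : Subalgebra ℂ (T → ℂ))

namespace Hom
variable {T K : Type u} [Group T] [AlgGroup T] [Group K] [AlgGroup K] (γ : Hom T K)

instance : FunLike (Hom T K) T K where
  coe γ := γ.toFun
  coe_injective γ δ h := by
    cases γ; cases δ; congr; exact DFunLike.ext' h

@[simp] theorem map_one : γ 1 = 1 := γ.toMonoidHom.map_one
@[simp] theorem map_mul (s t : T) : γ (s * t) = γ s * γ t := γ.toMonoidHom.map_mul s t
@[simp] theorem map_inv (t : T) : γ t⁻¹ = (γ t)⁻¹ := γ.toMonoidHom.map_inv t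

/-- `f ↦ f ∘ γ`. -/
def pullback : Coord K →ₐ[ℂ] Coord T where
  toFun f := ⟨fun t => f.1 (γ t), γ.comp_regular f.1 f.2⟩
  map_one' := rfl
  map_mul' _ _ := rfl
  map_zero' := rfl
  map_add' _ _ := rfl
  commutes' _ := rfl

@[simp] theorem pullback_apply (f : Coord K) (t : T) : (γ.pullback f).1 t = f.1 (γ t) := rfl

theorem differential_mem (D : LieAlg T) (f : Coord K) :
    (fun x : K => (D.1 (γ.pullback (leftTrans x f))).1 1) ∈
      (regular : Subalgebra ℂ (K → ℂ)) := by
  obtain ⟨n, a, b, h⟩ := mul_regular f.1 f.2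
  have : (fun x : K => (D.1 (γ.pullback (leftTrans x f))).1 1) =
      ∑ i, ((D.1 (γ.pullback (b i))).1 1) • (a i : K → ℂ) := by
    funext x
    have h2 : leftTrans x f = ∑ i, (a i).1 x • b i := by
      apply Subtype.ext; funext y; simp [h]
    simp [h2, mul_comm]
  rw [this]
  exact Subalgebra.sum_mem _ fun i _ => Subalgebra.smul_mem _ (a i).2 _

/-- The left invariant derivation of `ℂ[K]` whose value at `1` is `f ↦ D(f ∘ γ)(1)`. -/
def differentialFun (D : LieAlg T) : LieAlg K :=
  ⟨Derivation.mk'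
    { toFun := fun f => ⟨fun x : K => (D.1 (γ.pullback (leftTrans x f))).1 1,
        γ.differential_mem D f⟩
      map_add' := fun f g => by apply Subtype.ext; funext x; simp
      map_smul' := fun c f => by apply Subtype.ext; funext x; simp }
    (by intro f g; apply Subtype.ext; funext x; simp), by
    intro g f
    apply Subtype.ext; funext x
    have : leftTrans x (leftTrans g f) = leftTrans (g * x) f := by
      apply Subtype.ext; funext y; simp [mul_assoc]
    simp [this]⟩

theorem differentialFun_apply_one (D : LieAlg T) (f : Coord K) :
    ((γ.differentialFun D).1 f).1 1 = (D.1 (γ.pullback f)).1 1 := by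
  have : leftTrans (1 : K) f = f := by apply Subtype.ext; funext y; simp
  change (D.1 (γ.pullback (leftTrans 1 f))).1 1 = _
  rw [this]

theorem pullback_differentialFun (D : LieAlg T) (f : Coord K) :
    γ.pullback ((γ.differentialFun D).1 f) = D.1 (γ.pullback f) := by
  apply Subtype.ext; funext t
  have : γ.pullback (leftTrans (γ t) f) = leftTrans t (γ.pullback f) := by
    apply Subtype.ext; funext y; simp
  change (D.1 (γ.pullback (leftTrans (γ t) f))).1 1 = _
  rw [this, ← LieAlg.apply_eq]

/-- The differential of `γ` at the identity, `Lie(T) → Lie(K)`: it sends `D` to the left invariant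
derivation with value `f ↦ D(f ∘ γ)(1)` at `1`. -/
def differential : LieAlg T →ₗ⁅ℂ⁆ LieAlg K where
  toFun := γ.differentialFun
  map_add' D E := LieAlg.ext_one fun f => by simp [differentialFun_apply_one]
  map_smul' c D := LieAlg.ext_one fun f => by simp [differentialFun_apply_one]
  map_lie' {D E} := LieAlg.ext_one fun f => by
    simp [differentialFun_apply_one, Derivation.commutator_apply, pullback_differentialFun]

theorem differential_apply_one (D : LieAlg T) (f : Coord K) :
    ((γ.differential D).1 f).1 1 = (D.1 (γ.pullback f)).1 1 := γ.differentialFun_apply_one D f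

theorem pullback_differential (D : LieAlg T) (f : Coord K) :
    γ.pullback ((γ.differential D).1 f) = D.1 (γ.pullback f) := γ.pullback_differentialFun D f

theorem differential_adj (t : T) :
    γ.differential.comp (adj t) = (adj (γ t)).comp γ.differential := by
  refine LieHom.ext fun D => LieAlg.ext_one fun f => ?_
  have h1 : ((adj (γ t) (γ.differential D)).1 f).1 1 =
      (γ.pullback ((γ.differential D).1 (rightTrans (γ t)⁻¹ f))).1 t := by
    simp [adj_apply]
  have h2 : γ.pullback (rightTrans (γ t)⁻¹ f) = rightTrans t⁻¹ (γ.pullback f) := by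
    apply Subtype.ext; funext y; simp
  rw [LieHom.comp_apply, LieHom.comp_apply, h1, pullback_differential, h2,
    differential_apply_one]
  simp [adj_apply]

end Hom

end AlgGroup

section Std
attribute [local instance] LieRing.ofAssociativeRing

variable (L : Type u) [LieRing L] [LieAlgebra ℂ L]

/-- For a Lie algebra `L` let `L_` be the DG Lie algebra with `L` in degrees `0` and `-1`, differential
the identity of `L`, brackets `[X, Y]`, `[X, ξ]` those of `L` for `X, Y` of degree `0` and `ξ` of
degree `-1`, and `[ξ, η] = 0` for `ξ, η` of degree `-1`. In the tensor algebra of `L_`, where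
`(X, 0)` stands for `X` in degree `0` and `(0, ξ)` for `ξ` in degree `-1`, these are the relations
`x y - (-1)^(deg x deg y) y x = [x, y]`. -/
inductive StdRel : TensorAlgebra ℂ (L × L) → TensorAlgebra ℂ (L × L) → Prop
  | even_even (X Y : L) : StdRel
      (TensorAlgebra.ι ℂ (X, 0) * TensorAlgebra.ι ℂ (Y, 0))
      (TensorAlgebra.ι ℂ (Y, 0) * TensorAlgebra.ι ℂ (X, 0) + TensorAlgebra.ι ℂ (⁅X, Y⁆, 0))
  | even_odd (X ξ : L) : StdRel
      (TensorAlgebra.ι ℂ (X, 0) * TensorAlgebra.ι ℂ (0, ξ))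
      (TensorAlgebra.ι ℂ (0, ξ) * TensorAlgebra.ι ℂ (X, 0) + TensorAlgebra.ι ℂ (0, ⁅X, ξ⁆))
  | odd_odd (ξ η : L) : StdRel
      (TensorAlgebra.ι ℂ (0, ξ) * TensorAlgebra.ι ℂ (0, η))
      (-(TensorAlgebra.ι ℂ (0, η) * TensorAlgebra.ι ℂ (0, ξ)))

/-- The standard complex `N(L) = U(L) ⊗ ⋀ L` with its DG algebra structure, that is, the universal
enveloping algebra of the DG Lie algebra `L_`. -/
def StdAlg : Type u := RingQuot (StdRel L)

noncomputable instance : Ring (StdAlg L) := inferInstanceAs (Ring (RingQuot (StdRel L)))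
noncomputable instance : Algebra ℂ (StdAlg L) :=
  inferInstanceAs (Algebra ℂ (RingQuot (StdRel L)))

namespace StdAlg
variable {L}

/-- The quotient map from the tensor algebra. -/
noncomputable def mk : TensorAlgebra ℂ (L × L) →ₐ[ℂ] StdAlg L := RingQuot.mkAlgHom ℂ (StdRel L)

/-- The inclusion of `L` in degree `0`. -/
noncomputable def even : L →ₗ[ℂ] StdAlg L :=
  mk.toLinearMap ∘ₗ TensorAlgebra.ι ℂ ∘ₗ LinearMap.inl ℂ L L

/-- The inclusion of `L` in degree `-1`. -/
noncomputable def odd : L →ₗ[ℂ] StdAlg L :=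
  mk.toLinearMap ∘ₗ TensorAlgebra.ι ℂ ∘ₗ LinearMap.inr ℂ L L

theorem even_apply (X : L) : even X = mk (TensorAlgebra.ι ℂ (X, 0)) := rfl
theorem odd_apply (X : L) : odd X = mk (TensorAlgebra.ι ℂ (0, X)) := rfl

theorem even_mul_even (X Y : L) : even X * even Y = even Y * even X + even ⁅X, Y⁆ := by
  simp only [even_apply, ← map_mul, ← map_add]
  exact RingQuot.mkAlgHom_rel ℂ (StdRel.even_even X Y)

theorem even_mul_odd (X Y : L) : even X * odd Y = odd Y * even X + odd ⁅X, Y⁆ := by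
  simp only [even_apply, odd_apply, ← map_mul, ← map_add]
  exact RingQuot.mkAlgHom_rel ℂ (StdRel.even_odd X Y)

theorem odd_mul_odd (X Y : L) : odd X * odd Y = -(odd Y * odd X) := by
  simp only [odd_apply, ← map_mul, ← map_neg]
  exact RingQuot.mkAlgHom_rel ℂ (StdRel.odd_odd X Y)

section lift
variable {A : Type v} [Ring A] [Algebra ℂ A]

/-- The universal property of `N(L)` as an algebra. -/
noncomputable def lift (f g : L →ₗ[ℂ] A)
    (h₀ : ∀ X Y, f X * f Y = f Y * f X + f ⁅X, Y⁆)
    (h₁ : ∀ X Y, f X * g Y = g Y * f X + g ⁅X, Y⁆)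
    (h₂ : ∀ X Y, g X * g Y = -(g Y * g X)) : StdAlg L →ₐ[ℂ] A :=
  RingQuot.liftAlgHom ℂ ⟨TensorAlgebra.lift ℂ (f.coprod g), by
    intro x y h
    cases h with
    | even_even X Y => simpa using h₀ X Y
    | even_odd X Y => simpa using h₁ X Y
    | odd_odd X Y => simpa using h₂ X Y⟩

variable (f g : L →ₗ[ℂ] A)
    (h₀ : ∀ X Y, f X * f Y = f Y * f X + f ⁅X, Y⁆)
    (h₁ : ∀ X Y, f X * g Y = g Y * f X + g ⁅X, Y⁆)
    (h₂ : ∀ X Y, g X * g Y = -(g Y * g X))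

@[simp] theorem lift_even (X : L) : lift f g h₀ h₁ h₂ (even X) = f X := by
  rw [even_apply]
  exact (RingQuot.liftAlgHom_mkAlgHom_apply ℂ _ _ _).trans (by simp)

@[simp] theorem lift_odd (X : L) : lift f g h₀ h₁ h₂ (odd X) = g X := by
  rw [odd_apply]
  exact (RingQuot.liftAlgHom_mkAlgHom_apply ℂ _ _ _).trans (by simp)
end lift

theorem induction {P : StdAlg L → Prop} (halg : ∀ c, P (algebraMap ℂ _ c))
    (heven : ∀ X, P (even X)) (hodd : ∀ X, P (odd X)) (hmul : ∀ a b, P a → P b → P (a * b))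
    (hadd : ∀ a b, P a → P b → P (a + b)) (a : StdAlg L) : P a := by
  obtain ⟨b, rfl⟩ := RingQuot.mkAlgHom_surjective ℂ (StdRel L) a
  change P (mk b)
  induction b using TensorAlgebra.induction with
  | algebraMap r => rw [AlgHom.commutes]; exact halg r
  | ι x =>
    have : mk (TensorAlgebra.ι ℂ x) = even x.1 + odd x.2 := by
      rw [even_apply, odd_apply, ← map_add, ← map_add]; simp
    rw [this]; exact hadd _ _ (heven _) (hodd _)
  | mul a b ha hb => rw [map_mul]; exact hmul _ _ ha hb
  | add a b ha hb => rw [map_add]; exact hadd _ _ ha hb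

/-- The algebra automorphism `a ↦ (-1)^(deg a) a`. -/
noncomputable def sign : StdAlg L →ₐ[ℂ] StdAlg L :=
  lift even (-odd) even_mul_even
    (fun X Y => by
      simp only [LinearMap.neg_apply, mul_neg, neg_mul, even_mul_odd X Y]; abel)
    (fun X Y => by simp [odd_mul_odd X Y])

@[simp] theorem sign_even (X : L) : sign (even X) = even X := by simp [sign]
@[simp] theorem sign_odd (X : L) : sign (odd X) = -odd X := by simp [sign]

/-- The algebra homomorphism `a ↦ !![sign a, d a; 0, a]`, used to construct `d`. -/
noncomputable def dMatrix : StdAlg L →ₐ[ℂ] Matrix (Fin 2) (Fin 2) (StdAlg L) :=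
  lift
    { toFun := fun X => !![even X, 0; 0, even X]
      map_add' := fun X Y => by ext i j; fin_cases i <;> fin_cases j <;> simp
      map_smul' := fun c X => by ext i j; fin_cases i <;> fin_cases j <;> simp }
    { toFun := fun X => !![-odd X, even X; 0, odd X]
      map_add' := fun X Y => by ext i j; fin_cases i <;> fin_cases j <;> simp [add_comm]
      map_smul' := fun c X => by ext i j; fin_cases i <;> fin_cases j <;> simp }
    (fun X Y => by
      ext i j; fin_cases i <;> fin_cases j <;> simp [even_mul_even X Y])
    (fun X Y => by
      ext i j
      fin_cases i <;> fin_cases j <;> simp [even_mul_odd X Y, even_mul_even X Y]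
      abel)
    (fun X Y => by
      have hs : odd ⁅Y, X⁆ = -(odd ⁅X, Y⁆ : StdAlg L) := by rw [← lie_skew, map_neg]
      ext i j
      fin_cases i <;> fin_cases j <;>
        simp [odd_mul_odd X Y, even_mul_odd X Y, even_mul_odd Y X, hs]
      abel)

/-- The differential of `N(L)`: the odd derivation (see `d_mul`) with `d ξ = ξ` (from degree `-1` to
degree `0`) and `d X = 0` on the generators (see `d_odd`, `d_even`). -/
noncomputable def d : StdAlg L →ₗ[ℂ] StdAlg L where
  toFun a := dMatrix a 0 1
  map_add' a b := by simp
  map_smul' c a := by simp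

theorem dMatrix_aux (a : StdAlg L) :
    dMatrix a 0 0 = sign a ∧ dMatrix a 1 0 = 0 ∧ dMatrix a 1 1 = a := by
  induction a using induction with
  | halg c => simp [Matrix.algebraMap_matrix_apply]
  | heven X => simp [dMatrix]
  | hodd X => simp [dMatrix]
  | hmul a b ha hb => simp [Matrix.mul_apply, Fin.sum_univ_two, ha, hb]
  | hadd a b ha hb => simp [ha, hb]

@[simp] theorem d_even (X : L) : d (even X) = 0 := by simp [d, dMatrix]
@[simp] theorem d_odd (X : L) : d (odd X) = even X := by simp [d, dMatrix]
@[simp] theorem d_algebraMap (c : ℂ) : d (algebraMap ℂ (StdAlg L) c) = 0 := by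
  simp [d, Matrix.algebraMap_matrix_apply]

/-- The graded Leibniz rule. -/
theorem d_mul (a b : StdAlg L) : d (a * b) = d a * b + sign a * d b := by
  simp [d, Matrix.mul_apply, Fin.sum_univ_two, dMatrix_aux, add_comm]

/-- The counit `N(L) → ℂ`. -/
noncomputable def counit : StdAlg L →ₐ[ℂ] ℂ :=
  lift 0 0 (by simp) (by simp) (by simp)

@[simp] theorem counit_even (X : L) : counit (even X) = 0 := by simp [counit]
@[simp] theorem counit_odd (X : L) : counit (odd X) = 0 := by simp [counit]

theorem counit_d (a : StdAlg L) : counit (d a) = 0 := by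
  have key : counit (d a) = 0 ∧ True := by
    induction a using induction with
    | halg c => simp
    | heven X => simp
    | hodd X => simp
    | hmul a b ha hb => simp [d_mul, ha.1, hb.1]
    | hadd a b ha hb => simp [ha.1, hb.1]
  exact key.1

section map
variable {L' : Type v} [LieRing L'] [LieAlgebra ℂ L'] (f : L →ₗ⁅ℂ⁆ L')

/-- The functoriality of `N(L)` in `L`. -/
noncomputable def map : StdAlg L →ₐ[ℂ] StdAlg L' :=
  lift (even ∘ₗ f.toLinearMap) (odd ∘ₗ f.toLinearMap)
    (fun X Y => by simp [even_mul_even (f X) (f Y)])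
    (fun X Y => by simp [even_mul_odd (f X) (f Y)])
    (fun X Y => by simp [odd_mul_odd (f X) (f Y)])

@[simp] theorem map_even (X : L) : map f (even X) = even (f X) := by simp [map]
@[simp] theorem map_odd (X : L) : map f (odd X) = odd (f X) := by simp [map]

theorem sign_map (a : StdAlg L) : sign (map f a) = map f (sign a) := by
  induction a using induction with
  | halg c => simp
  | heven X => simp
  | hodd X => simp
  | hmul a b ha hb => simp [ha, hb]
  | hadd a b ha hb => simp [ha, hb]

theorem d_map (a : StdAlg L) : d (map f a) = map f (d a) := by
  induction a using induction with
  | halg c => simp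
  | heven X => simp
  | hodd X => simp
  | hmul a b ha hb => simp [d_mul, ha, hb, sign_map]
  | hadd a b ha hb => simp [ha, hb]

theorem counit_map (a : StdAlg L) : counit (map f a) = counit a := by
  induction a using induction with
  | halg c => simp
  | heven X => simp
  | hodd X => simp
  | hmul a b ha hb => simp [ha, hb]
  | hadd a b ha hb => simp [ha, hb]

theorem map_id (a : StdAlg L) : map (LieHom.id : L →ₗ⁅ℂ⁆ L) a = a := by
  induction a using induction with
  | halg c => simp
  | heven X => simp
  | hodd X => simp
  | hmul a b ha hb => simp [ha, hb]
  | hadd a b ha hb => simp [ha, hb]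

theorem map_comp {L'' : Type*} [LieRing L''] [LieAlgebra ℂ L''] (g : L' →ₗ⁅ℂ⁆ L'')
    (a : StdAlg L) : map (g.comp f) a = map g (map f a) := by
  induction a using induction with
  | halg c => simp
  | heven X => simp
  | hodd X => simp
  | hmul a b ha hb => simp [ha, hb]
  | hadd a b ha hb => simp [ha, hb]

end map

/-- The inclusion of `U(L)` into `N(L)`. -/
noncomputable def ofEnv : UniversalEnvelopingAlgebra ℂ L →ₐ[ℂ] StdAlg L :=
  UniversalEnvelopingAlgebra.lift ℂ
    { (even : L →ₗ[ℂ] StdAlg L) with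
      map_lie' := fun {X Y} => by
        simp [LieRing.of_associative_ring_bracket, even_mul_even X Y] }

@[simp] theorem ofEnv_ι (X : L) :
    ofEnv (UniversalEnvelopingAlgebra.ι ℂ X) = (even X : StdAlg L) := by
  simp only [ofEnv]
  rw [UniversalEnvelopingAlgebra.lift_ι_apply]; rfl

theorem env_induction {P : UniversalEnvelopingAlgebra ℂ L → Prop}
    (halg : ∀ c, P (algebraMap ℂ _ c))
    (hι : ∀ X, P (UniversalEnvelopingAlgebra.ι ℂ X)) (hmul : ∀ a b, P a → P b → P (a * b))
    (hadd : ∀ a b, P a → P b → P (a + b)) (a : UniversalEnvelopingAlgebra ℂ L) : P a := by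
  let S : Subalgebra ℂ (UniversalEnvelopingAlgebra ℂ L) :=
    { carrier := {a | P a}
      mul_mem' := fun {a b} => hmul a b
      add_mem' := fun {a b} => hadd a b
      algebraMap_mem' := halg }
  let f : L →ₗ⁅ℂ⁆ S :=
    { toFun := fun X => ⟨UniversalEnvelopingAlgebra.ι ℂ X, hι X⟩
      map_add' := fun X Y => by apply Subtype.ext; simp
      map_smul' := fun X Y => by apply Subtype.ext; simp
      map_lie' := fun {X Y} => by
        apply Subtype.ext
        simp [LieRing.of_associative_ring_bracket] }
  have : S.val.comp (UniversalEnvelopingAlgebra.lift ℂ f) = AlgHom.id ℂ _ := by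
    apply UniversalEnvelopingAlgebra.hom_ext
    ext X
    simp only [LieHom.coe_comp, Function.comp_apply, AlgHom.coe_toLieHom, AlgHom.comp_apply]
    rw [UniversalEnvelopingAlgebra.lift_ι_apply]; rfl
  have h := DFunLike.congr_fun this a
  have h2 := (UniversalEnvelopingAlgebra.lift ℂ f a).2
  change S.val _ = a at h
  rw [← h]; exact h2

/-- The functoriality of `U(L)` in `L`. -/
noncomputable def envMap {L' : Type v} [LieRing L'] [LieAlgebra ℂ L'] (f : L →ₗ⁅ℂ⁆ L') :
    UniversalEnvelopingAlgebra ℂ L →ₐ[ℂ] UniversalEnvelopingAlgebra ℂ L' :=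
  UniversalEnvelopingAlgebra.lift ℂ ((UniversalEnvelopingAlgebra.ι ℂ).comp f)

@[simp] theorem envMap_ι {L' : Type v} [LieRing L'] [LieAlgebra ℂ L'] (f : L →ₗ⁅ℂ⁆ L') (X : L) :
    envMap f (UniversalEnvelopingAlgebra.ι ℂ X) = UniversalEnvelopingAlgebra.ι ℂ (f X) := by
  simp only [envMap]
  rw [UniversalEnvelopingAlgebra.lift_ι_apply]; rfl

theorem map_ofEnv {L' : Type v} [LieRing L'] [LieAlgebra ℂ L'] (f : L →ₗ⁅ℂ⁆ L')
    (a : UniversalEnvelopingAlgebra ℂ L) : map f (ofEnv a) = ofEnv (envMap f a) := by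
  induction a using env_induction with
  | halg c => simp
  | hι X => simp only [envMap_ι, ofEnv_ι, map_even]
  | hmul a b ha hb => simp [ha, hb]
  | hadd a b ha hb => simp [ha, hb]

theorem d_ofEnv (a : UniversalEnvelopingAlgebra ℂ L) : d (ofEnv a) = 0 := by
  induction a using env_induction with
  | halg c => simp
  | hι X => simp only [ofEnv_ι, d_even]
  | hmul a b ha hb => simp [ha, hb, d_mul]
  | hadd a b ha hb => simp [ha, hb]

theorem sign_ofEnv (a : UniversalEnvelopingAlgebra ℂ L) : sign (ofEnv a) = ofEnv a := by
  induction a using env_induction with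
  | halg c => simp
  | hι X => simp only [ofEnv_ι, sign_even]
  | hmul a b ha hb => simp [ha, hb]
  | hadd a b ha hb => simp [ha, hb]

/-- `U(L)` acts on `N(L)` by left multiplication. -/
noncomputable instance : Module (UniversalEnvelopingAlgebra ℂ L) (StdAlg L) :=
  Module.compHom _ (ofEnv (L := L)).toRingHom

theorem env_smul_def (u : UniversalEnvelopingAlgebra ℂ L) (a : StdAlg L) :
    u • a = ofEnv u * a := rfl

instance : IsScalarTower ℂ (UniversalEnvelopingAlgebra ℂ L) (StdAlg L) :=
  ⟨fun c u a => by simp [env_smul_def]⟩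

/-- The component `U(L) ⊗ ⋀^p L` of `N(L)`, in degree `-p`: all sums of products `u ξ₁ ⋯ ξₚ` with
`u ∈ U(L)` and `ξ₁, …, ξₚ ∈ L` in degree `-1`. -/
noncomputable def degree (p : ℕ) : Submodule (UniversalEnvelopingAlgebra ℂ L) (StdAlg L) :=
  Submodule.span _ (Set.range fun ξ : Fin p → L => (List.ofFn fun i => odd (ξ i)).prod)

theorem prod_mem_degree {p : ℕ} (ξ : Fin p → L) :
    (List.ofFn fun i => odd (ξ i)).prod ∈ (degree p : Submodule _ (StdAlg L)) :=
  Submodule.subset_span ⟨ξ, rfl⟩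

theorem odd_mul_ofEnv (ξ : L) (u : UniversalEnvelopingAlgebra ℂ L) :
    odd ξ * ofEnv u ∈ Submodule.span (UniversalEnvelopingAlgebra ℂ L)
      (Set.range (odd : L → StdAlg L)) := by
  induction u using env_induction generalizing ξ with
  | halg c =>
    have : odd ξ * ofEnv (algebraMap ℂ _ c) = c • odd ξ := by
      rw [AlgHom.commutes, ← Algebra.commutes, Algebra.smul_def]
    rw [this]
    exact Submodule.smul_of_tower_mem _ c (Submodule.subset_span ⟨ξ, rfl⟩)
  | hι X =>
    have : odd ξ * ofEnv (UniversalEnvelopingAlgebra.ι ℂ X) =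
        UniversalEnvelopingAlgebra.ι ℂ X • odd ξ - odd ⁅X, ξ⁆ := by
      rw [env_smul_def, ofEnv_ι, even_mul_odd]; abel
    rw [this]
    exact Submodule.sub_mem _ (Submodule.smul_mem _ _ (Submodule.subset_span ⟨ξ, rfl⟩))
      (Submodule.subset_span ⟨_, rfl⟩)
  | hmul a b ha hb =>
    rw [map_mul, ← mul_assoc]
    have := ha ξ
    generalize odd ξ * ofEnv a = z at this
    induction this using Submodule.span_induction with
    | mem x hx => obtain ⟨η, rfl⟩ := hx; exact hb η
    | zero => simp
    | add x y _ _ hx hy => rw [add_mul]; exact Submodule.add_mem _ hx hy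
    | smul c x _ hx =>
      rw [env_smul_def, mul_assoc, ← env_smul_def]; exact Submodule.smul_mem _ _ hx
  | hadd a b ha hb => rw [map_add, mul_add]; exact Submodule.add_mem _ (ha ξ) (hb ξ)

theorem odd_mul_mem_degree (ξ : L) {p : ℕ} {x : StdAlg L} (hx : x ∈ degree p) :
    odd ξ * x ∈ degree (p + 1) := by
  induction hx using Submodule.span_induction generalizing ξ with
  | mem x hx =>
    obtain ⟨η, rfl⟩ := hx
    have := prod_mem_degree (Fin.cons ξ η : Fin (p + 1) → L)
    simpa [List.ofFn_succ] using this
  | zero => simp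
  | add x y _ _ hx hy => rw [mul_add]; exact Submodule.add_mem _ (hx ξ) (hy ξ)
  | smul u x _ hx =>
    rw [env_smul_def, ← mul_assoc]
    have := odd_mul_ofEnv ξ u
    generalize odd ξ * ofEnv u = z at this
    induction this using Submodule.span_induction with
    | mem y hy => obtain ⟨η, rfl⟩ := hy; exact hx η
    | zero => simp
    | add a b _ _ ha hb => rw [add_mul]; exact Submodule.add_mem _ ha hb
    | smul c a _ ha =>
      rw [env_smul_def, mul_assoc, ← env_smul_def]; exact Submodule.smul_mem _ _ ha

/-- `d` as a `U(L)`-linear map. -/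
noncomputable def dEnv : StdAlg L →ₗ[UniversalEnvelopingAlgebra ℂ L] StdAlg L where
  toFun := d
  map_add' := d.map_add
  map_smul' u a := by simp [env_smul_def, d_mul, d_ofEnv, sign_ofEnv]

theorem d_mem_degree {p : ℕ} {x : StdAlg L} (hx : x ∈ degree (p + 1)) : d x ∈ degree p := by
  change x ∈ (degree p).comap dEnv
  revert x
  change degree (p + 1) ≤ (degree p).comap dEnv
  refine Submodule.span_le.2 ?_
  rintro _ ⟨ξ, rfl⟩
  change d (List.ofFn fun i => odd (ξ i)).prod ∈ degree p
  induction p with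
  | zero =>
    simp only [List.ofFn_succ, List.ofFn_zero, List.prod_cons, List.prod_nil, mul_one, d_odd]
    rw [← ofEnv_ι, ← mul_one (ofEnv _), ← env_smul_def]
    exact Submodule.smul_mem _ _ (by simpa using prod_mem_degree (Fin.elim0 : Fin 0 → L))
  | succ p ih =>
    rw [List.ofFn_succ, List.prod_cons, d_mul, d_odd, sign_odd, neg_mul, ← ofEnv_ι,
      ← env_smul_def]
    exact Submodule.add_mem _ (Submodule.smul_mem _ _ (prod_mem_degree _))
      (Submodule.neg_mem _ (odd_mul_mem_degree _ (ih _)))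

theorem map_mem_degree {L' : Type v} [LieRing L'] [LieAlgebra ℂ L'] (f : L →ₗ⁅ℂ⁆ L') {p : ℕ}
    {x : StdAlg L} (hx : x ∈ degree p) : map f x ∈ degree p := by
  induction hx using Submodule.span_induction with
  | mem x hx =>
    obtain ⟨η, rfl⟩ := hx
    rw [map_list_prod, List.map_ofFn]
    have := prod_mem_degree (fun i => f (η i))
    simpa [Function.comp_def] using this
  | zero => simp
  | add x y _ _ hx hy => rw [map_add]; exact Submodule.add_mem _ hx hy
  | smul u x _ hx =>
    rw [env_smul_def, map_mul, map_ofEnv, ← env_smul_def]; exact Submodule.smul_mem _ _ hx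

section Rel
variable {S : Type v} [LieRing S] [LieAlgebra ℂ S] (φ : S →ₗ⁅ℂ⁆ L)

/-- The span of all `n m - n ε(m)`, for `n ∈ N(L)` and `m ∈ N(S)`, where `N(S)` acts on `N(L)` by right
multiplication through `φ : S → L`, and on `ℂ` through the counit `ε`. It is closed under the left
multiplication by `U(L)`. -/
noncomputable def relations : Submodule (UniversalEnvelopingAlgebra ℂ L) (StdAlg L) :=
  Submodule.span _ {x | ∃ (n : StdAlg L) (m : StdAlg S), x = n * map φ m - counit m • n}

theorem rel_mem (n : StdAlg L) (m : StdAlg S) :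
    n * map φ m - counit m • n ∈ relations φ := Submodule.subset_span ⟨n, m, rfl⟩

/-- `N(L) ⊗_{N(S)} ℂ`. -/
abbrev RelStd : Type u := StdAlg L ⧸ relations φ

/-- The component of `N(L) ⊗_{N(S)} ℂ` in degree `-p`. -/
noncomputable def relDegree (p : ℕ) : Submodule (UniversalEnvelopingAlgebra ℂ L) (RelStd φ) :=
  (degree p).map (relations φ).mkQ

theorem relations_le_comap_d : relations φ ≤ (relations φ).comap dEnv := by
  refine Submodule.span_le.2 ?_
  rintro _ ⟨n, m, rfl⟩
  change d _ ∈ relations φ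
  have : d (n * map φ m - counit m • n) = (d n * map φ m - counit m • d n) +
      (sign n * map φ (d m) - counit (d m) • sign n) := by
    simp [d_mul, d_map, counit_d]; abel
  rw [this]
  exact Submodule.add_mem _ (rel_mem φ _ _) (rel_mem φ _ _)

/-- The differential induced on `N(L) ⊗_{N(S)} ℂ`. -/
noncomputable def relDTotal : RelStd φ →ₗ[UniversalEnvelopingAlgebra ℂ L] RelStd φ :=
  Submodule.mapQ _ _ dEnv (relations_le_comap_d φ)

/-- The differential from degree `-(p+1)` to degree `-p`. -/
noncomputable def relD (p : ℕ) :
    relDegree φ (p + 1) →ₗ[UniversalEnvelopingAlgebra ℂ L] relDegree φ p :=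
  (relDTotal φ).restrict (by
    rintro _ ⟨x, hx, rfl⟩
    exact ⟨d x, d_mem_degree hx, rfl⟩)

theorem relations_le_ker_counit {x : StdAlg L} (hx : x ∈ relations φ) : counit x = 0 := by
  induction hx using Submodule.span_induction with
  | mem x hx => obtain ⟨n, m, rfl⟩ := hx; simp [counit_map, mul_comm]
  | zero => simp
  | add x y _ _ hx hy => simp [hx, hy]
  | smul u x _ hx => simp [env_smul_def, hx]

/-- The map induced on `N(L) ⊗_{N(S)} ℂ` by compatible endomorphisms of `L` and `S`. -/
noncomputable def relMap (f : L →ₗ⁅ℂ⁆ L) (g : S →ₗ⁅ℂ⁆ S) (h : φ.comp g = f.comp φ) :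
    RelStd φ →ₛₗ[(envMap f).toRingHom] RelStd φ :=
  Submodule.mapQ (relations φ) (relations φ)
    { toFun := map f
      map_add' := (map f).map_add
      map_smul' := fun u x => by
        rw [env_smul_def, map_mul, map_ofEnv]; rfl } (by
    refine Submodule.span_le.2 ?_
    rintro _ ⟨n, m, rfl⟩
    change map f _ ∈ relations φ
    have : map f (n * map φ m - counit m • n) =
        map f n * map φ (map g m) - counit (map g m) • map f n := by
      rw [← map_comp, h, map_comp, counit_map]; simp
    rw [this]
    exact rel_mem φ _ _)

theorem relMap_mk (f : L →ₗ⁅ℂ⁆ L) (g : S →ₗ⁅ℂ⁆ S) (h : φ.comp g = f.comp φ) (x : StdAlg L) :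
    relMap φ f g h ((relations φ).mkQ x) = (relations φ).mkQ (map f x) := rfl

end Rel

end StdAlg
end Std

namespace AlgGroup

section Adjoint
variable {K : Type u} [Group K] [AlgGroup K]

/-- `f ↦ f ∘ inv`. -/
def invCoord : Coord K →ₐ[ℂ] Coord K where
  toFun f := ⟨fun x => f.1 x⁻¹, inv_regular f.1 f.2⟩
  map_one' := rfl
  map_mul' _ _ := rfl
  map_zero' := rfl
  map_add' _ _ := rfl
  commutes' _ := rfl

@[simp] theorem invCoord_apply (f : Coord K) (x : K) : (invCoord f).1 x = f.1 x⁻¹ := rfl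

theorem exists_comul (f : Coord K) : ∃ (n : ℕ) (a b : Fin n → Coord K),
    (∀ x y : K, f.1 (x * y) = ∑ i, (a i).1 x * (b i).1 y) := mul_regular f.1 f.2

theorem leftTrans_eq {f : Coord K} {n : ℕ} {a b : Fin n → Coord K}
    (h : ∀ x y : K, f.1 (x * y) = ∑ i, (a i).1 x * (b i).1 y) (x : K) :
    leftTrans x f = ∑ i, (a i).1 x • b i := by
  apply Subtype.ext; funext y; simp [h]

theorem rightTrans_eq {f : Coord K} {n : ℕ} {a b : Fin n → Coord K}
    (h : ∀ x y : K, f.1 (x * y) = ∑ i, (a i).1 x * (b i).1 y) (x : K) :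
    rightTrans x f = ∑ i, (b i).1 x • a i := by
  apply Subtype.ext; funext y; simp [h, mul_comm]

theorem leftTrans_one (f : Coord K) : leftTrans (1 : K) f = f := by
  apply Subtype.ext; funext y; simp

theorem rightTrans_one (f : Coord K) : rightTrans (1 : K) f = f := by
  apply Subtype.ext; funext y; simp

theorem LieAlg.invCoord (η : LieAlg K) (f : Coord K) :
    (η.1 (invCoord f)).1 1 = -(η.1 f).1 1 := by
  obtain ⟨n, a, b, h⟩ := exists_comul f
  have h1 : ∑ i, a i * AlgGroup.invCoord (b i) = algebraMap ℂ (Coord K) (f.1 1) := by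
    apply Subtype.ext; funext x
    have := h x x⁻¹
    simp only [mul_inv_cancel] at this
    simp [this]
  have h2 : (η.1 (∑ i, a i * AlgGroup.invCoord (b i))).1 1 = 0 := by rw [h1]; simp
  have h3 : f = ∑ i, (b i).1 1 • a i := by rw [← rightTrans_eq h, rightTrans_one]
  have h4 : f = ∑ i, (a i).1 1 • b i := by rw [← leftTrans_eq h, leftTrans_one]
  have h5 : (η.1 f).1 1 = ∑ i, (b i).1 1 * (η.1 (a i)).1 1 := by
    conv_lhs => rw [h3]
    simp
  have h6 : (η.1 (AlgGroup.invCoord f)).1 1 =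
      ∑ i, (a i).1 1 * (η.1 (AlgGroup.invCoord (b i))).1 1 := by
    conv_lhs => rw [h4]
    simp
  rw [h5, h6, eq_neg_iff_add_eq_zero, ← Finset.sum_add_distrib, ← h2]
  simp

/-- The function `k ↦ (Ad(k) X)(F)(1)` is regular, and its differential is given by the bracket. -/
theorem exists_adj_coeff (X : LieAlg K) (F : Coord K) : ∃ c : Coord K,
    (∀ k : K, c.1 k = ((adj k X).1 F).1 1) ∧
      ∀ η : LieAlg K, (η.1 c).1 1 = (((⁅η, X⁆ : LieAlg K)).1 F).1 1 := by
  obtain ⟨n, a, b, h⟩ := exists_comul F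
  refine ⟨∑ i, invCoord (b i) * X.1 (a i), fun k => ?_, fun η => ?_⟩
  · rw [adj_apply, rightTrans_eq h]
    simp
  · have h3 : F = ∑ i, (b i).1 1 • a i := by rw [← rightTrans_eq h, rightTrans_one]
    have h4 : η.1 F = ∑ i, (η.1 (b i)).1 1 • a i := by
      apply Subtype.ext; funext x
      rw [LieAlg.apply_eq, leftTrans_eq h]
      simp [mul_comm]
    have h5 : (((⁅η, X⁆ : LieAlg K)).1 F).1 1 = (η.1 (X.1 F)).1 1 - (X.1 (η.1 F)).1 1 := by
      simp [Derivation.commutator_apply]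
    rw [h5, h4]
    conv_rhs => rw [h3]
    simp [LieAlg.invCoord, Finset.sum_add_distrib, mul_comm]
    ring

variable (K) in
theorem exists_separating : ∃ S : Finset (Coord K), ∀ X : LieAlg K,
    (∀ s ∈ S, (X.1 s).1 1 = 0) → X = 0 := by
  have : Algebra.FiniteType ℂ (Coord K) := (Subalgebra.fg_iff_finiteType _).1 AlgGroup.fg
  obtain ⟨S, hS⟩ := this.out
  refine ⟨S, fun X hX => LieAlg.ext_one fun f => ?_⟩
  have hf : f ∈ Algebra.adjoin ℂ (S : Set (Coord K)) := by rw [hS]; trivial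
  change (X.1 f).1 1 = 0
  induction hf using Algebra.adjoin_induction with
  | mem x hx => exact hX x hx
  | algebraMap r => simp
  | add x y _ _ hx hy => simp [hx, hy]
  | mul x y _ _ hx hy => simp [hx, hy]

/-- The values at `1` of a left invariant derivation on finitely many functions. -/
def evalOn (S : Finset (Coord K)) : LieAlg K →ₗ[ℂ] (S → ℂ) where
  toFun X s := (X.1 s.1).1 1
  map_add' X Y := by funext s; simp
  map_smul' c X := by funext s; simp

instance : FiniteDimensional ℂ (LieAlg K) := by
  obtain ⟨S, hS⟩ := exists_separating K
  refine FiniteDimensional.of_injective (evalOn S) ?_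
  rw [← LinearMap.ker_eq_bot, LinearMap.ker_eq_bot']
  exact fun X hX => hS X fun s hs => congrFun hX ⟨s, hs⟩

theorem exists_functional (l : LieAlg K →ₗ[ℂ] ℂ) :
    ∃ F : Coord K, ∀ X : LieAlg K, l X = (X.1 F).1 1 := by
  classical
  obtain ⟨S, hS⟩ := exists_separating K
  have hinj : LinearMap.ker (evalOn S) = ⊥ := by
    rw [LinearMap.ker_eq_bot']
    exact fun X hX => hS X fun s hs => congrFun hX ⟨s, hs⟩
  obtain ⟨g, hg⟩ := LinearMap.exists_leftInverse_of_injective _ hinj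
  refine ⟨∑ s : S, l (g (Pi.single s 1)) • s.1, fun X => ?_⟩
  have h1 : X = g (evalOn S X) := (DFunLike.congr_fun hg X).symm
  have h2 : evalOn S X = ∑ s : S, (X.1 s.1).1 1 • (Pi.single s 1 : S → ℂ) := by
    rw [← Finset.univ_sum_single (evalOn S X)]
    refine Finset.sum_congr rfl fun s _ => ?_
    rw [← Pi.single_smul]; simp [evalOn]
  conv_lhs => rw [h1, h2]
  simp [mul_comm]

theorem exists_adj_expansion (X : LieAlg K) : ∃ (n : ℕ) (c : Fin n → Coord K)
    (Y : Fin n → LieAlg K), (∀ k : K, adj k X = ∑ i, (c i).1 k • Y i) ∧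
      ∀ η : LieAlg K, ⁅η, X⁆ = ∑ i, (η.1 (c i)).1 1 • Y i := by
  let b := Module.finBasis ℂ (LieAlg K)
  choose F hF using fun i => exists_functional (b.coord i)
  choose c hc hd using fun i => exists_adj_coeff X (F i)
  refine ⟨_, c, b, fun k => ?_, fun η => ?_⟩
  · conv_lhs => rw [← b.sum_repr (adj k X)]
    refine Finset.sum_congr rfl fun i _ => ?_
    rw [hc, ← hF]; rfl
  · conv_lhs => rw [← b.sum_repr ⁅η, X⁆]
    refine Finset.sum_congr rfl fun i _ => ?_
    rw [hd, ← hF]; rfl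

end Adjoint

end AlgGroup

section Main
open AlgGroup CategoryTheory

section Rep
variable {G : Type u} [Group G] [AlgGroup G] {V : Type v} [AddCommGroup V] [Module ℂ V]

/-- Algebraic representations: `V` is the union of finite-dimensional invariant subspaces on which the
matrix coefficients are regular functions. -/
def IsAlgebraicRep (ν : Representation ℂ G V) : Prop :=
  ∀ v : V, ∃ W : Submodule ℂ V, v ∈ W ∧ FiniteDimensional ℂ W ∧ (∀ g, ∀ w ∈ W, ν g w ∈ W) ∧
    ∀ w ∈ W, ∀ l : Module.Dual ℂ V,
      (fun g => l (ν g w)) ∈ (AlgGroup.regular : Subalgebra ℂ (G → ℂ))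

theorem isAlgebraicRep_of_expansion {ν : Representation ℂ G V}
    (h : ∀ v : V, ∃ (ι : Type) (_ : Fintype ι) (c : ι → Coord G) (w : ι → V),
      ∀ g, ν g v = ∑ i, (c i).1 g • w i) : IsAlgebraicRep ν := by
  intro v
  obtain ⟨ι, _, c, w, hc⟩ := h v
  refine ⟨Submodule.span ℂ (Set.range fun g => ν g v), ?_, ?_, ?_, ?_⟩
  · exact Submodule.subset_span ⟨1, by simp⟩
  · have : Submodule.span ℂ (Set.range fun g => ν g v) ≤ Submodule.span ℂ (Set.range w) := by
      refine Submodule.span_le.2 ?_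
      rintro _ ⟨g, rfl⟩
      simp only [hc]
      exact Submodule.sum_mem _ fun i _ =>
        Submodule.smul_mem _ _ (Submodule.subset_span ⟨i, rfl⟩)
    have h2 : FiniteDimensional ℂ (Submodule.span ℂ (Set.range w)) :=
      FiniteDimensional.span_of_finite ℂ (Set.finite_range w)
    exact Submodule.finiteDimensional_of_le this
  · intro g x hx
    induction hx using Submodule.span_induction with
    | mem x hx =>
      obtain ⟨s, rfl⟩ := hx
      exact Submodule.subset_span ⟨g * s, by simp⟩
    | zero => simp
    | add x y _ _ hx hy => rw [map_add]; exact Submodule.add_mem _ hx hy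
    | smul a x _ hx => rw [map_smul]; exact Submodule.smul_mem _ _ hx
  · intro x hx l
    induction hx using Submodule.span_induction with
    | mem x hx =>
      obtain ⟨s, rfl⟩ := hx
      have : (fun g => l (ν g (ν s v))) = ∑ i, l (w i) • (rightTrans s (c i)).1 := by
        funext g
        have h1 : ν g (ν s v) = ν (g * s) v := by simp
        rw [h1, hc]
        simp [mul_comm]
      rw [this]
      exact Subalgebra.sum_mem _ fun i _ => Subalgebra.smul_mem _ (rightTrans s (c i)).2 _
    | zero =>
      have : (fun g => l (ν g 0)) = 0 := by funext g; simp
      rw [this]; exact Subalgebra.zero_mem _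
    | add x y _ _ hx hy =>
      have : (fun g => l (ν g (x + y))) = (fun g => l (ν g x)) + fun g => l (ν g y) := by
        funext g; simp
      rw [this]; exact Subalgebra.add_mem _ hx hy
    | smul a x _ hx =>
      have : (fun g => l (ν g (a • x))) = a • (fun g => l (ν g x)) := by
        funext g; simp
      rw [this]; exact Subalgebra.smul_mem _ hx a

end Rep

/-- Reductive groups (in characteristic zero): every finite-dimensional algebraic representation is
completely reducible. -/
def IsReductive (G : Type u) [Group G] [AlgGroup G] : Prop :=
  ∀ (n : ℕ) (ν : Representation ℂ G (Fin n → ℂ)), IsAlgebraicRep ν →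
    ∀ W : Submodule ℂ (Fin n → ℂ), (∀ g, ∀ w ∈ W, ν g w ∈ W) →
      ∃ W' : Submodule ℂ (Fin n → ℂ), (∀ g, ∀ w ∈ W', ν g w ∈ W') ∧ IsCompl W W'

/-- The enveloping algebra of the Lie algebra of `G`. -/
abbrev Env (G : Type u) [Group G] [AlgGroup G] : Type u := UniversalEnvelopingAlgebra ℂ (LieAlg G)

section HC
variable {T K : Type u} [Group T] [AlgGroup T] [Group K] [AlgGroup K]

/-- A `U(𝔨)`-module `V` with an action `ν` of `T` is a `(𝔨, T)`-module (with respect to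
`γ : T → K`, where `𝔨` is the Lie algebra of `K`) if the action of `T` is algebraic, the action of
`U(𝔨)` is `T`-equivariant, and the differential of `ν` is the action of `Lie(T)` through `dγ`.
The differential is expressed by matrix coefficients: for `v ∈ V`, `dν(ξ)v` is the vector such that
every linear form `l` takes on it the derivative at `1`, along `ξ`, of the regular function
`t ↦ l(ν(t)v)`. -/
structure IsHCModule (γ : AlgGroup.Hom T K) {V : Type v} [AddCommGroup V] [Module ℂ V]
    [Module (Env K) V] (ν : Representation ℂ T V) : Prop where
  algebraic : IsAlgebraicRep ν
  equivariant : ∀ (t : T) (a : Env K) (v : V),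
    ν t (a • v) = StdAlg.envMap (adj (γ t)) a • ν t v
  differential : ∀ (ξ : LieAlg T) (v : V) (l : Module.Dual ℂ V) (c : Coord T),
    (∀ t, c.1 t = l (ν t v)) →
      (ξ.1 c).1 1 = l (UniversalEnvelopingAlgebra.ι ℂ (γ.differential ξ) • v)

/-- The category of `(𝔨, T)`-modules. -/
structure HCMod (γ : AlgGroup.Hom T K) where
  carrier : Type u
  [addCommGroup : AddCommGroup carrier]
  [module : Module ℂ carrier]
  [moduleEnv : Module (Env K) carrier]
  [isScalarTower : IsScalarTower ℂ (Env K) carrier]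
  ν : Representation ℂ T carrier
  isHC : IsHCModule γ ν

namespace HCMod
attribute [instance] addCommGroup module moduleEnv isScalarTower

variable {γ : AlgGroup.Hom T K}

instance : CoeSort (HCMod γ) (Type u) := ⟨HCMod.carrier⟩

/-- Morphisms: linear maps that commute with `U(𝔨)` and with `T`. -/
@[ext]
structure Hom (M N : HCMod γ) where
  toLinearMap : M →ₗ[Env K] N
  comm : ∀ (t : T) (m : M), toLinearMap (M.ν t m) = N.ν t (toLinearMap m)

instance : Category (HCMod γ) where
  Hom M N := Hom M N
  id M := ⟨LinearMap.id, fun _ _ => rfl⟩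
  comp f g := ⟨g.toLinearMap ∘ₗ f.toLinearMap, fun t m => by simp [f.comm, g.comm]⟩

/-- The underlying `U(𝔨)`-linear map of a morphism. -/
def linearMap {M N : HCMod γ} (f : M ⟶ N) : M →ₗ[Env K] N := Hom.toLinearMap f

end HCMod

/-- The one-dimensional space `ℂ`, as the trivial module of `U(L)`. -/
def TrivMod (_L : Type u) : Type u := ULift.{u} ℂ

namespace TrivMod
variable (L : Type u) [LieRing L] [LieAlgebra ℂ L]
noncomputable instance : AddCommGroup (TrivMod L) := inferInstanceAs (AddCommGroup (ULift ℂ))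
noncomputable instance : Module ℂ (TrivMod L) := inferInstanceAs (Module ℂ (ULift ℂ))
/-- The counit of `U(L)`. -/
noncomputable def envCounit : UniversalEnvelopingAlgebra ℂ L →ₐ[ℂ] ℂ :=
  StdAlg.counit.comp StdAlg.ofEnv
noncomputable instance : Module (UniversalEnvelopingAlgebra ℂ L) (TrivMod L) :=
  Module.compHom _ (envCounit L).toRingHom
variable {L} in
theorem smul_def (u : UniversalEnvelopingAlgebra ℂ L) (x : TrivMod L) :
  u • x = StdAlg.counit (StdAlg.ofEnv u) • x := rfl
instance : IsScalarTower ℂ (UniversalEnvelopingAlgebra ℂ L) (TrivMod L) :=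
  ⟨fun c u x => by simp [smul_def, mul_smul]⟩
end TrivMod

namespace StdAlg
variable {L : Type u} [LieRing L] [LieAlgebra ℂ L] {S : Type v} [LieRing S] [LieAlgebra ℂ S]
  (φ : S →ₗ⁅ℂ⁆ L)

/-- The map `N(L) ⊗_{N(S)} ℂ → ℂ` induced by the counit. -/
noncomputable def relAug : RelStd φ →ₗ[UniversalEnvelopingAlgebra ℂ L] TrivMod L :=
  (relations φ).liftQ
    { toFun := fun x => (ULift.up (counit x) : ULift.{u} ℂ)
      map_add' := fun x y => by rw [map_add]; rfl
      map_smul' := fun u x => by rw [env_smul_def, map_mul]; rfl }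
    (fun x hx => by
      change (ULift.up (counit x) : ULift.{u} ℂ) = ULift.up 0
      rw [relations_le_ker_counit φ hx])

end StdAlg

section Objects
open StdAlg
variable (γ : AlgGroup.Hom T K)

/-- The action of `T` on `N(𝔨) ⊗_{N(𝔱)} ℂ` induced by the adjoint action. -/
noncomputable def relAct (t : T) : RelStd γ.differential →ₗ[ℂ] RelStd γ.differential where
  toFun := relMap γ.differential (adj (γ t)) (adj t) (γ.differential_adj t)
  map_add' := map_add _
  map_smul' c x := by
    rw [← algebraMap_smul (Env K) c x, LinearMap.map_smulₛₗ]
    simp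

theorem relAct_mk (t : T) (x : StdAlg (LieAlg K)) :
    relAct γ t ((relations γ.differential).mkQ x) =
      (relations γ.differential).mkQ (map (adj (γ t)) x) := rfl

theorem relAct_smul (t : T) (a : Env K) (x : RelStd γ.differential) :
    relAct γ t (a • x) = envMap (adj (γ t)) a • relAct γ t x :=
  LinearMap.map_smulₛₗ (relMap γ.differential (adj (γ t)) (adj t) (γ.differential_adj t)) a x

theorem relAct_mem (t : T) (p : ℕ) {x : RelStd γ.differential}
    (hx : x ∈ relDegree γ.differential p) : relAct γ t x ∈ relDegree γ.differential p := by
  obtain ⟨y, hy, rfl⟩ := hx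
  exact ⟨_, map_mem_degree (adj (γ t)) hy, rfl⟩

/-- The action of `T` on the component of degree `-p`. -/
noncomputable def relRep (p : ℕ) : Representation ℂ T (relDegree γ.differential p) where
  toFun t :=
    { toFun := fun x => ⟨relAct γ t x.1, relAct_mem γ t p x.2⟩
      map_add' := fun x y => by apply Subtype.ext; simp
      map_smul' := fun c x => by apply Subtype.ext; simp }
  map_one' := by
    ext v : 1
    obtain ⟨_, y, hy, rfl⟩ := v
    apply Subtype.ext
    change relAct γ 1 ((relations γ.differential).mkQ y) = (relations γ.differential).mkQ y
    rw [relAct_mk, AlgGroup.Hom.map_one, adj_one, map_id]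
  map_mul' s t := by
    ext v : 1
    obtain ⟨_, y, hy, rfl⟩ := v
    apply Subtype.ext
    change relAct γ (s * t) ((relations γ.differential).mkQ y) =
      relAct γ s (relAct γ t ((relations γ.differential).mkQ y))
    rw [relAct_mk, relAct_mk, relAct_mk, AlgGroup.Hom.map_mul, adj_mul, map_comp]

theorem exists_map_adj_expansion (x : StdAlg (LieAlg K)) :
    ∃ (ι : Type) (_ : Fintype ι) (c : ι → Coord T) (w : ι → StdAlg (LieAlg K)),
      (∀ t, map (adj (γ t)) x = ∑ i, (c i).1 t • w i) ∧
      ∀ ξ : LieAlg T, even (γ.differential ξ) * x - x * even (γ.differential ξ) =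
        ∑ i, (ξ.1 (c i)).1 1 • w i := by
  induction x using StdAlg.induction with
  | halg a =>
    refine ⟨Unit, inferInstance, fun _ => 1, fun _ => algebraMap ℂ _ a, fun t => ?_, fun ξ => ?_⟩
    · simp
    · rw [← Algebra.commutes]; simp
  | heven X =>
    obtain ⟨n, c, Y, h1, h2⟩ := exists_adj_expansion X
    refine ⟨Fin n, inferInstance, fun i => γ.pullback (c i), fun i => even (Y i),
      fun t => ?_, fun ξ => ?_⟩
    · simp [h1]
    · rw [even_mul_even, add_sub_cancel_left, h2]
      simp [γ.differential_apply_one]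
  | hodd X =>
    obtain ⟨n, c, Y, h1, h2⟩ := exists_adj_expansion X
    refine ⟨Fin n, inferInstance, fun i => γ.pullback (c i), fun i => odd (Y i),
      fun t => ?_, fun ξ => ?_⟩
    · simp [h1]
    · rw [even_mul_odd, add_sub_cancel_left, h2]
      simp [γ.differential_apply_one]
  | hmul a b ha hb =>
    obtain ⟨ι, _, c, w, h1, h2⟩ := ha
    obtain ⟨κ, _, e, z, h3, h4⟩ := hb
    refine ⟨ι × κ, inferInstance, fun i => c i.1 * e i.2, fun i => w i.1 * z i.2,
      fun t => ?_, fun ξ => ?_⟩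
    · rw [map_mul, h1, h3, Finset.sum_mul_sum, Fintype.sum_prod_type]
      simp [mul_smul_mul_comm]
    · have ea : a = ∑ i, (c i).1 1 • w i := by
        rw [← h1, AlgGroup.Hom.map_one, adj_one, map_id]
      have eb : b = ∑ i, (e i).1 1 • z i := by
        rw [← h3, AlgGroup.Hom.map_one, adj_one, map_id]
      have : even (γ.differential ξ) * (a * b) - a * b * even (γ.differential ξ) =
          (even (γ.differential ξ) * a - a * even (γ.differential ξ)) * b +
          a * (even (γ.differential ξ) * b - b * even (γ.differential ξ)) := by
        noncomm_ring
      rw [this, h2, h4]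
      conv_lhs => rw [ea, eb]
      rw [Finset.sum_mul_sum, Finset.sum_mul_sum, Fintype.sum_prod_type,
        ← Finset.sum_add_distrib]
      refine Finset.sum_congr rfl fun i _ => ?_
      rw [← Finset.sum_add_distrib]
      refine Finset.sum_congr rfl fun j _ => ?_
      simp only [smul_mul_smul_comm, ← add_smul]
      congr 1
      simp
      ring
  | hadd a b ha hb =>
    obtain ⟨ι, _, c, w, h1, h2⟩ := ha
    obtain ⟨κ, _, e, z, h3, h4⟩ := hb
    refine ⟨ι ⊕ κ, inferInstance, Sum.elim c e, Sum.elim w z, fun t => ?_, fun ξ => ?_⟩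
    · simp [h1, h3]
    · simp only [Fintype.sum_sum_type, Sum.elim_inl, Sum.elim_inr, ← h2, ← h4]
      noncomm_ring

theorem exists_relRep_expansion (p : ℕ) (v : relDegree γ.differential p) :
    ∃ (ι : Type) (_ : Fintype ι) (c : ι → Coord T) (w : ι → relDegree γ.differential p),
      (∀ t, relRep γ p t v = ∑ i, (c i).1 t • w i) ∧
      ∀ ξ : LieAlg T, UniversalEnvelopingAlgebra.ι ℂ (γ.differential ξ) • v =
        ∑ i, (ξ.1 (c i)).1 1 • w i := by
  obtain ⟨_, x, hx, rfl⟩ := v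
  obtain ⟨ι, _, c, w, h1, h2⟩ := exists_map_adj_expansion γ x
  obtain ⟨π, hπ⟩ := Submodule.exists_isCompl
    ((relDegree γ.differential p).restrictScalars ℂ)
  let P : RelStd γ.differential →ₗ[ℂ] relDegree γ.differential p :=
    Submodule.projectionOnto ((relDegree γ.differential p).restrictScalars ℂ) π hπ
  have hP : ∀ y : relDegree γ.differential p, P y.1 = y := fun y =>
    Submodule.projectionOnto_apply_left hπ y
  let Q : StdAlg (LieAlg K) →ₗ[ℂ] relDegree γ.differential p :=
    P ∘ₗ (relations γ.differential).mkQ.restrictScalars ℂ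
  refine ⟨ι, inferInstance, c, fun i => Q (w i), fun t => ?_, fun ξ => ?_⟩
  · rw [← hP (relRep γ p t _)]
    change Q (map (adj (γ t)) x) = _
    rw [h1]; simp
  · rw [← hP (_ • _)]
    have h3 : ∑ i, (ξ.1 (c i)).1 1 • Q (w i) =
        Q (even (γ.differential ξ) * x - x * even (γ.differential ξ)) := by
      rw [h2]; simp
    rw [h3]
    change P _ = P ((relations γ.differential).mkQ _)
    congr 1
    rw [map_sub]
    have h4 : (relations γ.differential).mkQ (x * even (γ.differential ξ)) = 0 := by
      rw [Submodule.mkQ_apply, Submodule.Quotient.mk_eq_zero]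
      simpa using rel_mem γ.differential x (even ξ)
    rw [h4, sub_zero, ← ofEnv_ι, ← env_smul_def, LinearMap.map_smul]
    rfl

theorem isHCModule_relRep (p : ℕ) : IsHCModule γ (relRep γ p) where
  algebraic := isAlgebraicRep_of_expansion fun v => by
    obtain ⟨ι, i, c, w, h, _⟩ := exists_relRep_expansion γ p v
    exact ⟨ι, i, c, w, h⟩
  equivariant t a v := Subtype.ext (relAct_smul γ t a v.1)
  differential ξ v l c hc := by
    obtain ⟨ι, _, e, w, h1, h2⟩ := exists_relRep_expansion γ p v
    have : c = ∑ i, l (w i) • e i := by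
      apply Subtype.ext; funext t
      rw [hc, h1]; simp [mul_comm]
    rw [h2, this]; simp [mul_comm]

/-- The component of degree `-p` of `N(𝔨) ⊗_{N(𝔱)} ℂ`, as a `(𝔨, T)`-module. -/
noncomputable def relStd (p : ℕ) : HCMod γ where
  carrier := relDegree γ.differential p
  ν := relRep γ p
  isHC := isHCModule_relRep γ p

/-- The differential of `N(𝔨) ⊗_{N(𝔱)} ℂ`, from degree `-(p+1)` to degree `-p`. -/
noncomputable def relStdD (p : ℕ) : relStd γ (p + 1) ⟶ relStd γ p where
  toLinearMap := relD γ.differential p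
  comm t m := by
    obtain ⟨_, x, hx, rfl⟩ := m
    apply Subtype.ext
    change (relations γ.differential).mkQ (d (map (adj (γ t)) x)) =
      (relations γ.differential).mkQ (map (adj (γ t)) (d x))
    rw [d_map]

/-- The trivial `(𝔨, T)`-module `ℂ`. -/
noncomputable def trivialHC : HCMod γ where
  carrier := TrivMod (LieAlg K)
  ν := 1
  isHC :=
    { algebraic := isAlgebraicRep_of_expansion fun v =>
        ⟨Unit, inferInstance, fun _ => 1, fun _ => v, fun g => by simp⟩
      equivariant := fun t a v => by
        simp [TrivMod.smul_def, ← map_ofEnv, counit_map]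
      differential := fun ξ v l c hc => by
        have : c = algebraMap ℂ (Coord T) (l v) := by
          apply Subtype.ext; funext t; rw [hc]; simp
        rw [this, TrivMod.smul_def, ofEnv_ι]
        simp }

/-- The morphism `N(𝔨) ⊗_{N(𝔱)} ℂ → ℂ` induced by the counit, in degree `0`. -/
noncomputable def relStdAug : relStd γ 0 ⟶ trivialHC γ where
  toLinearMap := (relAug γ.differential).domRestrict _
  comm t m := by
    obtain ⟨_, x, hx, rfl⟩ := m
    change (ULift.up (counit (map (adj (γ t)) x)) : ULift.{u} ℂ) = ULift.up (counit x)
    rw [counit_map]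

end Objects
end HC

end Main

/-! Write L for 𝔨, S for 𝔱, φ for the differential of γ, U for U(L) and R for `relations φ`. By
`mem_of_mem_relations`, R is the left ideal of N(L) generated by φ(S) in degrees 0 and -1, so the
complex is N(L)/R.

Projectivity. The component of degree -p is generated over U by the finite-dimensional T-stable
image of ⋀^p L, and it behaves like U(L) ⊗_{U(S)} ⋀^p(L/S): a linear map on this image that commutes
with S extends to a U-linear map (`exists_extend_relOdd`). The extension comes from making Hom(⋀L,
M) an N(L)-module and evaluating at 1, so the isomorphism N(L) = U ⊗ ⋀L is never needed. A lifting
problem along an epimorphism, which is surjective by `HCMod.surjective_of_epi`, becomes a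
T-equivariant lifting problem for a finite-dimensional representation; reductivity solves it
(`IsReductive.exists_lift`). T-equivariance gives S-equivariance by differentiation
(`IsHCModule.map_smul_of_comm`). Finite generation comes from the same generating space.

Acyclicity. An algebraic analogue of the Poincaré lemma is used. Let f : U → L be linear with f(1) =
0, f(U φ(S)) = 0 and f(X) ≡ X modulo φ(S); f plays the role of coordinates on K/T near the base
point. With the coaction x ↦ ∑ x₁ ⊗ x₂ in U ⊗ N(L), put h(x) = ∑ odd(f(x₁)) x₂. Since f kills U
φ(S), h preserves R. The operator dh + hd is an Euler operator: modulo R and shorter products, it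
multiplies a product of n generators by n (`euler_sub_mem`). In characteristic zero one divides by n
and descends to the constants, where the counit detects everything (`exists_sub_d_mem_relations`).
Homogeneity of d and of R then puts the primitive in the right degree.

Existence of f (`exists_linearMap_env`) needs a PBW basis of U adapted to S, and this is where
injectivity of φ enters. Ordered words span by the usual reordering argument. Their independence
(`linearIndependent_word`) uses that L consists of derivations of ℂ[K]: words act as differential
operators, and on powers of a function vanishing at 1 a word acts through the product of its
first-order symbols. -/

namespace StdAlg
-- Left multiplication by generators, and d² = 0.
variable {L : Type u} [LieRing L] [LieAlgebra ℂ L]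

/-- Induction on `N(L)` by left multiplication with generators. -/
theorem left_induction {P : StdAlg L → Prop} (one : P 1) (smul : ∀ (c : ℂ) a, P a → P (c • a))
    (add : ∀ a b, P a → P b → P (a + b)) (even_mul : ∀ X a, P a → P (even X * a))
    (odd_mul : ∀ X a, P a → P (odd X * a)) (a : StdAlg L) : P a := by
  -- With an arbitrary right factor z, the case of a product reduces to two successive left
  -- multiplications.
  suffices h : ∀ z, P z → P (a * z) by simpa using h 1 one
  induction a using induction with
  | halg c => intro z hz; rw [← Algebra.smul_def]; exact smul c z hz
  | heven X => exact even_mul X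
  | hodd X => exact odd_mul X
  | hmul a b ha hb => intro z hz; rw [mul_assoc]; exact ha _ (hb _ hz)
  | hadd a b ha hb => intro z hz; rw [add_mul]; exact add _ _ (ha z hz) (hb z hz)

theorem d_even_mul (X : L) (a : StdAlg L) : d (even X * a) = even X * d a := by
  simp [d_mul]

theorem d_odd_mul (X : L) (a : StdAlg L) : d (odd X * a) = even X * a - odd X * d a := by
  simp [d_mul, sub_eq_add_neg]

theorem d_one : d (1 : StdAlg L) = 0 := by simpa using d_algebraMap (L := L) 1

theorem d_d (a : StdAlg L) : d (d a) = 0 := by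
  induction a using left_induction with
  | one => simp [d_one]
  | smul c a h => simp [h]
  | add a b ha hb => simp [ha, hb]
  | even_mul X a h => simp [d_even_mul, h]
  | odd_mul X a h => simp [d_odd_mul, d_even_mul, h]

/-! ### The grading of N(L) by the number of odd generators. -/

section Grading

/-- The algebra homomorphism `N(L) → N(L)[z]` that multiplies the component of degree `-p`
by `z ^ p`. -/
noncomputable def gradePoly : StdAlg L →ₐ[ℂ] Polynomial (StdAlg L) :=
  lift ((Polynomial.monomial 0).restrictScalars ℂ ∘ₗ even)
    ((Polynomial.monomial 1).restrictScalars ℂ ∘ₗ odd)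
    (fun X Y => by
      simp [-Polynomial.monomial_zero_left, Polynomial.monomial_mul_monomial, even_mul_even X Y])
    (fun X Y => by
      simp [-Polynomial.monomial_zero_left, Polynomial.monomial_mul_monomial, even_mul_odd X Y])
    (fun X Y => by simp [Polynomial.monomial_mul_monomial, odd_mul_odd X Y])

theorem gradePoly_even (X : L) : gradePoly (even X) = Polynomial.monomial 0 (even X) := by
  simp [gradePoly]

theorem gradePoly_odd (X : L) : gradePoly (odd X) = Polynomial.monomial 1 (odd X) := by
  simp [gradePoly]

theorem gradePoly_ofEnv (u : UniversalEnvelopingAlgebra ℂ L) :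
    gradePoly (ofEnv u) = Polynomial.C (ofEnv u) := by
  induction u using env_induction with
  | halg c => simp [Polynomial.algebraMap_apply]
  | hι X => rw [ofEnv_ι, gradePoly_even, Polynomial.monomial_zero_left]
  | hmul a b ha hb => simp [ha, hb]
  | hadd a b ha hb => simp [ha, hb]

/-- The projection of `N(L)` onto its component of degree `-p`. -/
noncomputable def proj (p : ℕ) : StdAlg L →ₗ[ℂ] StdAlg L where
  toFun a := (gradePoly a).coeff p
  map_add' a b := by simp
  map_smul' c a := by simp

theorem proj_apply (p : ℕ) (a : StdAlg L) : proj p a = (gradePoly a).coeff p := rfl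

theorem proj_zero_one : proj 0 (1 : StdAlg L) = 1 := by simp [proj_apply]

theorem proj_succ_one (p : ℕ) : proj (p + 1) (1 : StdAlg L) = 0 := by
  simp [proj_apply, Polynomial.coeff_one]

theorem proj_ofEnv_mul (p : ℕ) (u : UniversalEnvelopingAlgebra ℂ L) (a : StdAlg L) :
    proj p (ofEnv u * a) = ofEnv u * proj p a := by
  simp [proj_apply, gradePoly_ofEnv]

theorem proj_even_mul (p : ℕ) (X : L) (a : StdAlg L) :
    proj p (even X * a) = even X * proj p a := by
  rw [← ofEnv_ι, proj_ofEnv_mul]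

theorem proj_mul_even (p : ℕ) (X : L) (a : StdAlg L) :
    proj p (a * even X) = proj p a * even X := by
  simp [proj_apply, gradePoly_even]

theorem proj_succ_odd_mul (p : ℕ) (X : L) (a : StdAlg L) :
    proj (p + 1) (odd X * a) = odd X * proj p a := by
  simp [proj_apply, gradePoly_odd, ← Polynomial.C_mul_X_eq_monomial, mul_assoc]

theorem proj_zero_odd_mul (X : L) (a : StdAlg L) : proj 0 (odd X * a) = 0 := by
  simp [proj_apply, gradePoly_odd, Polynomial.mul_coeff_zero]

theorem proj_succ_mul_odd (p : ℕ) (X : L) (a : StdAlg L) :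
    proj (p + 1) (a * odd X) = proj p a * odd X := by
  simp only [proj_apply, map_mul, gradePoly_odd, ← Polynomial.C_mul_X_eq_monomial]
  rw [← mul_assoc, Polynomial.coeff_mul_X, Polynomial.coeff_mul_C]

theorem proj_zero_mul_odd (X : L) (a : StdAlg L) : proj 0 (a * odd X) = 0 := by
  simp [proj_apply, gradePoly_odd, Polynomial.mul_coeff_zero]

theorem proj_mem_degree (p : ℕ) (a : StdAlg L) : proj p a ∈ degree p := by
  induction a using left_induction generalizing p with
  | one =>
    cases p with
    | zero => rw [proj_zero_one]; simpa using prod_mem_degree (Fin.elim0 : Fin 0 → L)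
    | succ p => rw [proj_succ_one]; exact Submodule.zero_mem _
  | smul c a h => rw [map_smul]; exact Submodule.smul_of_tower_mem _ c (h p)
  | add a b ha hb => rw [map_add]; exact Submodule.add_mem _ (ha p) (hb p)
  | even_mul X a h =>
    rw [proj_even_mul, ← ofEnv_ι, ← env_smul_def]; exact Submodule.smul_mem _ _ (h p)
  | odd_mul X a h =>
    cases p with
    | zero => rw [proj_zero_odd_mul]; exact Submodule.zero_mem _
    | succ p => rw [proj_succ_odd_mul]; exact odd_mul_mem_degree X (h p)

theorem proj_eq_self {p : ℕ} {a : StdAlg L} (ha : a ∈ degree p) : proj p a = a := by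
  induction ha using Submodule.span_induction with
  | mem x hx =>
    obtain ⟨ξ, rfl⟩ := hx
    induction p with
    | zero => simp [proj_zero_one]
    | succ p ih =>
      have := ih (fun i => ξ i.succ)
      simp only at this ⊢
      rw [List.ofFn_succ, List.prod_cons, proj_succ_odd_mul, this]
  | zero => simp
  | add x y _ _ hx hy => rw [map_add, hx, hy]
  | smul u x _ hx => rw [env_smul_def, proj_ofEnv_mul, hx]

theorem d_eq_zero_of_mem_degree_zero {a : StdAlg L} (ha : a ∈ degree 0) : d a = 0 := by
  induction ha using Submodule.span_induction with
  | mem x hx => obtain ⟨ξ, rfl⟩ := hx; simp [d_one]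
  | zero => simp
  | add x y _ _ hx hy => rw [map_add, hx, hy, add_zero]
  | smul u x _ hx => rw [env_smul_def, d_mul, d_ofEnv, hx]; simp

theorem counit_eq_zero_of_mem_degree_succ {p : ℕ} {a : StdAlg L} (ha : a ∈ degree (p + 1)) :
    counit a = 0 := by
  induction ha using Submodule.span_induction with
  | mem x hx => obtain ⟨ξ, rfl⟩ := hx; simp [List.ofFn_succ]
  | zero => simp
  | add x y _ _ hx hy => rw [map_add, hx, hy, add_zero]
  | smul u x _ hx => rw [env_smul_def, map_mul, hx, mul_zero]

/-- d trades one odd generator for an even one, so it is homogeneous. This allows an inhomogeneous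
primitive to be replaced by its component in the required degree. -/
theorem proj_d (p : ℕ) (a : StdAlg L) : proj p (d a) = d (proj (p + 1) a) := by
  induction a using left_induction generalizing p with
  | one => simp [d_one, proj_succ_one]
  | smul c a h => simp [h]
  | add a b ha hb => simp [ha, hb]
  | even_mul X a h => simp [d_even_mul, proj_even_mul, h]
  | odd_mul X a h =>
    rw [d_odd_mul, map_sub, proj_even_mul, proj_succ_odd_mul, d_odd_mul]
    cases p with
    | zero => rw [proj_zero_odd_mul, d_eq_zero_of_mem_degree_zero (proj_mem_degree 0 a), mul_zero]
    | succ p => rw [proj_succ_odd_mul, h]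

end Grading

/-! ### The relations as a homogeneous left ideal. -/

section Relations
variable {S : Type v} [LieRing S] [LieAlgebra ℂ S] (φ : S →ₗ⁅ℂ⁆ L)

theorem mul_even_mem_relations (a : StdAlg L) (τ : S) : a * even (φ τ) ∈ relations φ := by
  simpa using rel_mem φ a (even τ)

theorem mul_odd_mem_relations (a : StdAlg L) (τ : S) : a * odd (φ τ) ∈ relations φ := by
  simpa using rel_mem φ a (odd τ)

variable {φ} in
/-- `relations φ` is spanned over `ℂ` by the products `a * even (φ τ)` and `a * odd (φ τ)`. -/
theorem mem_of_mem_relations {Z : Submodule ℂ (StdAlg L)} (he : ∀ a τ, a * even (φ τ) ∈ Z)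
    (ho : ∀ a τ, a * odd (φ τ) ∈ Z) {x : StdAlg L} (hx : x ∈ relations φ) : x ∈ Z := by
  have key : ∀ (m : StdAlg S) (n : StdAlg L), n * map φ m - counit m • n ∈ Z := by
    intro m
    induction m using induction with
    | halg c => intro n; simp [Algebra.smul_def, Algebra.commutes]
    | heven τ => intro n; simpa using he n τ
    | hodd τ => intro n; simpa using ho n τ
    | hmul a b ha hb =>
      intro n
      have : n * map φ (a * b) - counit (a * b) • n =
          ((n * map φ a) * map φ b - counit b • (n * map φ a)) +
            counit b • (n * map φ a - counit a • n) := by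
        simp [mul_assoc, smul_sub, smul_smul, mul_comm]
      rw [this]
      exact Z.add_mem (hb _) (Z.smul_mem _ (ha _))
    | hadd a b ha hb =>
      intro n
      have : n * map φ (a + b) - counit (a + b) • n =
          (n * map φ a - counit a • n) + (n * map φ b - counit b • n) := by
        simp [mul_add, add_smul]; abel
      rw [this]
      exact Z.add_mem (ha _) (hb _)
  -- Z is only a complex subspace; the free left factor b absorbs the scalars from U(L) in the span
  -- induction.
  suffices h : ∀ b : StdAlg L, b * x ∈ Z by simpa using h 1
  induction hx using Submodule.span_induction with
  | mem x hx =>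
    obtain ⟨n, m, rfl⟩ := hx
    intro b
    rw [mul_sub, ← mul_assoc, mul_smul_comm]
    exact key m (b * n)
  | zero => simp
  | add x y _ _ hx hy => intro b; rw [mul_add]; exact Z.add_mem (hx b) (hy b)
  | smul u x _ hx => intro b; rw [env_smul_def, ← mul_assoc]; exact hx _

variable {φ}

/-- The test for a linear operator to descend to the quotient complex; it serves for left
multiplications, for the grading projections and for the homotopy. -/
theorem map_mem_relations {f : StdAlg L →ₗ[ℂ] StdAlg L}
    (he : ∀ a τ, f (a * even (φ τ)) ∈ relations φ) (ho : ∀ a τ, f (a * odd (φ τ)) ∈ relations φ)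
    {x : StdAlg L} (hx : x ∈ relations φ) : f x ∈ relations φ :=
  mem_of_mem_relations (Z := ((relations φ).restrictScalars ℂ).comap f) he ho hx

theorem mul_mem_relations (a : StdAlg L) {x : StdAlg L} (hx : x ∈ relations φ) :
    a * x ∈ relations φ :=
  map_mem_relations (f := LinearMap.mulLeft ℂ a)
    (fun b τ => by
      rw [LinearMap.mulLeft_apply, ← mul_assoc]; exact mul_even_mem_relations φ _ τ)
    (fun b τ => by
      rw [LinearMap.mulLeft_apply, ← mul_assoc]; exact mul_odd_mem_relations φ _ τ) hx

theorem d_mem_relations {x : StdAlg L} (hx : x ∈ relations φ) : d x ∈ relations φ :=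
  relations_le_comap_d φ hx

/-- Right multiplication by a generator is homogeneous, so the projections carry generating products
of the relations to such products or to zero. Hence the quotient is graded. -/
theorem proj_mem_relations (p : ℕ) {x : StdAlg L} (hx : x ∈ relations φ) :
    proj p x ∈ relations φ :=
  map_mem_relations
    (fun b τ => by rw [proj_mul_even]; exact mul_even_mem_relations φ _ τ)
    (fun b τ => by
      cases p with
      | zero => rw [proj_zero_mul_odd]; exact Submodule.zero_mem _
      | succ p => rw [proj_succ_mul_odd]; exact mul_odd_mem_relations φ _ τ) hx

end Relations

/-! ### The filtration of N(L) by length. -/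

section Filtration

variable (L) in
/-- The filtration of `N(L)` by the number of generators: products of at most `n` generators. -/
noncomputable def filt (n : ℕ) : Submodule ℂ (StdAlg L) :=
  (1 ⊔ (LinearMap.range even ⊔ LinearMap.range odd)) ^ n

theorem even_mul_mem_filt (X : L) {n : ℕ} {x : StdAlg L} (hx : x ∈ filt L n) :
    even X * x ∈ filt L (n + 1) := by
  rw [filt, pow_succ']
  exact Submodule.mul_mem_mul (Submodule.mem_sup_right (Submodule.mem_sup_left ⟨X, rfl⟩)) hx

theorem odd_mul_mem_filt (X : L) {n : ℕ} {x : StdAlg L} (hx : x ∈ filt L n) :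
    odd X * x ∈ filt L (n + 1) := by
  rw [filt, pow_succ']
  exact Submodule.mul_mem_mul (Submodule.mem_sup_right (Submodule.mem_sup_right ⟨X, rfl⟩)) hx

theorem filt_mono {m n : ℕ} (h : m ≤ n) : filt L m ≤ filt L n :=
  pow_le_pow_right₀ (by exact le_sup_left) h

theorem mem_filt_zero {x : StdAlg L} : x ∈ filt L 0 ↔ ∃ c : ℂ, x = c • 1 := by
  rw [filt, pow_zero, Submodule.mem_one]
  simp [Algebra.algebraMap_eq_smul_one, eq_comm]

theorem filt_succ_le {n : ℕ} {Z : Submodule ℂ (StdAlg L)} (h : filt L n ≤ Z)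
    (he : ∀ X, ∀ x ∈ filt L n, even X * x ∈ Z) (ho : ∀ X, ∀ x ∈ filt L n, odd X * x ∈ Z) :
    filt L (n + 1) ≤ Z := by
  rw [filt, pow_succ', Submodule.mul_le]
  intro a ha x hx
  obtain ⟨a, ha', b, hb, rfl⟩ := Submodule.mem_sup.1 ha
  obtain ⟨_, ⟨X, rfl⟩, _, ⟨Y, rfl⟩, rfl⟩ := Submodule.mem_sup.1 hb
  obtain ⟨c, rfl⟩ := Submodule.mem_one.1 ha'
  rw [add_mul, add_mul, ← Algebra.smul_def]
  exact Z.add_mem (Z.smul_mem _ (h hx)) (Z.add_mem (he _ _ hx) (ho _ _ hx))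

theorem exists_mem_filt (a : StdAlg L) : ∃ n, a ∈ filt L n := by
  induction a using left_induction with
  | one => exact ⟨0, mem_filt_zero.2 ⟨1, by simp⟩⟩
  | smul c a h => exact h.imp fun n hn => Submodule.smul_mem _ c hn
  | add a b ha hb =>
    obtain ⟨m, hm⟩ := ha
    obtain ⟨n, hn⟩ := hb
    exact ⟨max m n, Submodule.add_mem _ (filt_mono (le_max_left _ _) hm)
      (filt_mono (le_max_right _ _) hn)⟩
  | even_mul X a h => obtain ⟨n, hn⟩ := h; exact ⟨n + 1, even_mul_mem_filt X hn⟩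
  | odd_mul X a h => obtain ⟨n, hn⟩ := h; exact ⟨n + 1, odd_mul_mem_filt X hn⟩

/-- The bracket of two generators is a single generator, so commuting past a product does not
lengthen it. This moves elements of φ(S) from the left end, where they appear, to the right end,
where they are relations. -/
theorem even_mul_sub_mem_filt (X : L) {n : ℕ} {x : StdAlg L} (hx : x ∈ filt L n) :
    even X * x - x * even X ∈ filt L n := by
  induction n generalizing x with
  | zero => obtain ⟨c, rfl⟩ := mem_filt_zero.1 hx; simp
  | succ n ih =>
    refine filt_succ_le (Z := (filt L (n + 1)).comap
      (LinearMap.mulLeft ℂ (even X) - LinearMap.mulRight ℂ (even X))) ?_ ?_ ?_ hx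
    · intro y hy; exact filt_mono n.le_succ (ih hy)
    · intro Y y hy
      have : even X * (even Y * y) - even Y * y * even X =
          even Y * (even X * y - y * even X) + even ⁅X, Y⁆ * y := by
        rw [← mul_assoc, even_mul_even X Y]; noncomm_ring
      change even X * (even Y * y) - even Y * y * even X ∈ filt L (n + 1)
      rw [this]
      exact Submodule.add_mem _ (even_mul_mem_filt Y (ih hy)) (even_mul_mem_filt _ hy)
    · intro Y y hy
      have : even X * (odd Y * y) - odd Y * y * even X =
          odd Y * (even X * y - y * even X) + odd ⁅X, Y⁆ * y := by
        rw [← mul_assoc, even_mul_odd X Y]; noncomm_ring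
      change even X * (odd Y * y) - odd Y * y * even X ∈ filt L (n + 1)
      rw [this]
      exact Submodule.add_mem _ (odd_mul_mem_filt Y (ih hy)) (odd_mul_mem_filt _ hy)

theorem odd_mul_even (X Y : L) : (odd X * even Y : StdAlg L) = even Y * odd X + odd ⁅X, Y⁆ := by
  rw [even_mul_odd, ← lie_skew X Y, map_neg]; abel

/-- The graded commutator: each odd letter passed changes the sign, whence `sign x`, and only even
letters leave a bracket behind. -/
theorem odd_mul_sub_mem_filt (X : L) {n : ℕ} {x : StdAlg L} (hx : x ∈ filt L n) :
    odd X * x - sign x * odd X ∈ filt L n := by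
  induction n generalizing x with
  | zero => obtain ⟨c, rfl⟩ := mem_filt_zero.1 hx; simp
  | succ n ih =>
    refine filt_succ_le (Z := (filt L (n + 1)).comap
      (LinearMap.mulLeft ℂ (odd X) - LinearMap.mulRight ℂ (odd X) ∘ₗ sign.toLinearMap))
      ?_ ?_ ?_ hx
    · intro y hy; exact filt_mono n.le_succ (ih hy)
    · intro Y y hy
      have : odd X * (even Y * y) - sign (even Y * y) * odd X =
          even Y * (odd X * y - sign y * odd X) + odd ⁅X, Y⁆ * y := by
        rw [← mul_assoc, odd_mul_even X Y, map_mul, sign_even]; noncomm_ring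
      change odd X * (even Y * y) - sign (even Y * y) * odd X ∈ filt L (n + 1)
      rw [this]
      exact Submodule.add_mem _ (even_mul_mem_filt Y (ih hy)) (odd_mul_mem_filt _ hy)
    · intro Y y hy
      have : odd X * (odd Y * y) - sign (odd Y * y) * odd X =
          -(odd Y * (odd X * y - sign y * odd X)) := by
        rw [← mul_assoc, odd_mul_odd X Y, map_mul, sign_odd]; noncomm_ring
      change odd X * (odd Y * y) - sign (odd Y * y) * odd X ∈ filt L (n + 1)
      rw [this]
      exact Submodule.neg_mem _ (odd_mul_mem_filt Y (ih hy))

end Filtration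

end StdAlg

/-! ### Words in U(L): the spanning half of PBW. -/

section PBW
attribute [local instance] LieRing.ofAssociativeRing

namespace UniversalEnvelopingAlgebra
variable {L : Type u} [LieRing L] [LieAlgebra ℂ L] {κ : Type*} (b : κ → L)

/-- The product in `U(L)` of a word in a family of elements of `L`. -/
noncomputable def word (l : List κ) : UniversalEnvelopingAlgebra ℂ L :=
  (l.map fun i => ι ℂ (b i)).prod

@[simp] theorem word_nil : word b [] = 1 := rfl

theorem word_cons (i : κ) (l : List κ) : word b (i :: l) = ι ℂ (b i) * word b l := by
  rw [word, List.map_cons, List.prod_cons]; rfl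

theorem word_append (l l' : List κ) : word b (l ++ l') = word b l * word b l' := by
  simp only [word, List.map_append, List.prod_append]

/-- The span of the words of length at most `n`. -/
noncomputable def wordSpan (n : ℕ) : Submodule ℂ (UniversalEnvelopingAlgebra ℂ L) :=
  Submodule.span ℂ (word b '' {l | l.length < n})

variable {b}

theorem ι_mul_mem_wordSpan (i : κ) {n : ℕ} {x : UniversalEnvelopingAlgebra ℂ L}
    (hx : x ∈ wordSpan b n) : ι ℂ (b i) * x ∈ wordSpan b (n + 1) := by
  induction hx using Submodule.span_induction with
  | mem x hx =>
    obtain ⟨l, hl, rfl⟩ := hx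
    rw [← word_cons]
    exact Submodule.subset_span ⟨i :: l, by simpa using hl, rfl⟩
  | zero => simp
  | add x y _ _ hx hy => rw [mul_add]; exact Submodule.add_mem _ hx hy
  | smul c x _ hx => rw [mul_smul_comm]; exact Submodule.smul_mem _ c hx

theorem ι_mul_ι (X Y : L) : ι ℂ X * ι ℂ Y = ι ℂ Y * ι ℂ X + ι ℂ ⁅X, Y⁆ := by
  rw [LieHom.map_lie, LieRing.of_associative_ring_bracket]; abel

/-- Exchanging two neighbours costs their bracket, which expands into words one letter shorter. The
inequality in `wordSpan` is strict, so the bound `l.length` does express a drop in length. -/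
theorem word_sub_word_mem (hb : Submodule.span ℂ (Set.range b) = ⊤) {l l' : List κ}
    (h : l.Perm l') : word b l - word b l' ∈ wordSpan b l.length := by
  induction h with
  | nil => simp
  | cons i _ ih =>
    rw [word_cons, word_cons, ← mul_sub]; exact ι_mul_mem_wordSpan i ih
  | swap i j l =>
    have : word b (j :: i :: l) - word b (i :: j :: l) = ι ℂ ⁅b j, b i⁆ * word b l := by
      simp only [word_cons, ← mul_assoc, ι_mul_ι (b j) (b i)]; noncomm_ring
    rw [this]
    have hX : ⁅b j, b i⁆ ∈ Submodule.span ℂ (Set.range b) := by rw [hb]; trivial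
    generalize ⁅b j, b i⁆ = X at hX
    induction hX using Submodule.span_induction with
    | mem x hx =>
      obtain ⟨k, rfl⟩ := hx
      rw [← word_cons]
      exact Submodule.subset_span ⟨k :: l, by simp, rfl⟩
    | zero => simp only [map_zero, zero_mul, Submodule.zero_mem]
    | add x y _ _ hx hy => rw [map_add, add_mul]; exact Submodule.add_mem _ hx hy
    | smul c x _ hx => rw [map_smul, smul_mul_assoc]; exact Submodule.smul_mem _ c hx
  | trans h _ ih ih' =>
    rw [← sub_add_sub_cancel]
    exact Submodule.add_mem _ ih (h.length_eq ▸ ih')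

theorem span_range_word (hb : Submodule.span ℂ (Set.range b) = ⊤) :
    Submodule.span ℂ (Set.range (word b)) = ⊤ := by
  have hmul : ∀ x ∈ Submodule.span ℂ (Set.range (word b)),
      ∀ y ∈ Submodule.span ℂ (Set.range (word b)),
        x * y ∈ Submodule.span ℂ (Set.range (word b)) := by
    intro x hx y hy
    have := Submodule.mul_mem_mul hx hy
    rw [Submodule.span_mul_span] at this
    refine Submodule.span_mono ?_ this
    rintro _ ⟨_, ⟨l, rfl⟩, _, ⟨l', rfl⟩, rfl⟩
    exact ⟨l ++ l', word_append b l l'⟩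
  rw [eq_top_iff]
  rintro x -
  induction x using StdAlg.env_induction with
  | halg c =>
    rw [Algebra.algebraMap_eq_smul_one]
    exact Submodule.smul_mem _ _ (Submodule.subset_span ⟨[], rfl⟩)
  | hι X =>
    have hX : X ∈ Submodule.span ℂ (Set.range b) := by rw [hb]; trivial
    induction hX using Submodule.span_induction with
    | mem x hx =>
      obtain ⟨k, rfl⟩ := hx
      exact Submodule.subset_span ⟨[k], by rw [word_cons, word_nil, mul_one]⟩
    | zero => simp only [map_zero, Submodule.zero_mem]
    | add x y _ _ hx hy => rw [map_add]; exact Submodule.add_mem _ hx hy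
    | smul c x _ hx => rw [map_smul]; exact Submodule.smul_mem _ c hx
  | hmul x y hx hy => exact hmul x hx y hy
  | hadd x y hx hy => exact Submodule.add_mem _ hx hy

/-- The spanning half of the Poincaré–Birkhoff–Witt theorem: it suffices to take one word for every
multiset of letters. -/
theorem span_range_word_comp (hb : Submodule.span ℂ (Set.range b) = ⊤) {J : Type*}
    {ℓ : J → List κ} (hℓ : Function.Surjective fun j => (ℓ j : Multiset κ)) :
    Submodule.span ℂ (Set.range fun j => word b (ℓ j)) = ⊤ := by
  have key : ∀ (n : ℕ) (l : List κ), l.length < n →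
      word b l ∈ Submodule.span ℂ (Set.range fun j => word b (ℓ j)) := by
    intro n
    induction n with
    | zero => intro l hl; simp at hl
    | succ n ih =>
      intro l hl
      obtain ⟨j, hj⟩ := hℓ l
      have hp : l.Perm (ℓ j) := (Multiset.coe_eq_coe.1 hj).symm
      rw [← sub_add_cancel (word b l) (word b (ℓ j))]
      refine Submodule.add_mem _ ?_ (Submodule.subset_span ⟨j, rfl⟩)
      refine (Submodule.span_le (p := Submodule.span ℂ (Set.range fun j => word b (ℓ j)))).2 ?_
        (word_sub_word_mem hb hp)
      rintro _ ⟨l', hl', rfl⟩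
      exact ih l' (lt_of_lt_of_le hl' (Nat.lt_succ_iff.1 hl))
  rw [eq_top_iff, ← span_range_word hb, Submodule.span_le]
  rintro _ ⟨l, rfl⟩
  exact key _ l (Nat.lt_succ_self _)

end UniversalEnvelopingAlgebra

/-! ### Invariant differential operators on ℂ[K], and the independence half of PBW. -/

namespace AlgGroup
variable {K : Type u} [Group K] [AlgGroup K]

variable (K) in
/-- The action of `U(𝔨)` on `ℂ[K]` by left invariant differential operators. -/
noncomputable def diffOp : UniversalEnvelopingAlgebra ℂ (LieAlg K) →ₐ[ℂ]
    Module.End ℂ (Coord K) :=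
  let f : LieAlg K →ₗ⁅ℂ⁆ Module.End ℂ (Coord K) :=
    { toFun := fun D => D.1.toLinearMap
      map_add' := fun _ _ => rfl
      map_smul' := fun _ _ => rfl
      map_lie' := fun {D E} => by
        ext f : 1
        simp [LieRing.of_associative_ring_bracket] }
  UniversalEnvelopingAlgebra.lift ℂ f

theorem diffOp_ι (D : LieAlg K) (f : Coord K) :
    diffOp K (UniversalEnvelopingAlgebra.ι ℂ D) f = D.1 f := by
  rw [diffOp, UniversalEnvelopingAlgebra.lift_ι_apply]; rfl

variable (K) in
/-- The ideal of the functions that vanish at `1`. -/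
def idealOne : Ideal (Coord K) :=
  RingHom.ker ((Pi.evalAlgHom ℂ (fun _ : K => ℂ) 1).comp regular.val)

theorem mem_idealOne {f : Coord K} : f ∈ idealOne K ↔ f.1 1 = 0 := Iff.rfl

/-- By the Leibniz rule a derivation lowers the order of vanishing at 1 by at most one. -/
theorem derivation_mem_pow (D : LieAlg K) {n : ℕ} {f : Coord K} (hf : f ∈ idealOne K ^ (n + 1)) :
    D.1 f ∈ idealOne K ^ n := by
  induction n generalizing f with
  | zero => simp
  | succ n ih =>
    rw [pow_succ] at hf
    induction hf using Submodule.mul_induction_on' with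
    | mem_mul_mem a ha b hb =>
      rw [Derivation.leibniz, smul_eq_mul, smul_eq_mul]
      refine Ideal.add_mem _ (Ideal.mul_mem_right _ _ ha) ?_
      rw [pow_succ']
      exact Ideal.mul_mem_mul hb (ih ha)
    | add x _ y _ hx hy => rw [map_add]; exact Ideal.add_mem _ hx hy

-- A symbol computation: modulo higher order of vanishing each letter D sends f^k to k f^(k-1) times
-- the constant (Df)(1). The exponents from r + 1 to r + `l.length` produce the rising factorial.
open UniversalEnvelopingAlgebra in
theorem diffOp_word_pow {κ : Type*} (b : κ → LieAlg K) {f : Coord K} (hf : f ∈ idealOne K)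
    (l : List κ) (r : ℕ) :
    diffOp K (word b l) (f ^ (l.length + r)) -
      (((r + 1).ascFactorial l.length : ℂ) * (l.map fun i => ((b i).1 f).1 1).prod) • f ^ r ∈
        idealOne K ^ (r + 1) := by
  induction l generalizing r with
  | nil => simp
  | cons i l ih =>
    set c : ℂ := ((r + 1 + 1).ascFactorial l.length : ℂ) *
      (l.map fun i => ((b i).1 f).1 1).prod with hc
    have h1 := derivation_mem_pow (b i) (ih (r + 1))
    -- Replacing the derivative of f by its value at 1 is an error of one more order of vanishing.
    have h2 : f ^ r * ((b i).1 f - algebraMap ℂ _ (((b i).1 f).1 1)) ∈ idealOne K ^ (r + 1) := by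
      rw [pow_succ]
      exact Ideal.mul_mem_mul (Ideal.pow_mem_pow hf r) (mem_idealOne.2 (by simp))
    have h3 := Ideal.add_mem _ h1 (Ideal.mul_mem_left _ (algebraMap ℂ (Coord K) (c * (r + 1))) h2)
    have hasc : (((r + 1).ascFactorial (i :: l).length : ℕ) : ℂ) =
        ((r + 1 + 1).ascFactorial l.length : ℂ) * (r + 1) := by
      rw [List.length_cons, Nat.ascFactorial_succ, ← Nat.succ_ascFactorial]
      push_cast; ring
    rw [hasc, word_cons, map_mul, Module.End.mul_apply, diffOp_ι, List.map_cons, List.prod_cons]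
    convert h3 using 1
    rw [show (i :: l).length + r = l.length + (r + 1) by simp; omega, ← hc]
    rw [map_sub, Derivation.map_smul, Derivation.leibniz_pow]
    apply Subtype.ext
    funext x
    simp [hc]
    ring

-- Evaluation of the symbol formula at 1: the remainder vanishes there, and so does f^r unless r =
-- 0. Thus f^n sees, among words of length at most n, only those of length exactly n.
open UniversalEnvelopingAlgebra in
theorem diffOp_word_pow_one {κ : Type*} (b : κ → LieAlg K) {f : Coord K} (hf : f ∈ idealOne K)
    (l : List κ) {n : ℕ} (hn : l.length ≤ n) :
    (diffOp K (word b l) (f ^ n)).1 1 =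
      if l.length = n then (n.factorial : ℂ) * (l.map fun i => ((b i).1 f).1 1).prod else 0 := by
  obtain ⟨r, rfl⟩ := Nat.exists_eq_add_of_le hn
  have h := mem_idealOne.1 (Ideal.pow_le_self (Nat.succ_ne_zero r) (diffOp_word_pow b hf l r))
  have h0 : f.1 1 = 0 := hf
  cases r with
  | zero =>
    simp only [AddSubgroupClass.coe_sub, Pi.sub_apply, sub_eq_zero] at h
    rw [h]
    simp [Nat.one_ascFactorial]
  | succ r =>
    simp only [AddSubgroupClass.coe_sub, Pi.sub_apply, sub_eq_zero] at h
    rw [h, if_neg (by omega)]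
    simp [h0]

open UniversalEnvelopingAlgebra in
/-- The independence half of the Poincaré–Birkhoff–Witt theorem, for the Lie algebra of an algebraic
group: words with different multisets of letters are linearly independent. -/
theorem linearIndependent_word {κ : Type*} [Finite κ] (b : Module.Basis κ ℂ (LieAlg K))
    {J : Type*} {ℓ : J → List κ} (hℓ : Function.Injective fun j => (ℓ j : Multiset κ)) :
    LinearIndependent ℂ fun j => word b (ℓ j) := by
  classical
  have := Fintype.ofFinite κ
  rw [linearIndependent_iff']
  intro s g hg
  by_contra! hne
  obtain ⟨j₀, hj₀, hj₀'⟩ := hne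
  obtain ⟨j, hj, hmax⟩ := (s.filter fun j => g j ≠ 0).exists_max_image (fun j => (ℓ j).length)
    ⟨j₀, by simp [hj₀, hj₀']⟩
  rw [Finset.mem_filter] at hj
  set n := (ℓ j).length with hn
  let t := (s.filter fun j => g j ≠ 0).filter fun i => (ℓ i).length = n
  -- The top symbol of the supposed relation, as a commutative polynomial. It will be shown to
  -- vanish at every point; since different words have different multisets of letters, they give
  -- different monomials, and all top coefficients must be zero.
  let p : MvPolynomial κ ℂ := ∑ i ∈ t, MvPolynomial.monomial
    (Multiset.toFinsupp (ℓ i : Multiset κ)) (g i)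
  have hp : p = 0 := by
    refine MvPolynomial.funext fun v => ?_
    -- Every linear form on the Lie algebra is the differential at 1 of a regular function, so the
    -- first derivatives along the basis can be prescribed to be v; subtracting F(1) puts the
    -- function in the ideal.
    obtain ⟨F, hF⟩ := exists_functional (b.constr ℂ v)
    have hf : F - algebraMap ℂ _ (F.1 1) ∈ idealOne K := mem_idealOne.2 (by simp)
    have hD : ∀ i, ((b i).1 (F - algebraMap ℂ _ (F.1 1))).1 1 = v i := by
      intro i
      rw [map_sub, Derivation.map_algebraMap, sub_zero, ← hF, Module.Basis.constr_basis]
    set f := F - algebraMap ℂ _ (F.1 1)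
    have h0 : (diffOp K (∑ i ∈ s, g i • word b (ℓ i)) (f ^ n)).1 1 = 0 := by
      rw [hg]; simp
    have hs : ∑ i ∈ s.filter (fun j => g j ≠ 0), g i • word b (ℓ i) =
        ∑ i ∈ s, g i • word b (ℓ i) := by
      refine Finset.sum_filter_of_ne fun i _ h => ?_
      contrapose! h
      rw [h, zero_smul]
    have h1 : (diffOp K (∑ i ∈ s, g i • word b (ℓ i)) (f ^ n)).1 1 =
        (n.factorial : ℂ) * MvPolynomial.eval v p := by
      rw [← hs]
      simp only [map_sum, map_smul, LinearMap.sum_apply, LinearMap.smul_apply,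
        AddSubmonoidClass.coe_finsetSum, Finset.sum_apply, p, t]
      conv_rhs => rw [Finset.sum_filter, Finset.mul_sum]
      refine Finset.sum_congr rfl fun i hi => ?_
      have := diffOp_word_pow_one b hf (ℓ i) (hmax i hi)
      simp only [SetLike.val_smul, Pi.smul_apply, this, hD, smul_eq_mul, mul_ite, mul_zero]
      split_ifs with h
      · rw [MvPolynomial.eval_monomial, Finsupp.prod, Multiset.toFinsupp_support,
          ← Multiset.prod_coe, ← Multiset.map_coe, Finset.prod_multiset_map_count]
        simp only [Multiset.toFinsupp_apply]
        ring
      · rfl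
    rw [h1] at h0
    simpa [Nat.factorial_ne_zero] using h0
  have hc : MvPolynomial.coeff (Multiset.toFinsupp (ℓ j : Multiset κ)) p = g j := by
    rw [MvPolynomial.coeff_sum, Finset.sum_eq_single j]
    · simp
    · intro i _ hij
      rw [MvPolynomial.coeff_monomial, if_neg]
      exact fun h => hij (hℓ (Multiset.toFinsupp.injective h))
    · intro h
      exact absurd (by simp only [t, Finset.mem_filter]; exact ⟨hj, hn.symm⟩) h
  rw [hp, MvPolynomial.coeff_zero] at hc
  exact hj.2 hc.symm

end AlgGroup
end PBW

/-! ### PBW for a pair, and the linear map U(L) → L. -/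

section RelativePBW

theorem exists_basis_sum {V W : Type*} [AddCommGroup V] [Module ℂ V] [FiniteDimensional ℂ V]
    [AddCommGroup W] [Module ℂ W] (f : W →ₗ[ℂ] V) (hf : Function.Injective f) {n : ℕ}
    (b : Module.Basis (Fin n) ℂ W) :
    ∃ (m : ℕ) (e : Module.Basis (Fin m ⊕ Fin n) ℂ V), ∀ i, e (Sum.inr i) = f (b i) := by
  obtain ⟨C, hC⟩ := Submodule.exists_isCompl (LinearMap.range f)
  let e := ((Module.finBasis ℂ C).prod (b.map (LinearEquiv.ofInjective f hf))).map
    (Submodule.prodEquivOfIsCompl C (LinearMap.range f) hC.symm)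
  refine ⟨_, e, fun i => ?_⟩
  simp [e]

theorem Multiset.bijective_map_inl_add_map_inr (α β : Type*) :
    Function.Bijective fun M : Multiset α × Multiset β =>
      M.1.map (Sum.inl : α → α ⊕ β) + M.2.map (Sum.inr : β → α ⊕ β) := by
  classical
  constructor
  · rintro ⟨M, N⟩ ⟨M', N'⟩ h
    simp only at h
    ext i
    · have := congrArg (Multiset.count (Sum.inl i)) h
      simpa [Multiset.count_map_eq_count' _ _ Sum.inl_injective, Multiset.count_eq_zero] using this
    · have := congrArg (Multiset.count (Sum.inr i)) h
      simpa [Multiset.count_map_eq_count' _ _ Sum.inr_injective, Multiset.count_eq_zero] using this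
  · intro M
    induction M using Multiset.induction with
    | empty => exact ⟨(0, 0), by simp⟩
    | cons x M ih =>
      obtain ⟨⟨A, B⟩, rfl⟩ := ih
      cases x with
      | inl i => exact ⟨(i ::ₘ A, B), by simp⟩
      | inr i => exact ⟨(A, i ::ₘ B), by simp⟩

namespace UniversalEnvelopingAlgebra
attribute [local instance] LieRing.ofAssociativeRing
variable {L : Type u} [LieRing L] [LieAlgebra ℂ L] {S : Type v} [LieRing S] [LieAlgebra ℂ S]

theorem envMap_word (φ : S →ₗ⁅ℂ⁆ L) {κ : Type*} (b : κ → S) (l : List κ) :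
    StdAlg.envMap φ (word b l) = word (fun i => φ (b i)) l := by
  induction l with
  | nil => simp
  | cons i l ih => rw [word_cons, word_cons, map_mul, ih, StdAlg.envMap_ι]

theorem word_map {κ κ' : Type*} (b : κ → L) (f : κ' → κ) (l : List κ') :
    word b (l.map f) = word (fun i => b (f i)) l := by
  simp [word, Function.comp_def]

theorem counit_word {κ : Type*} (b : κ → S) {l : List κ} (hl : l ≠ []) :
    StdAlg.counit (StdAlg.ofEnv (word b l)) = 0 := by
  obtain ⟨i, l, rfl⟩ := List.exists_cons_of_ne_nil hl
  rw [word_cons, map_mul, StdAlg.ofEnv_ι, map_mul, StdAlg.counit_even, zero_mul]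

/-- An element of `U(S)` with counit zero is a linear combination of nontrivial words. -/
theorem mem_span_word_of_counit_eq_zero {κ : Type*} {b : κ → S}
    (hb : Submodule.span ℂ (Set.range b) = ⊤) {u : UniversalEnvelopingAlgebra ℂ S}
    (hu : StdAlg.counit (StdAlg.ofEnv u) = 0) :
    u ∈ Submodule.span ℂ ((fun M : Multiset κ => word b M.toList) '' {0}ᶜ) := by
  have h1 : u ∈ Submodule.span ℂ (Set.range fun M : Multiset κ => word b M.toList) := by
    rw [span_range_word_comp hb (fun M => ⟨M, by simp⟩)]; trivial
  suffices h : u - algebraMap ℂ _ (StdAlg.counit (StdAlg.ofEnv u)) ∈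
      Submodule.span ℂ ((fun M : Multiset κ => word b M.toList) '' {0}ᶜ) by simpa [hu] using h
  clear hu
  induction h1 using Submodule.span_induction with
  | mem x hx =>
    obtain ⟨M, rfl⟩ := hx
    by_cases hM : M = 0
    · simp [hM]
    · simp only
      rw [counit_word b (by simpa using hM), map_zero, sub_zero]
      exact Submodule.subset_span ⟨M, hM, rfl⟩
  | zero => simp
  | add x y _ _ hx hy =>
    convert Submodule.add_mem _ hx hy using 1
    simp only [map_add]; abel
  | smul c x _ hx =>
    convert Submodule.smul_mem _ c hx using 1
    simp only [map_smul, smul_eq_mul, map_mul, Algebra.algebraMap_eq_smul_one, smul_sub, smul_smul,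
      smul_mul_smul_comm, one_mul]

end UniversalEnvelopingAlgebra

open UniversalEnvelopingAlgebra AlgGroup in
/-- The Poincaré–Birkhoff–Witt theorem for a pair: `U(𝔨)` has a basis that consists of the products of
words in a complement of `𝔱` and words in `𝔱`. -/
theorem AlgGroup.exists_basis_env {K : Type u} [Group K] [AlgGroup K] {S : Type v} [LieRing S]
    [LieAlgebra ℂ S] (φ : S →ₗ⁅ℂ⁆ LieAlg K) (hφ : Function.Injective φ) :
    ∃ (m n : ℕ) (e : Module.Basis (Fin m ⊕ Fin n) ℂ (LieAlg K)) (b : Module.Basis (Fin n) ℂ S)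
      (B : Module.Basis (Multiset (Fin m) × Multiset (Fin n)) ℂ
        (UniversalEnvelopingAlgebra ℂ (LieAlg K))),
      (∀ i, e (Sum.inr i) = φ (b i)) ∧
      ∀ M, B M = word (fun i => e (Sum.inl i)) M.1.toList *
        StdAlg.envMap φ (word b M.2.toList) := by
  have : FiniteDimensional ℂ S := FiniteDimensional.of_injective (φ : S →ₗ[ℂ] LieAlg K) hφ
  let b := Module.finBasis ℂ S
  obtain ⟨m, e, he⟩ := exists_basis_sum (φ : S →ₗ[ℂ] LieAlg K) hφ b
  -- Letters of the complement are put first and letters of φ(S) last, so that right multiplication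
  -- by φ(S) affects only the second factor of a basis element.
  let ℓ : Multiset (Fin m) × Multiset (Fin (Module.finrank ℂ S)) →
      List (Fin m ⊕ Fin (Module.finrank ℂ S)) :=
    fun M => M.1.toList.map Sum.inl ++ M.2.toList.map Sum.inr
  have hℓ : Function.Bijective fun M => (ℓ M : Multiset (Fin m ⊕ Fin (Module.finrank ℂ S))) := by
    convert Multiset.bijective_map_inl_add_map_inr (Fin m) (Fin (Module.finrank ℂ S)) using 2 with M
    simp only [ℓ]
    rw [← Multiset.coe_add, ← Multiset.map_coe, ← Multiset.map_coe, Multiset.coe_toList,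
      Multiset.coe_toList]
  refine ⟨m, _, e, b, Module.Basis.mk (linearIndependent_word e hℓ.injective)
    (span_range_word_comp e.span_eq hℓ.surjective).ge, he, fun M => ?_⟩
  rw [Module.Basis.mk_apply, word_append, word_map, word_map, envMap_word]
  simp only [he, LieHom.coe_toLinearMap]

open UniversalEnvelopingAlgebra in
/-- A basis as in the Poincaré–Birkhoff–Witt theorem for a pair gives a linear map `U(L) → L` that
vanishes on `ℂ + U(L)S` and is the identity of `L` modulo `S`. -/
theorem UniversalEnvelopingAlgebra.exists_linearMap_of_basis {L : Type u} [LieRing L]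
    [LieAlgebra ℂ L] {S : Type v} [LieRing S] [LieAlgebra ℂ S] (φ : S →ₗ⁅ℂ⁆ L) {κ κ' : Type*}
    (e : Module.Basis (κ ⊕ κ') ℂ L) (b : Module.Basis κ' ℂ S)
    (B : Module.Basis (Multiset κ × Multiset κ') ℂ (UniversalEnvelopingAlgebra ℂ L))
    (he : ∀ i, e (Sum.inr i) = φ (b i))
    (hB : ∀ M, B M = word (fun i => e (Sum.inl i)) M.1.toList *
      StdAlg.envMap φ (word b M.2.toList)) :
    ∃ π : UniversalEnvelopingAlgebra ℂ L →ₗ[ℂ] L, π 1 = 0 ∧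
      (∀ u τ, π (u * ι ℂ (φ τ)) = 0) ∧ ∀ X, ∃ τ, π (ι ℂ X) = X + φ τ := by
  classical
  -- π keeps the one-letter words in the complement and kills all other basis elements. For a
  -- multiset of one element the sum is that element, which avoids extracting it.
  obtain ⟨π, hπB⟩ : ∃ π : UniversalEnvelopingAlgebra ℂ L →ₗ[ℂ] L, ∀ M, π (B M) =
      if M.2 = 0 ∧ M.1.card = 1 then (M.1.map fun i => e (Sum.inl i)).sum else 0 :=
    ⟨B.constr ℂ _, fun M => B.constr_basis ℂ _ M⟩
  have h1 : π 1 = 0 := by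
    have : B (0, 0) = 1 := by rw [hB]; simp
    rw [← this, hπB]; simp
  have h2 : ∀ u τ, π (u * ι ℂ (φ τ)) = 0 := by
    intro u τ
    have hu : u ∈ Submodule.span ℂ (Set.range B) := by rw [B.span_eq]; trivial
    induction hu using Submodule.span_induction with
    | mem x hx =>
      obtain ⟨M, rfl⟩ := hx
      rw [hB, mul_assoc, ← StdAlg.envMap_ι, ← map_mul]
      -- The factor from U(S) lies in its augmentation ideal, so it expands in nonempty words; the
      -- product is then a combination of basis elements with nonempty second component.
      have hv := mem_span_word_of_counit_eq_zero (b := b) b.span_eq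
        (u := word b M.2.toList * ι ℂ τ) (by rw [map_mul, StdAlg.ofEnv_ι]; simp)
      generalize word b M.2.toList * ι ℂ τ = v at hv
      induction hv using Submodule.span_induction with
      | mem v hv =>
        obtain ⟨N, hN, rfl⟩ := hv
        have := hB (M.1, N)
        simp only at this
        rw [← this, hπB, if_neg]
        exact fun h => hN h.1
      | zero => simp
      | add x y _ _ hx hy => rw [map_add, mul_add, map_add, hx, hy, add_zero]
      | smul c x _ hx => rw [map_smul, mul_smul_comm, map_smul, hx, smul_zero]
    | zero => simp only [zero_mul, map_zero]
    | add x y _ _ hx hy => rw [add_mul, map_add, hx, hy, add_zero]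
    | smul c x _ hx => rw [smul_mul_assoc, map_smul, hx, smul_zero]
  refine ⟨π, h1, h2, fun X => ?_⟩
  have hX : X ∈ Submodule.span ℂ (Set.range e) := by rw [e.span_eq]; trivial
  induction hX using Submodule.span_induction with
  | mem x hx =>
    obtain ⟨i | i, rfl⟩ := hx
    · have : B ({i}, 0) = ι ℂ (e (Sum.inl i)) := by
        rw [hB]; simp [word_cons, -UniversalEnvelopingAlgebra.ι_apply]
      refine ⟨0, ?_⟩
      rw [← this, hπB]; simp
    -- A basis vector in φ(S) is killed by π, so the correction must cancel it.
    · refine ⟨-b i, ?_⟩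
      have := h2 1 (b i)
      rw [one_mul] at this
      rw [he, this, map_neg, add_neg_cancel]
  | zero => exact ⟨0, by simp only [map_zero, add_zero]⟩
  | add x y _ _ hx hy =>
    obtain ⟨σ, hσ⟩ := hx
    obtain ⟨τ, hτ⟩ := hy
    exact ⟨σ + τ, by rw [map_add, map_add, hσ, hτ, map_add]; abel⟩
  | smul c x _ hx =>
    obtain ⟨σ, hσ⟩ := hx
    exact ⟨c • σ, by rw [map_smul, map_smul, hσ, map_smul, smul_add]⟩

open UniversalEnvelopingAlgebra AlgGroup in
/-- A linear map `U(𝔨) → 𝔨` that vanishes on `ℂ + U(𝔨)𝔱` and is the identity of `𝔨` modulo `𝔱`. -/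
theorem AlgGroup.exists_linearMap_env {K : Type u} [Group K] [AlgGroup K] {S : Type v} [LieRing S]
    [LieAlgebra ℂ S] (φ : S →ₗ⁅ℂ⁆ LieAlg K) (hφ : Function.Injective φ) :
    ∃ π : UniversalEnvelopingAlgebra ℂ (LieAlg K) →ₗ[ℂ] LieAlg K, π 1 = 0 ∧
      (∀ u τ, π (u * ι ℂ (φ τ)) = 0) ∧ ∀ X, ∃ τ, π (ι ℂ X) = X + φ τ := by
  obtain ⟨m, n, e, b, B, he, hB⟩ := exists_basis_env φ hφ
  exact exists_linearMap_of_basis φ e b B he hB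

end RelativePBW

/-! ### The coaction of U(L), the homotopy and the Euler operator. -/

namespace StdAlg
open TensorProduct UniversalEnvelopingAlgebra

section Coaction
variable {L : Type u} [LieRing L] [LieAlgebra ℂ L]

section
attribute [local instance] LieRing.ofAssociativeRing

/-- The homomorphism `X ↦ i X + j X`, `ξ ↦ j ξ`, for `X` of degree `0` and `ξ` of degree `-1`. -/
noncomputable def addLift {A : Type*} [Ring A] [Algebra ℂ A]
    (i : UniversalEnvelopingAlgebra ℂ L →ₐ[ℂ] A)
    (j : StdAlg L →ₐ[ℂ] A) (h : ∀ u a, i u * j a = j a * i u) : StdAlg L →ₐ[ℂ] A :=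
  lift (i.toLinearMap ∘ₗ (ι ℂ : L →ₗ⁅ℂ⁆ UniversalEnvelopingAlgebra ℂ L).toLinearMap +
      j.toLinearMap ∘ₗ even) (j.toLinearMap ∘ₗ odd)
    (fun X Y => by
      change (i (ι ℂ X) + j (even X)) * (i (ι ℂ Y) + j (even Y)) =
        (i (ι ℂ Y) + j (even Y)) * (i (ι ℂ X) + j (even X)) + (i (ι ℂ ⁅X, Y⁆) + j (even ⁅X, Y⁆))
      simp only [mul_add, add_mul, ← map_mul, even_mul_even X Y, ι_mul_ι X Y, h, map_add]
      abel)
    (fun X Y => by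
      change (i (ι ℂ X) + j (even X)) * j (odd Y) =
        j (odd Y) * (i (ι ℂ X) + j (even X)) + j (odd ⁅X, Y⁆)
      simp only [mul_add, add_mul, ← map_mul, even_mul_odd X Y, h, map_add]
      abel)
    (fun X Y => by
      change j (odd X) * j (odd Y) = -(j (odd Y) * j (odd X))
      rw [← map_mul, odd_mul_odd X Y, map_neg, map_mul])

end

/-- The coaction `N(L) → U(L) ⊗ N(L)` obtained from the comultiplication of `N(L)`. -/
noncomputable def coact : StdAlg L →ₐ[ℂ] UniversalEnvelopingAlgebra ℂ L ⊗[ℂ] StdAlg L :=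
  addLift Algebra.TensorProduct.includeLeft Algebra.TensorProduct.includeRight fun u a => by
    simp only [Algebra.TensorProduct.includeLeft_apply, Algebra.TensorProduct.includeRight_apply,
      Algebra.TensorProduct.tmul_mul_tmul, mul_one, one_mul]

theorem coact_even (X : L) : coact (even X) = ι ℂ X ⊗ₜ[ℂ] 1 + 1 ⊗ₜ[ℂ] even X := by
  rw [coact, addLift, lift_even]; rfl

theorem coact_odd (X : L) : coact (odd X) = 1 ⊗ₜ[ℂ] (odd X : StdAlg L) := by
  rw [coact, addLift, lift_odd]; rfl

/-- `u ⊗ a ↦ g u * a`. -/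
noncomputable def contract (g : UniversalEnvelopingAlgebra ℂ L →ₗ[ℂ] StdAlg L) :
    UniversalEnvelopingAlgebra ℂ L ⊗[ℂ] StdAlg L →ₗ[ℂ] StdAlg L :=
  TensorProduct.lift (LinearMap.mul ℂ (StdAlg L) ∘ₗ g)

@[simp] theorem contract_tmul (g : UniversalEnvelopingAlgebra ℂ L →ₗ[ℂ] StdAlg L)
    (u : UniversalEnvelopingAlgebra ℂ L) (a : StdAlg L) :
    contract g (u ⊗ₜ[ℂ] a) = g u * a := by
  simp [contract]

/-- `1 ⊗ d`. -/
noncomputable def dRight : UniversalEnvelopingAlgebra ℂ L ⊗[ℂ] StdAlg L →ₗ[ℂ]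
    UniversalEnvelopingAlgebra ℂ L ⊗[ℂ] StdAlg L := LinearMap.lTensor
    (UniversalEnvelopingAlgebra ℂ L) d

@[simp] theorem dRight_tmul (u : UniversalEnvelopingAlgebra ℂ L) (a : StdAlg L) : dRight
    (u ⊗ₜ[ℂ] a) = u ⊗ₜ[ℂ] d a := by
  simp [dRight]

theorem dRight_ι_mul (X : L) (z : UniversalEnvelopingAlgebra ℂ L ⊗[ℂ] StdAlg L) :
    dRight (ι ℂ X ⊗ₜ[ℂ] 1 * z) = ι ℂ X ⊗ₜ[ℂ] 1 * dRight z := by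
  induction z using TensorProduct.induction_on with
  | zero => simp only [mul_zero, map_zero]
  | tmul u a => simp only [Algebra.TensorProduct.tmul_mul_tmul, dRight_tmul, one_mul]
  | add x y hx hy => simp only [mul_add, map_add, hx, hy]

theorem dRight_even_mul (X : L) (z : UniversalEnvelopingAlgebra ℂ L ⊗[ℂ] StdAlg L) :
    dRight (1 ⊗ₜ[ℂ] even X * z) = 1 ⊗ₜ[ℂ] even X * dRight z := by
  induction z using TensorProduct.induction_on with
  | zero => simp only [mul_zero, map_zero]
  | tmul u a =>
    simp only [Algebra.TensorProduct.tmul_mul_tmul, dRight_tmul, one_mul, d_even_mul]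
  | add x y hx hy => simp only [mul_add, map_add, hx, hy]

theorem dRight_odd_mul (X : L) (z : UniversalEnvelopingAlgebra ℂ L ⊗[ℂ] StdAlg L) :
    dRight (1 ⊗ₜ[ℂ] odd X * z) = 1 ⊗ₜ[ℂ] even X * z - 1 ⊗ₜ[ℂ] odd X * dRight z := by
  induction z using TensorProduct.induction_on with
  | zero => simp only [mul_zero, map_zero, sub_zero]
  | tmul u a =>
    simp only [Algebra.TensorProduct.tmul_mul_tmul, dRight_tmul, one_mul, d_odd_mul,
      TensorProduct.tmul_sub]
  | add x y hx hy => simp only [mul_add, map_add, hx, hy]; abel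

/-- The defect of compatibility of `coact` with `d`. -/
noncomputable def coactDefect : StdAlg L →ₗ[ℂ] UniversalEnvelopingAlgebra ℂ L ⊗[ℂ] StdAlg L :=
  coact.toLinearMap ∘ₗ d - dRight ∘ₗ coact.toLinearMap

theorem coactDefect_apply (x : StdAlg L) :
    coactDefect x = coact (d x) - dRight (coact x) := rfl

theorem coactDefect_even_mul (X : L) (x : StdAlg L) :
    coactDefect (even X * x) = ι ℂ X ⊗ₜ[ℂ] 1 * coactDefect x + 1 ⊗ₜ[ℂ] even X * coactDefect x := by
  simp only [coactDefect_apply, d_even_mul, map_mul, coact_even, add_mul, map_add, dRight_ι_mul,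
    dRight_even_mul, mul_sub]
  abel

/-- Here the defect arises: the coaction drops the left half of the odd generator but keeps the left
half X ⊗ 1 of its differential. This extra term later makes the Euler operator count odd letters. -/
theorem coactDefect_odd_mul (X : L) (x : StdAlg L) :
    coactDefect (odd X * x) = ι ℂ X ⊗ₜ[ℂ] 1 * coact x - 1 ⊗ₜ[ℂ] odd X * coactDefect x := by
  simp only [coactDefect_apply, d_odd_mul, map_sub, map_mul, coact_even, coact_odd, add_mul,
    dRight_odd_mul, mul_sub]
  abel

section contractLemmas
variable (f : UniversalEnvelopingAlgebra ℂ L →ₗ[ℂ] L)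

theorem contract_ι_mul (g : UniversalEnvelopingAlgebra ℂ L →ₗ[ℂ] StdAlg L) (X : L)
    (z : UniversalEnvelopingAlgebra ℂ L ⊗[ℂ] StdAlg L) :
    contract g (ι ℂ X ⊗ₜ[ℂ] 1 * z) = contract (g ∘ₗ LinearMap.mulLeft ℂ (ι ℂ X)) z := by
  induction z using TensorProduct.induction_on with
  | zero => simp only [mul_zero, map_zero]
  | tmul u a =>
    simp only [Algebra.TensorProduct.tmul_mul_tmul, contract_tmul, one_mul, LinearMap.comp_apply,
      LinearMap.mulLeft_apply]
  | add x y hx hy => simp only [mul_add, map_add, hx, hy]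

/-- `u ↦ [f u, X]`. -/
noncomputable def lieRight (X : L) : UniversalEnvelopingAlgebra ℂ L →ₗ[ℂ] L :=
  -((LieAlgebra.ad ℂ L X : L →ₗ[ℂ] L) ∘ₗ f)

theorem lieRight_apply (X : L) (u : UniversalEnvelopingAlgebra ℂ L) : lieRight f X u = ⁅f u, X⁆ :=
    by
  simp [lieRight]

/-- Moving X to the left past f(u) leaves the bracket [f(u), X]. Recording it as another contraction
keeps the error under control: if f(1) = 0, then `lieRight f X` also vanishes at 1. -/
theorem contract_even_even_mul (X : L) (z : UniversalEnvelopingAlgebra ℂ L ⊗[ℂ] StdAlg L) :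
    contract (even ∘ₗ f) (1 ⊗ₜ[ℂ] even X * z) =
      even X * contract (even ∘ₗ f) z + contract (even ∘ₗ lieRight f X) z := by
  induction z using TensorProduct.induction_on with
  | zero => simp only [mul_zero, map_zero, add_zero]
  | tmul u a =>
    simp only [Algebra.TensorProduct.tmul_mul_tmul, contract_tmul, one_mul, LinearMap.comp_apply,
      lieRight_apply, ← mul_assoc, even_mul_even (f u) X, add_mul]
  | add x y hx hy => simp only [mul_add, map_add, hx, hy]; abel

theorem contract_odd_even_mul (X : L) (z : UniversalEnvelopingAlgebra ℂ L ⊗[ℂ] StdAlg L) :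
    contract (odd ∘ₗ f) (1 ⊗ₜ[ℂ] even X * z) =
      even X * contract (odd ∘ₗ f) z + contract (odd ∘ₗ lieRight f X) z := by
  induction z using TensorProduct.induction_on with
  | zero => simp only [mul_zero, map_zero, add_zero]
  | tmul u a =>
    simp only [Algebra.TensorProduct.tmul_mul_tmul, contract_tmul, one_mul, LinearMap.comp_apply,
      lieRight_apply, ← mul_assoc, odd_mul_even (f u) X, add_mul]
  | add x y hx hy => simp only [mul_add, map_add, hx, hy]; abel

theorem contract_even_odd_mul (X : L) (z : UniversalEnvelopingAlgebra ℂ L ⊗[ℂ] StdAlg L) :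
    contract (even ∘ₗ f) (1 ⊗ₜ[ℂ] odd X * z) =
      odd X * contract (even ∘ₗ f) z + contract (odd ∘ₗ lieRight f X) z := by
  induction z using TensorProduct.induction_on with
  | zero => simp only [mul_zero, map_zero, add_zero]
  | tmul u a =>
    simp only [Algebra.TensorProduct.tmul_mul_tmul, contract_tmul, one_mul, LinearMap.comp_apply,
      lieRight_apply, ← mul_assoc, even_mul_odd (f u) X, add_mul]
  | add x y hx hy => simp only [mul_add, map_add, hx, hy]; abel

theorem contract_odd_odd_mul (X : L) (z : UniversalEnvelopingAlgebra ℂ L ⊗[ℂ] StdAlg L) :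
    contract (odd ∘ₗ f) (1 ⊗ₜ[ℂ] odd X * z) = -(odd X * contract (odd ∘ₗ f) z) := by
  induction z using TensorProduct.induction_on with
  | zero => simp only [mul_zero, map_zero, neg_zero]
  | tmul u a =>
    simp only [Algebra.TensorProduct.tmul_mul_tmul, contract_tmul, one_mul, LinearMap.comp_apply,
      ← mul_assoc, odd_mul_odd (f u) X, neg_mul]
  | add x y hx hy => simp only [mul_add, map_add, hx, hy]; abel

/-- A Cartan formula: d turns the contracted odd factor into the even one and passes the rest with a
sign. -/
theorem d_contract_odd (z : UniversalEnvelopingAlgebra ℂ L ⊗[ℂ] StdAlg L) :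
    d (contract (odd ∘ₗ f) z) = contract (even ∘ₗ f) z - contract (odd ∘ₗ f) (dRight z) := by
  induction z using TensorProduct.induction_on with
  | zero => simp only [map_zero, sub_zero]
  | tmul u a => simp only [contract_tmul, LinearMap.comp_apply, dRight_tmul, d_odd_mul]
  | add x y hx hy => simp only [map_add, hx, hy]; abel

theorem contract_mul_tmul_one (g : UniversalEnvelopingAlgebra ℂ L →ₗ[ℂ] StdAlg L) (a : StdAlg L)
    (z : UniversalEnvelopingAlgebra ℂ L ⊗[ℂ] StdAlg L) :
    contract g (z * 1 ⊗ₜ[ℂ] a) = contract g z * a := by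
  induction z using TensorProduct.induction_on with
  | zero => simp only [zero_mul, map_zero]
  | tmul u b => simp only [Algebra.TensorProduct.tmul_mul_tmul, contract_tmul, mul_one, mul_assoc]
  | add x y hx hy => simp only [add_mul, map_add, hx, hy]

theorem contract_mul_ι_eq_zero {g : UniversalEnvelopingAlgebra ℂ L →ₗ[ℂ] StdAlg L} {X : L}
    (hX : ∀ u, g (u * ι ℂ X) = 0)
    (z : UniversalEnvelopingAlgebra ℂ L ⊗[ℂ] StdAlg L) : contract g (z * ι ℂ X ⊗ₜ[ℂ] 1) = 0 := by
  induction z using TensorProduct.induction_on with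
  | zero => simp only [zero_mul, map_zero]
  | tmul u b =>
    simp only [Algebra.TensorProduct.tmul_mul_tmul, contract_tmul, hX, zero_mul]
  | add x y hx hy => simp only [add_mul, map_add, hx, hy, add_zero]

/-- The homotopy `x ↦ ∑ odd (f x₁) * x₂`. -/
noncomputable def homotopy : StdAlg L →ₗ[ℂ] StdAlg L :=
  contract (odd ∘ₗ f) ∘ₗ coact.toLinearMap

theorem homotopy_apply (x : StdAlg L) : homotopy f x = contract (odd ∘ₗ f) (coact x) := rfl

/-- The operator `d h + h d`, an analogue of the Euler vector field. -/
noncomputable def euler : StdAlg L →ₗ[ℂ] StdAlg L := d ∘ₗ homotopy f + homotopy f ∘ₗ d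

theorem euler_apply (x : StdAlg L) : euler f x = d (homotopy f x) + homotopy f (d x) := rfl

/-- Differentiating the odd factor gives the first term; the remaining terms combine into the
failure of the coaction to commute with d. No differential of x is left, so the operator can be
studied one generator at a time. -/
theorem euler_eq (x : StdAlg L) :
    euler f x = contract (even ∘ₗ f) (coact x) + contract (odd ∘ₗ f) (coactDefect x) := by
  rw [euler_apply, homotopy_apply, homotopy_apply, d_contract_odd, coactDefect_apply, map_sub]
  abel

end contractLemmas

/-! ### Leading terms of the coaction and of its defect. -/

section filtration

variable (L) in
/-- Products of less than `n` generators. -/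
noncomputable def filtLT : ℕ → Submodule ℂ (StdAlg L)
  | 0 => ⊥
  | n + 1 => filt L n

theorem filtLT_le_filt (n : ℕ) : filtLT L n ≤ filt L n := by
  cases n with
  | zero => exact bot_le
  | succ n => exact filt_mono n.le_succ

theorem even_mul_mem_filtLT (X : L) {n : ℕ} {x : StdAlg L} (hx : x ∈ filtLT L n) :
    even X * x ∈ filtLT L (n + 1) := by
  cases n with
  | zero => rw [(Submodule.mem_bot ℂ).1 hx, mul_zero]; exact Submodule.zero_mem _
  | succ n => exact even_mul_mem_filt X hx

theorem odd_mul_mem_filtLT (X : L) {n : ℕ} {x : StdAlg L} (hx : x ∈ filtLT L n) :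
    odd X * x ∈ filtLT L (n + 1) := by
  cases n with
  | zero => rw [(Submodule.mem_bot ℂ).1 hx, mul_zero]; exact Submodule.zero_mem _
  | succ n => exact odd_mul_mem_filt X hx

variable (L) in
/-- The filtration of `U(L) ⊗ N(L)` by the second factor. -/
noncomputable def tensorFilt (n : ℕ) : Submodule ℂ (UniversalEnvelopingAlgebra ℂ L ⊗[ℂ] StdAlg L) :=
  Submodule.span ℂ {z | ∃ u, ∃ x ∈ filtLT L n, z = u ⊗ₜ[ℂ] x}

theorem tensorFilt_le_comap {M : Type*} [AddCommGroup M] [Module ℂ M]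
    {g : UniversalEnvelopingAlgebra ℂ L ⊗[ℂ] StdAlg L →ₗ[ℂ] M} {n : ℕ} {Z : Submodule ℂ M}
    (h : ∀ u, ∀ x ∈ filtLT L n, g (u ⊗ₜ[ℂ] x) ∈ Z)
        {z : UniversalEnvelopingAlgebra ℂ L ⊗[ℂ] StdAlg L}
    (hz : z ∈ tensorFilt L n) : g z ∈ Z := by
  refine (Submodule.span_le (p := Z.comap g)).2 ?_ hz
  rintro _ ⟨u, x, hx, rfl⟩
  exact h u x hx

theorem tmul_mem_tensorFilt (u : UniversalEnvelopingAlgebra ℂ L) {n : ℕ} {x : StdAlg L}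
    (hx : x ∈ filtLT L n) :
    u ⊗ₜ[ℂ] x ∈ tensorFilt L n := Submodule.subset_span ⟨u, x, hx, rfl⟩

theorem tensorFilt_mono (n : ℕ) : tensorFilt L n ≤ tensorFilt L (n + 1) := by
  refine Submodule.span_mono ?_
  rintro _ ⟨u, x, hx, rfl⟩
  exact ⟨u, x, filtLT_le_filt n hx, rfl⟩

theorem ι_mul_mem_tensorFilt (X : L) {n : ℕ} {z : UniversalEnvelopingAlgebra ℂ L ⊗[ℂ] StdAlg L}
    (hz : z ∈ tensorFilt L n) :
    ι ℂ X ⊗ₜ[ℂ] 1 * z ∈ tensorFilt L n :=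
  tensorFilt_le_comap (g := LinearMap.mulLeft ℂ _) (fun u x hx => by
    rw [LinearMap.mulLeft_apply, Algebra.TensorProduct.tmul_mul_tmul, one_mul]
    exact tmul_mem_tensorFilt _ hx) hz

theorem even_mul_mem_tensorFilt (X : L) {n : ℕ} {z : UniversalEnvelopingAlgebra ℂ L ⊗[ℂ] StdAlg L}
    (hz : z ∈ tensorFilt L n) : 1 ⊗ₜ[ℂ] even X * z ∈ tensorFilt L (n + 1) :=
  tensorFilt_le_comap (g := LinearMap.mulLeft ℂ _) (fun u x hx => by
    rw [LinearMap.mulLeft_apply, Algebra.TensorProduct.tmul_mul_tmul, one_mul]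
    exact tmul_mem_tensorFilt _ (even_mul_mem_filtLT X hx)) hz

theorem odd_mul_mem_tensorFilt (X : L) {n : ℕ} {z : UniversalEnvelopingAlgebra ℂ L ⊗[ℂ] StdAlg L}
    (hz : z ∈ tensorFilt L n) : 1 ⊗ₜ[ℂ] odd X * z ∈ tensorFilt L (n + 1) :=
  tensorFilt_le_comap (g := LinearMap.mulLeft ℂ _) (fun u x hx => by
    rw [LinearMap.mulLeft_apply, Algebra.TensorProduct.tmul_mul_tmul, one_mul]
    exact tmul_mem_tensorFilt _ (odd_mul_mem_filtLT X hx)) hz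

theorem contract_even_mem_filt (f : UniversalEnvelopingAlgebra ℂ L →ₗ[ℂ] L) {n : ℕ}
    {z : UniversalEnvelopingAlgebra ℂ L ⊗[ℂ] StdAlg L}
    (hz : z ∈ tensorFilt L n) : contract (even ∘ₗ f) z ∈ filt L n :=
  tensorFilt_le_comap (fun u x hx => by
    rw [contract_tmul]; exact even_mul_mem_filtLT _ hx) hz

theorem contract_odd_mem_filt (f : UniversalEnvelopingAlgebra ℂ L →ₗ[ℂ] L) {n : ℕ}
    {z : UniversalEnvelopingAlgebra ℂ L ⊗[ℂ] StdAlg L}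
    (hz : z ∈ tensorFilt L n) : contract (odd ∘ₗ f) z ∈ filt L n :=
  tensorFilt_le_comap (fun u x hx => by
    rw [contract_tmul]; exact odd_mul_mem_filtLT _ hx) hz

/-- Each letter either stays in the right factor or moves to the left one, and only the term where
all stay keeps n letters on the right. -/
theorem coact_sub_mem {n : ℕ} {x : StdAlg L} (hx : x ∈ filt L n) :
    coact x - 1 ⊗ₜ[ℂ] x ∈ tensorFilt L n := by
  induction n generalizing x with
  | zero =>
    obtain ⟨c, rfl⟩ := mem_filt_zero.1 hx
    rw [map_smul, map_one, Algebra.TensorProduct.one_def, TensorProduct.tmul_smul, sub_self]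
    exact Submodule.zero_mem _
  | succ n ih =>
    refine filt_succ_le (Z := (tensorFilt L (n + 1)).comap
      (coact.toLinearMap - TensorProduct.mk ℂ (UniversalEnvelopingAlgebra ℂ L) (StdAlg L) 1)) ?_ ?_
          ?_ hx
    · intro y hy; exact tensorFilt_mono n (ih hy)
    · intro Y y hy
      have h1 : coact y ∈ tensorFilt L (n + 1) := by
        rw [← sub_add_cancel (coact y) (1 ⊗ₜ[ℂ] y)]
        exact Submodule.add_mem _ (tensorFilt_mono n (ih hy)) (tmul_mem_tensorFilt 1 hy)
      have h2 : coact (even Y * y) - 1 ⊗ₜ[ℂ] (even Y * y) =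
          ι ℂ Y ⊗ₜ[ℂ] 1 * coact y + 1 ⊗ₜ[ℂ] even Y * (coact y - 1 ⊗ₜ[ℂ] y) := by
        rw [map_mul, coact_even, add_mul, mul_sub, Algebra.TensorProduct.tmul_mul_tmul, one_mul]
        abel
      change coact (even Y * y) - 1 ⊗ₜ[ℂ] (even Y * y) ∈ tensorFilt L (n + 1)
      rw [h2]
      exact Submodule.add_mem _ (ι_mul_mem_tensorFilt Y h1) (even_mul_mem_tensorFilt Y (ih hy))
    · intro Y y hy
      have h2 : coact (odd Y * y) - 1 ⊗ₜ[ℂ] (odd Y * y) =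
          1 ⊗ₜ[ℂ] odd Y * (coact y - 1 ⊗ₜ[ℂ] y) := by
        rw [map_mul, coact_odd, mul_sub, Algebra.TensorProduct.tmul_mul_tmul, one_mul]
      change coact (odd Y * y) - 1 ⊗ₜ[ℂ] (odd Y * y) ∈ tensorFilt L (n + 1)
      rw [h2]
      exact odd_mul_mem_tensorFilt Y (ih hy)

theorem coact_mem {n : ℕ} {x : StdAlg L} (hx : x ∈ filt L n) :
    coact x ∈ tensorFilt L (n + 1) := by
  rw [← sub_add_cancel (coact x) (1 ⊗ₜ[ℂ] x)]
  exact Submodule.add_mem _ (tensorFilt_mono n (coact_sub_mem hx)) (tmul_mem_tensorFilt 1 hx)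

theorem coactDefect_one : coactDefect (1 : StdAlg L) = 0 := by
  rw [coactDefect_apply, d_one, map_one, Algebra.TensorProduct.one_def, dRight_tmul, d_one,
    map_zero, TensorProduct.tmul_zero, sub_zero]

/-- Every term of the defect has lost at least one odd letter from its right factor. -/
theorem coactDefect_mem {n : ℕ} {x : StdAlg L} (hx : x ∈ filt L n) :
    coactDefect x ∈ tensorFilt L n := by
  induction n generalizing x with
  | zero =>
    obtain ⟨c, rfl⟩ := mem_filt_zero.1 hx
    rw [map_smul, coactDefect_one, smul_zero]
    exact Submodule.zero_mem _
  | succ n ih =>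
    refine filt_succ_le (Z := (tensorFilt L (n + 1)).comap coactDefect) ?_ ?_ ?_ hx
    · intro y hy; exact tensorFilt_mono n (ih hy)
    · intro Y y hy
      rw [Submodule.mem_comap, coactDefect_even_mul]
      exact Submodule.add_mem _ (ι_mul_mem_tensorFilt Y (tensorFilt_mono n (ih hy)))
        (even_mul_mem_tensorFilt Y (ih hy))
    · intro Y y hy
      rw [Submodule.mem_comap, coactDefect_odd_mul]
      exact Submodule.sub_mem _ (ι_mul_mem_tensorFilt Y (coact_mem hy))
        (odd_mul_mem_tensorFilt Y (ih hy))

end filtration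

/-! ### The Euler operator modulo relations, and acyclicity. -/

section acyclic
variable {S : Type v} [LieRing S] [LieAlgebra ℂ S] {φ : S →ₗ⁅ℂ⁆ L}

theorem even_mul_mem_sup (X : L) {n : ℕ} {x : StdAlg L}
    (hx : x ∈ filtLT L n ⊔ (relations φ).restrictScalars ℂ) :
    even X * x ∈ filt L n ⊔ (relations φ).restrictScalars ℂ := by
  obtain ⟨a, ha, r, hr, rfl⟩ := Submodule.mem_sup.1 hx
  rw [mul_add]
  exact Submodule.add_mem_sup (even_mul_mem_filtLT X ha) (mul_mem_relations (φ := φ) _ hr)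

theorem odd_mul_mem_sup (X : L) {n : ℕ} {x : StdAlg L}
    (hx : x ∈ filtLT L n ⊔ (relations φ).restrictScalars ℂ) :
    odd X * x ∈ filt L n ⊔ (relations φ).restrictScalars ℂ := by
  obtain ⟨a, ha, r, hr, rfl⟩ := Submodule.mem_sup.1 hx
  rw [mul_add]
  exact Submodule.add_mem_sup (odd_mul_mem_filtLT X ha) (mul_mem_relations (φ := φ) _ hr)

/-- A letter from φ(S) on the left does not count towards the length modulo relations: it can be
commuted to the right end. This is why f need only be the identity modulo φ(S). -/
theorem even_map_mul_mem (τ : S) {n : ℕ} {x : StdAlg L} (hx : x ∈ filt L n) :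
    even (φ τ) * x ∈ filt L n ⊔ (relations φ).restrictScalars ℂ := by
  rw [← sub_add_cancel (even (φ τ) * x) (x * even (φ τ))]
  exact Submodule.add_mem_sup (even_mul_sub_mem_filt _ hx) (mul_even_mem_relations φ x τ)

theorem odd_map_mul_mem (τ : S) {n : ℕ} {x : StdAlg L} (hx : x ∈ filt L n) :
    odd (φ τ) * x ∈ filt L n ⊔ (relations φ).restrictScalars ℂ := by
  rw [← sub_add_cancel (odd (φ τ) * x) (sign x * odd (φ τ))]
  exact Submodule.add_mem_sup (odd_mul_sub_mem_filt _ hx) (mul_odd_mem_relations φ _ τ)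

variable {f : UniversalEnvelopingAlgebra ℂ L →ₗ[ℂ] L}

/-- On a product ending in φ(τ), the coaction puts this last letter either in the left factor, where
f kills the term, or in the right factor, where it still makes a relation. -/
theorem homotopy_mem_relations (hmul : ∀ u τ, f (u * ι ℂ (φ τ)) = 0)
    {x : StdAlg L} (hx : x ∈ relations φ) :
    homotopy f x ∈ relations φ := by
  refine map_mem_relations (fun a τ => ?_) (fun a τ => ?_) hx
  · rw [homotopy_apply, map_mul, coact_even, mul_add, map_add, contract_mul_tmul_one,
      contract_mul_ι_eq_zero (fun u => by rw [LinearMap.comp_apply, hmul, map_zero]), zero_add]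
    exact mul_even_mem_relations φ _ τ
  · rw [homotopy_apply, map_mul, coact_odd, contract_mul_tmul_one]
    exact mul_odd_mem_relations φ _ τ

theorem contract_even_coact {g : UniversalEnvelopingAlgebra ℂ L →ₗ[ℂ] L} {n : ℕ} {x : StdAlg L}
    (hx : x ∈ filt L n) :
    contract (even ∘ₗ g) (coact x) - even (g 1) * x ∈ filt L n := by
  have := contract_even_mem_filt g (coact_sub_mem hx)
  rwa [map_sub, contract_tmul] at this

theorem contract_odd_coact {g : UniversalEnvelopingAlgebra ℂ L →ₗ[ℂ] L} {n : ℕ} {x : StdAlg L}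
    (hx : x ∈ filt L n) :
    contract (odd ∘ₗ g) (coact x) - odd (g 1) * x ∈ filt L n := by
  have := contract_odd_mem_filt g (coact_sub_mem hx)
  rwa [map_sub, contract_tmul] at this

/-- The Euler operator counts an added even letter once. The summand X ⊗ 1 of the coaction gives, to
leading order, f(X) x = (X + φ(τ)) x; the bracket terms have no leading part because f(1) = 0, and
the terms from the defect are already short. -/
theorem euler_even_mul (h1 : f 1 = 0) (hι : ∀ X, ∃ τ, f (ι ℂ X) = X + φ τ)
    (X : L) {n : ℕ} {x : StdAlg L} (hx : x ∈ filt L n) :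
    euler f (even X * x) - even X * euler f x - even X * x ∈
      filt L n ⊔ (relations φ).restrictScalars ℂ := by
  obtain ⟨τ, hτ⟩ := hι X
  have e1 := contract_even_coact (g := f ∘ₗ LinearMap.mulLeft ℂ (ι ℂ X)) hx
  have e2 := contract_even_coact (g := lieRight f X) hx
  have e3 := contract_odd_mem_filt (f ∘ₗ LinearMap.mulLeft ℂ (ι ℂ X)) (coactDefect_mem hx)
  have e4 := contract_odd_mem_filt (lieRight f X) (coactDefect_mem hx)
  rw [LinearMap.comp_apply, LinearMap.mulLeft_apply, mul_one, hτ, map_add, add_mul] at e1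
  rw [lieRight_apply, h1, zero_lie, map_zero, zero_mul, sub_zero] at e2
  have e5 := Submodule.add_mem_sup
    (Submodule.add_mem _ e1 (Submodule.add_mem _ e2 (Submodule.add_mem _ e3 e4)))
    ((relations φ).restrictScalars ℂ).zero_mem
  convert Submodule.add_mem _ e5 (even_map_mul_mem (φ := φ) τ hx) using 1
  rw [euler_eq, euler_eq, map_mul, coact_even, add_mul, map_add, contract_ι_mul,
    contract_even_even_mul, coactDefect_even_mul, map_add, contract_ι_mul, contract_odd_even_mul,
    mul_add, LinearMap.comp_assoc, LinearMap.comp_assoc]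
  abel

/-- The same count for an odd letter. Its coaction has no summand X ⊗ 1, and the leading term comes
from the defect instead. -/
theorem euler_odd_mul (h1 : f 1 = 0) (hι : ∀ X, ∃ τ, f (ι ℂ X) = X + φ τ)
    (X : L) {n : ℕ} {x : StdAlg L} (hx : x ∈ filt L n) :
    euler f (odd X * x) - odd X * euler f x - odd X * x ∈
      filt L n ⊔ (relations φ).restrictScalars ℂ := by
  obtain ⟨τ, hτ⟩ := hι X
  have e1 := contract_odd_coact (g := f ∘ₗ LinearMap.mulLeft ℂ (ι ℂ X)) hx
  have e2 := contract_odd_coact (g := lieRight f X) hx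
  rw [LinearMap.comp_apply, LinearMap.mulLeft_apply, mul_one, hτ, map_add, add_mul] at e1
  rw [lieRight_apply, h1, zero_lie, map_zero, zero_mul, sub_zero] at e2
  have e5 := Submodule.add_mem_sup (Submodule.add_mem _ e1 e2)
    ((relations φ).restrictScalars ℂ).zero_mem
  convert Submodule.add_mem _ e5 (odd_map_mul_mem (φ := φ) τ hx) using 1
  rw [euler_eq, euler_eq, map_mul, coact_odd, contract_even_odd_mul, coactDefect_odd_mul, map_sub,
    contract_ι_mul, contract_odd_odd_mul, mul_add, LinearMap.comp_assoc]
  abel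

/-- Induction on the number of letters, each contributing 1. The bound `filtLT` is zero for n = 0,
so that constants are killed exactly modulo relations. -/
theorem euler_sub_mem (h1 : f 1 = 0) (hι : ∀ X, ∃ τ, f (ι ℂ X) = X + φ τ)
    {n : ℕ} {x : StdAlg L} (hx : x ∈ filt L n) :
    euler f x - (n : ℂ) • x ∈ filtLT L n ⊔ (relations φ).restrictScalars ℂ := by
  induction n generalizing x with
  | zero =>
    obtain ⟨c, rfl⟩ := mem_filt_zero.1 hx
    have : euler f (1 : StdAlg L) = 0 := by
      rw [euler_eq, coactDefect_one, map_one, Algebra.TensorProduct.one_def, contract_tmul,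
        LinearMap.comp_apply, h1, map_zero, map_zero, zero_mul, zero_add]
    rw [map_smul, this]
    simp
  | succ n ih =>
    change _ ∈ filt L n ⊔ (relations φ).restrictScalars ℂ
    refine filt_succ_le (Z := (filt L n ⊔ (relations φ).restrictScalars ℂ).comap
      (euler f - ((n + 1 : ℕ) : ℂ) • LinearMap.id)) ?_ ?_ ?_ hx
    · intro y hy
      have e1 := sup_le_sup_right (filtLT_le_filt n) _ (ih hy)
      rw [Submodule.mem_comap]
      convert Submodule.sub_mem _ e1 (Submodule.mem_sup_left hy) using 1
      simp only [LinearMap.sub_apply, LinearMap.add_apply, LinearMap.smul_apply, LinearMap.id_apply,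
        Nat.cast_succ, add_smul, one_smul, sub_sub]
    · intro Y y hy
      rw [Submodule.mem_comap]
      convert Submodule.add_mem _ (euler_even_mul h1 hι Y hy) (even_mul_mem_sup Y (ih hy)) using 1
      simp only [LinearMap.sub_apply, LinearMap.add_apply, LinearMap.smul_apply, LinearMap.id_apply,
        Nat.cast_succ, add_smul, one_smul, mul_sub, mul_smul_comm]
      abel
    · intro Y y hy
      rw [Submodule.mem_comap]
      convert Submodule.add_mem _ (euler_odd_mul h1 hι Y hy) (odd_mul_mem_sup Y (ih hy)) using 1
      simp only [LinearMap.sub_apply, LinearMap.add_apply, LinearMap.smul_apply, LinearMap.id_apply,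
        Nat.cast_succ, add_smul, one_smul, mul_sub, mul_smul_comm]
      abel

/-- The acyclicity of the augmented complex `N(L) ⊗_{N(S)} ℂ → ℂ`. -/
theorem exists_sub_d_mem_relations (h1 : f 1 = 0) (hmul : ∀ u τ, f (u * ι ℂ (φ τ)) = 0)
    (hι : ∀ X, ∃ τ, f (ι ℂ X) = X + φ τ)
    {x : StdAlg L} (hd : d x ∈ relations φ)
    (hε : counit x = 0) : ∃ y, x - d y ∈ relations φ := by
  obtain ⟨n, hx⟩ := exists_mem_filt x
  induction n generalizing x with
  | zero =>
    obtain ⟨c, rfl⟩ := mem_filt_zero.1 hx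
    have hc : c = 0 := by simpa using hε
    exact ⟨0, by simp [hc]⟩
  | succ n ih =>
    obtain ⟨a, ha, r, hr, har⟩ := Submodule.mem_sup.1 (euler_sub_mem h1 hι hx)
    have hr : r ∈ relations φ := hr
    set c : ℂ := ((n + 1 : ℕ) : ℂ)
    have hc : c ≠ 0 := Nat.cast_ne_zero.2 n.succ_ne_zero
    have hs := homotopy_mem_relations hmul hd
    set s := homotopy f (d x)
    -- The remainder a is shorter than x. Up to relations it differs from -c x by a boundary, so it
    -- is again a cycle with counit zero and the induction hypothesis applies.
    have key : a = d (homotopy f x) + s - c • x - r := by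
      rw [eq_sub_iff_add_eq, har, euler_apply]
    have hda : d a ∈ relations φ := by
      rw [key, map_sub, map_sub, map_add, d_d, zero_add, map_smul]
      exact Submodule.sub_mem _ (Submodule.sub_mem _ (d_mem_relations hs)
        (Submodule.smul_of_tower_mem _ c hd)) (d_mem_relations hr)
    have hεa : counit a = 0 := by
      rw [key, map_sub, map_sub, map_add, counit_d, map_smul, hε,
        relations_le_ker_counit φ hs, relations_le_ker_counit φ hr]
      simp
    obtain ⟨y, hy⟩ := ih hda hεa ha
    -- Solving c x ≡ d(h x) - a and a ≡ d y for x; c is the positive integer n + 1.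
    refine ⟨c⁻¹ • (homotopy f x - y), ?_⟩
    have : x - d (c⁻¹ • (homotopy f x - y)) = c⁻¹ • (s - r - (a - d y)) := by
      rw [key, map_smul, map_sub]
      have : x = c⁻¹ • c • x := by rw [smul_smul, inv_mul_cancel₀ hc, one_smul]
      nth_rewrite 1 [this]
      rw [← smul_sub]
      congr 1
      abel
    rw [this]
    exact Submodule.smul_of_tower_mem _ _ (Submodule.sub_mem _ (Submodule.sub_mem _ hs hr) hy)

end acyclic
end Coaction
end StdAlg

/-! ### The exterior part ⋀L of N(L). -/

namespace StdAlg
open UniversalEnvelopingAlgebra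

section OddPow
variable {L : Type u} [LieRing L] [LieAlgebra ℂ L]

variable (L) in
/-- The products of `p` elements of degree `-1`. -/
noncomputable def oddPow (p : ℕ) : Submodule ℂ (StdAlg L) := LinearMap.range odd ^ p

theorem finiteDimensional_oddPow [FiniteDimensional ℂ L] (p : ℕ) :
    FiniteDimensional ℂ (oddPow L p) :=
  Module.Finite.iff_fg.2 (Submodule.FG.pow (Module.Finite.iff_fg.1 inferInstance) p)

theorem odd_mul_mem_oddPow (X : L) {p : ℕ} {x : StdAlg L} (hx : x ∈ oddPow L p) :
    odd X * x ∈ oddPow L (p + 1) := by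
  rw [oddPow, pow_succ']
  exact Submodule.mul_mem_mul ⟨X, rfl⟩ hx

theorem one_mem_oddPow_zero : (1 : StdAlg L) ∈ oddPow L 0 := by
  rw [oddPow, pow_zero]; exact Submodule.one_le.1 le_rfl

theorem oddPow_induction {P : ℕ → StdAlg L → Prop} (one : P 0 1)
    (smul : ∀ p (c : ℂ) a, P p a → P p (c • a)) (add : ∀ p a b, P p a → P p b → P p (a + b))
    (odd_mul : ∀ p X a, P p a → P (p + 1) (odd X * a)) {p : ℕ} {x : StdAlg L}
    (hx : x ∈ oddPow L p) : P p x := by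
  induction p generalizing x with
  | zero =>
    rw [oddPow, pow_zero] at hx
    obtain ⟨c, rfl⟩ := Submodule.mem_one.1 hx
    rw [Algebra.algebraMap_eq_smul_one]
    exact smul _ _ _ one
  | succ p ih =>
    rw [oddPow, pow_succ'] at hx
    induction hx using Submodule.mul_induction_on' with
    | mem_mul_mem a ha b hb => obtain ⟨X, rfl⟩ := ha; exact odd_mul _ _ _ (ih hb)
    | add x _ y _ hx hy => exact add _ _ _ hx hy

theorem oddPow_le_degree {p : ℕ} {x : StdAlg L} (hx : x ∈ oddPow L p) : x ∈ degree p := by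
  refine oddPow_induction (P := fun p x => x ∈ degree p) ?_ ?_ ?_ ?_ hx
  · simpa using prod_mem_degree (Fin.elim0 : Fin 0 → L)
  · intro p c a h; exact Submodule.smul_of_tower_mem _ c h
  · intro p a b ha hb; exact Submodule.add_mem _ ha hb
  · intro p X a h; exact odd_mul_mem_degree X h

theorem map_mem_oddPow (f : L →ₗ⁅ℂ⁆ L) {p : ℕ} {x : StdAlg L} (hx : x ∈ oddPow L p) :
    map f x ∈ oddPow L p := by
  refine oddPow_induction (P := fun p x => map f x ∈ oddPow L p) ?_ ?_ ?_ ?_ hx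
  · rw [map_one]; exact one_mem_oddPow_zero
  · intro p c a h; rw [map_smul]; exact Submodule.smul_mem _ c h
  · intro p a b ha hb; rw [map_add]; exact Submodule.add_mem _ ha hb
  · intro p X a h; rw [map_mul, map_odd]; exact odd_mul_mem_oddPow _ h

variable (L) in
/-- The subalgebra `⋀ L` of `N(L)`. -/
noncomputable def oddAlg : Subalgebra ℂ (StdAlg L) := Algebra.adjoin ℂ (Set.range odd)

theorem odd_mem_oddAlg (X : L) : odd X ∈ oddAlg L := Algebra.subset_adjoin ⟨X, rfl⟩

theorem oddPow_le_oddAlg {p : ℕ} {x : StdAlg L} (hx : x ∈ oddPow L p) : x ∈ oddAlg L := by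
  refine oddPow_induction (P := fun _ x => x ∈ oddAlg L) ?_ ?_ ?_ ?_ hx
  · exact Subalgebra.one_mem _
  · intro p c a h; exact Subalgebra.smul_mem _ h c
  · intro p a b ha hb; exact Subalgebra.add_mem _ ha hb
  · intro p X a h; exact Subalgebra.mul_mem _ (odd_mem_oddAlg X) h

theorem proj_mul (p : ℕ) (a b : StdAlg L) :
    proj p (a * b) = ∑ q ∈ Finset.HasAntidiagonal.antidiagonal p, proj q.1 a * proj q.2 b := by
  simp only [proj_apply, map_mul, Polynomial.coeff_mul]

theorem proj_mem_oddPow {x : StdAlg L} (hx : x ∈ oddAlg L) (p : ℕ) : proj p x ∈ oddPow L p := by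
  induction hx using Algebra.adjoin_induction generalizing p with
  | mem x hx =>
    obtain ⟨X, rfl⟩ := hx
    rw [← mul_one (odd X)]
    match p with
    | 0 => rw [proj_zero_odd_mul]; exact Submodule.zero_mem _
    | 1 =>
      rw [proj_succ_odd_mul, proj_zero_one]; exact odd_mul_mem_oddPow X one_mem_oddPow_zero
    | p + 2 => rw [proj_succ_odd_mul, proj_succ_one, mul_zero]; exact Submodule.zero_mem _
  | algebraMap r =>
    rw [Algebra.algebraMap_eq_smul_one, map_smul]
    refine Submodule.smul_mem _ _ ?_
    cases p with
    | zero => rw [proj_zero_one]; exact one_mem_oddPow_zero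
    | succ p => rw [proj_succ_one]; exact Submodule.zero_mem _
  | add x y _ _ hx hy => rw [map_add]; exact Submodule.add_mem _ (hx p) (hy p)
  | mul x y _ _ hx hy =>
    rw [proj_mul]
    refine Submodule.sum_mem _ fun q hq => ?_
    rw [← Finset.HasAntidiagonal.mem_antidiagonal.1 hq, oddPow, pow_add]
    exact Submodule.mul_mem_mul (hx q.1) (hy q.2)

/-- The commutator is a derivation that sends odd generators to odd generators; this is the adjoint
action on ⋀L. -/
theorem even_mul_sub_mem_oddAlg (X : L) {x : StdAlg L} (hx : x ∈ oddAlg L) :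
    even X * x - x * even X ∈ oddAlg L := by
  induction hx using Algebra.adjoin_induction with
  | mem x hx =>
    obtain ⟨Y, rfl⟩ := hx
    rw [even_mul_odd, add_sub_cancel_left]; exact odd_mem_oddAlg _
  | algebraMap r => rw [Algebra.commutes, sub_self]; exact Subalgebra.zero_mem _
  | add x y _ _ hx hy =>
    rw [mul_add, add_mul, add_sub_add_comm]; exact Subalgebra.add_mem _ hx hy
  | mul x y hx' hy' hx hy =>
    have : even X * (x * y) - x * y * even X =
        (even X * x - x * even X) * y + x * (even X * y - y * even X) := by noncomm_ring
    rw [this]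
    exact Subalgebra.add_mem _ (Subalgebra.mul_mem _ hx hy') (Subalgebra.mul_mem _ hx' hy)

/-- The commutator with `X` on `⋀ L`. -/
noncomputable def adOdd (X : L) : oddAlg L →ₗ[ℂ] oddAlg L :=
  (LinearMap.mulLeft ℂ (even X) - LinearMap.mulRight ℂ (even X)).restrict
    (p := Subalgebra.toSubmodule (oddAlg L)) (q := Subalgebra.toSubmodule (oddAlg L))
    fun _ hx => even_mul_sub_mem_oddAlg X hx

theorem adOdd_coe (X : L) (x : oddAlg L) :
    (adOdd X x : StdAlg L) = even X * x - x * even X := rfl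

/-- `odd X` as an element of `⋀ L`. -/
noncomputable def oddGen (X : L) : oddAlg L := ⟨odd X, odd_mem_oddAlg X⟩

end OddPow

/-! ### The N(L)-module Hom(⋀L, M) and extension of maps from ⋀L. -/

section Coinduced
variable {L : Type u} [LieRing L] [LieAlgebra ℂ L] {M : Type v} [AddCommGroup M]

variable (M) in
/-- The action of `L` in degree `-1` on the linear maps from `⋀ L` to a `U(L)`-module. -/
noncomputable def coindOdd [Module ℂ M] : L →ₗ[ℂ] Module.End ℂ (oddAlg L →ₗ[ℂ] M) where
  toFun X :=
    { toFun := fun f => f ∘ₗ LinearMap.mulRight ℂ (oddGen X)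
      map_add' := fun f g => rfl
      map_smul' := fun c f => rfl }
  map_add' X Y := by
    ext f x
    change f (x * oddGen (X + Y)) = f (x * oddGen X) + f (x * oddGen Y)
    rw [← map_add, ← mul_add]
    congr 2
    exact Subtype.ext (map_add odd X Y)
  map_smul' c X := by
    ext f x
    change f (x * oddGen (c • X)) = c • f (x * oddGen X)
    rw [← map_smul, ← mul_smul_comm]
    congr 2
    exact Subtype.ext (map_smul odd c X)

theorem coindOdd_apply [Module ℂ M] (X : L) (f : oddAlg L →ₗ[ℂ] M) (x : oddAlg L) :
    coindOdd M X f x = f (x * oddGen X) := rfl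

variable [Module (UniversalEnvelopingAlgebra ℂ L) M]

theorem ι_smul_ι_smul (X Y : L) (m : M) :
    ι ℂ X • ι ℂ Y • m = ι ℂ Y • ι ℂ X • m + ι ℂ ⁅X, Y⁆ • m := by
  rw [smul_smul, smul_smul, ← add_smul, ι_mul_ι X Y]

variable [Module ℂ M] [IsScalarTower ℂ (UniversalEnvelopingAlgebra ℂ L) M]

variable (M) in
/-- The action of `L` in degree `0` on the linear maps from `⋀ L` to a `U(L)`-module. -/
noncomputable def coindEven : L →ₗ[ℂ] Module.End ℂ (oddAlg L →ₗ[ℂ] M) where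
  toFun X :=
    { toFun := fun f => (Module.toModuleEnd ℂ (S := UniversalEnvelopingAlgebra ℂ L) M (ι ℂ X)) ∘ₗ f -
        f ∘ₗ adOdd X
      map_add' := fun f g => by
        ext x
        simp only [LinearMap.sub_apply, LinearMap.comp_apply, LinearMap.add_apply, map_add]; abel
      map_smul' := fun c f => by
        ext x
        simp only [LinearMap.sub_apply, LinearMap.comp_apply, LinearMap.smul_apply, map_smul,
          RingHom.id_apply, smul_sub] }
  map_add' X Y := by
    ext f x
    have : adOdd (X + Y) x = adOdd X x + adOdd Y x := by
      apply Subtype.ext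
      rw [Subalgebra.coe_add, adOdd_coe, adOdd_coe, adOdd_coe, map_add, add_mul, mul_add]; abel
    change ι ℂ (X + Y) • f x - f (adOdd (X + Y) x) =
      (ι ℂ X • f x - f (adOdd X x)) + (ι ℂ Y • f x - f (adOdd Y x))
    rw [this, map_add, map_add, add_smul]; abel
  map_smul' c X := by
    ext f x
    have : adOdd (c • X) x = c • adOdd X x := by
      apply Subtype.ext
      rw [Subalgebra.coe_smul, adOdd_coe, adOdd_coe, map_smul, smul_mul_assoc, mul_smul_comm,
        smul_sub]
    change ι ℂ (c • X) • f x - f (adOdd (c • X) x) = c • (ι ℂ X • f x - f (adOdd X x))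
    rw [this, map_smul, map_smul, smul_assoc, smul_sub]

theorem coindEven_apply (X : L) (f : oddAlg L →ₗ[ℂ] M) (x : oddAlg L) :
    coindEven M X f x = ι ℂ X • f x - f (adOdd X x) := rfl

variable (M) in
/-- The action of `N(L)` on the linear maps from `⋀ L` to a `U(L)`-module. -/
noncomputable def coind : StdAlg L →ₐ[ℂ] Module.End ℂ (oddAlg L →ₗ[ℂ] M) :=
  lift (coindEven M) (coindOdd M)
    (fun X Y => by
      ext f x
      have h : adOdd X (adOdd Y x) = adOdd Y (adOdd X x) + adOdd ⁅X, Y⁆ x := by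
        apply Subtype.ext
        have : (even ⁅X, Y⁆ : StdAlg L) = even X * even Y - even Y * even X := by
          rw [even_mul_even X Y]; abel
        simp only [Subalgebra.coe_add, adOdd_coe, this]
        noncomm_ring
      simp only [LinearMap.add_apply, Module.End.mul_apply, coindEven_apply, smul_sub,
        ι_smul_ι_smul X Y, h, map_add]
      abel)
    (fun X Y => by
      ext f x
      have h : adOdd X (x * oddGen Y) = adOdd X x * oddGen Y + x * oddGen ⁅X, Y⁆ := by
        apply Subtype.ext
        have : (odd ⁅X, Y⁆ : StdAlg L) = even X * odd Y - odd Y * even X := by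
          rw [even_mul_odd X Y]; abel
        simp only [Subalgebra.coe_add, Subalgebra.coe_mul, adOdd_coe, oddGen, this]
        noncomm_ring
      simp only [LinearMap.add_apply, Module.End.mul_apply, coindEven_apply, coindOdd_apply, h,
        map_add]
      abel)
    (fun X Y => by
      ext f x
      have h : x * oddGen X * oddGen Y = -(x * oddGen Y * oddGen X) := by
        rw [mul_assoc, mul_assoc, ← mul_neg]
        congr 1
        exact Subtype.ext (odd_mul_odd X Y)
      simp only [Module.End.mul_apply, LinearMap.neg_apply, coindOdd_apply, h, map_neg])

theorem coind_even (X : L) : coind M (even X) = coindEven M X := lift_even ..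
theorem coind_odd (X : L) : coind M (odd X) = coindOdd M X := lift_odd ..

/-- The adjoint action kills 1, so only the action on M survives there. Hence evaluation at 1 is
U(L)-linear. -/
theorem coind_ofEnv_one (u : UniversalEnvelopingAlgebra ℂ L) (f : oddAlg L →ₗ[ℂ] M) :
    coind M (ofEnv u) f 1 = u • f 1 := by
  induction u using env_induction generalizing f with
  | halg c => simp
  | hι X =>
    have : adOdd X 1 = 0 := by
      apply Subtype.ext
      rw [adOdd_coe]; simp
    rw [ofEnv_ι, coind_even, coindEven_apply, this, map_zero, sub_zero]
  | hmul a b ha hb => rw [map_mul, map_mul, Module.End.mul_apply, ha, hb, mul_smul]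
  | hadd a b ha hb => rw [map_add, map_add, LinearMap.add_apply, LinearMap.add_apply, ha, hb, add_smul]

theorem coind_oddAlg (a : oddAlg L) (f : oddAlg L →ₗ[ℂ] M) (x : oddAlg L) :
    coind M (a : StdAlg L) f x = f (x * a) := by
  obtain ⟨a, ha⟩ := a
  induction ha using Algebra.adjoin_induction generalizing f x with
  | mem a ha => obtain ⟨X, rfl⟩ := ha; rw [coind_odd]; rfl
  | algebraMap r =>
    have : x * ⟨algebraMap ℂ (StdAlg L) r, Subalgebra.algebraMap_mem _ r⟩ = r • x := by
      rw [Algebra.smul_def, Algebra.commutes]; rfl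
    rw [this]
    simp
  | add a b ha hb iha ihb =>
    have := congrArg f (mul_add x ⟨a, ha⟩ ⟨b, hb⟩)
    rw [map_add, ← iha f x, ← ihb f x] at this
    simp only [map_add, LinearMap.add_apply] at this ⊢
    exact this.symm
  | mul a b ha hb iha ihb =>
    have := congrArg f (mul_assoc x ⟨a, ha⟩ ⟨b, hb⟩)
    rw [← ihb f] at this
    simp only [map_mul, Module.End.mul_apply]
    rw [iha]
    exact this

/-- The `U(L)`-linear map `N(L) → M` that extends a given linear map on `⋀ L`. -/
noncomputable def extendOdd (f : oddAlg L →ₗ[ℂ] M) :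
    StdAlg L →ₗ[UniversalEnvelopingAlgebra ℂ L] M where
  toFun n := coind M n f 1
  map_add' a b := by rw [map_add]; rfl
  map_smul' u a := by
    rw [env_smul_def, map_mul, Module.End.mul_apply, coind_ofEnv_one, RingHom.id_apply]

theorem extendOdd_coe (f : oddAlg L →ₗ[ℂ] M) (a : oddAlg L) :
    extendOdd f (a : StdAlg L) = f a := by
  change coind M (a : StdAlg L) f 1 = f a
  rw [coind_oddAlg, one_mul]

/-- The two hypotheses say that the generators φ(S), odd and even, annihilate f in the module
Hom(⋀L, M). The left ideal they generate then annihilates f as well. -/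
theorem extendOdd_eq_zero {S : Type*} [LieRing S] [LieAlgebra ℂ S] {φ : S →ₗ⁅ℂ⁆ L}
    {f : oddAlg L →ₗ[ℂ] M} (ho : ∀ x τ, f (x * oddGen (φ τ)) = 0)
    (he : ∀ x τ, f (adOdd (φ τ) x) = ι ℂ (φ τ) • f x) {n : StdAlg L} (hn : n ∈ relations φ) :
    extendOdd f n = 0 := by
  have hE : ∀ τ, coind M (even (φ τ)) f = 0 := by
    intro τ
    ext x
    rw [coind_even, coindEven_apply, he, sub_self, LinearMap.zero_apply]
  have hO : ∀ τ, coind M (odd (φ τ)) f = 0 := by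
    intro τ
    ext x
    rw [coind_odd, coindOdd_apply, ho, LinearMap.zero_apply]
  refine mem_of_mem_relations (Z := LinearMap.ker ((extendOdd f).restrictScalars ℂ))
    (fun a τ => ?_) (fun a τ => ?_) hn
  · change coind M (a * even (φ τ)) f 1 = 0
    rw [map_mul, Module.End.mul_apply, hE, map_zero, LinearMap.zero_apply]
  · change coind M (a * odd (φ τ)) f 1 = 0
    rw [map_mul, Module.End.mul_apply, hO, map_zero, LinearMap.zero_apply]

end Coinduced

/-! ### Generators and mapping property of the components of N(L) ⊗_{N(S)} ℂ. -/

section RelDegree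
variable {L : Type u} [LieRing L] [LieAlgebra ℂ L] {S : Type v} [LieRing S] [LieAlgebra ℂ S]
  (φ : S →ₗ⁅ℂ⁆ L)

/-- The projection of `N(L)` onto the component of degree `-p` of `N(L) ⊗_{N(S)} ℂ`. -/
noncomputable def relProj (p : ℕ) : StdAlg L →ₗ[UniversalEnvelopingAlgebra ℂ L] relDegree φ p where
  toFun a := ⟨(relations φ).mkQ (proj p a), ⟨_, proj_mem_degree p a, rfl⟩⟩
  map_add' a b := Subtype.ext (by simp)
  map_smul' u a := Subtype.ext (by
    simp only [env_smul_def, proj_ofEnv_mul, RingHom.id_apply]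
    rw [← env_smul_def, map_smul]; rfl)

theorem relProj_coe (p : ℕ) (a : StdAlg L) :
    (relProj φ p a : RelStd φ) = (relations φ).mkQ (proj p a) := rfl

theorem relProj_eq_mkQ {p : ℕ} {a : StdAlg L} (ha : a ∈ degree p) :
    (relProj φ p a : RelStd φ) = (relations φ).mkQ a := by
  rw [relProj_coe, proj_eq_self ha]

theorem relProj_eq_zero (p : ℕ) {a : StdAlg L} (ha : a ∈ relations φ) : relProj φ p a = 0 :=
  Subtype.ext ((Submodule.Quotient.mk_eq_zero _).2 (proj_mem_relations p ha))

/-- The image of `⋀^p L` in `N(L) ⊗_{N(S)} ℂ`. -/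
noncomputable def relOdd (p : ℕ) : Submodule ℂ (relDegree φ p) :=
  (oddPow L p).map ((relProj φ p).restrictScalars ℂ)

theorem relProj_mem_relOdd (p : ℕ) (a : oddAlg L) : relProj φ p (a : StdAlg L) ∈ relOdd φ p := by
  have h := proj_mem_oddPow a.2 p
  refine ⟨_, h, Subtype.ext ?_⟩
  exact (relProj_eq_mkQ φ (oddPow_le_degree h))

theorem span_relOdd (p : ℕ) :
    Submodule.span (UniversalEnvelopingAlgebra ℂ L) (relOdd φ p : Set (relDegree φ p)) = ⊤ := by
  rw [eq_top_iff]
  rintro ⟨_, x, hx, rfl⟩ -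
  have h : relProj φ p x ∈ Submodule.span (UniversalEnvelopingAlgebra ℂ L)
      (relOdd φ p : Set (relDegree φ p)) := by
    induction hx using Submodule.span_induction with
    | mem x hx =>
      obtain ⟨ξ, rfl⟩ := hx
      refine Submodule.subset_span (relProj_mem_relOdd φ p ⟨_, ?_⟩)
      refine Subalgebra.list_prod_mem _ fun a ha => ?_
      obtain ⟨i, rfl⟩ := List.mem_ofFn.1 ha
      exact odd_mem_oddAlg _
    | zero => rw [map_zero]; exact Submodule.zero_mem _
    | add x y _ _ hx hy => rw [map_add]; exact Submodule.add_mem _ hx hy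
    | smul u x _ hx => rw [map_smul]; exact Submodule.smul_mem _ u hx
  convert h using 1
  exact Subtype.ext (relProj_eq_mkQ φ hx).symm

theorem finiteDimensional_relOdd [FiniteDimensional ℂ L] (p : ℕ) :
    FiniteDimensional ℂ (relOdd φ p) := by
  have := finiteDimensional_oddPow (L := L) p
  exact Module.Finite.map _ _

theorem finite_relDegree [FiniteDimensional ℂ L] (p : ℕ) :
    Module.Finite (UniversalEnvelopingAlgebra ℂ L) (relDegree φ p) := by
  have := finiteDimensional_relOdd φ p
  obtain ⟨s, hs⟩ := Module.Finite.iff_fg.1 this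
  refine ⟨⟨s, ?_⟩⟩
  rw [eq_top_iff, ← span_relOdd, Submodule.span_le, ← hs]
  exact Submodule.span_le_restrictScalars ℂ _ _

variable {φ} in
/-- A linear map defined on the image of `⋀^p L` that commutes with `S` extends to a
`U(L)`-linear map. -/
theorem exists_extend_relOdd {M : Type*} [AddCommGroup M] [Module ℂ M]
    [Module (UniversalEnvelopingAlgebra ℂ L) M] [IsScalarTower ℂ (UniversalEnvelopingAlgebra ℂ L) M]
    {p : ℕ} (s : relDegree φ p →ₗ[ℂ] M)
    (hs : ∀ x ∈ relOdd φ p, ∀ τ, s (ι ℂ (φ τ) • x) = ι ℂ (φ τ) • s x) :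
    ∃ g : relDegree φ p →ₗ[UniversalEnvelopingAlgebra ℂ L] M, ∀ x ∈ relOdd φ p, g x = s x := by
  -- s is pulled back to all of ⋀L through the projection to degree p. Modulo relations the
  -- commutator with φ(τ) is left multiplication by φ(τ), so the hypothesis on s is the required
  -- equivariance.
  let f : oddAlg L →ₗ[ℂ] M :=
    s ∘ₗ (relProj φ p).restrictScalars ℂ ∘ₗ (Subalgebra.toSubmodule (oddAlg L)).subtype
  have hf : ∀ x, f x = s (relProj φ p x.1) := fun _ => rfl
  have ho : ∀ x τ, f (x * oddGen (φ τ)) = 0 := by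
    intro x τ
    rw [hf]
    exact (congrArg s (relProj_eq_zero φ p (mul_odd_mem_relations φ x.1 τ))).trans (map_zero s)
  have he : ∀ x τ, f (adOdd (φ τ) x) = ι ℂ (φ τ) • f x := by
    intro x τ
    rw [hf, hf, ← hs _ (relProj_mem_relOdd φ p x), adOdd_coe, map_sub,
      relProj_eq_zero φ p (mul_even_mem_relations φ _ τ), sub_zero, ← map_smul, env_smul_def,
      ofEnv_ι]
  let g := (relations φ).liftQ (extendOdd f) fun x hx => extendOdd_eq_zero ho he hx
  refine ⟨g.domRestrict _, ?_⟩
  rintro _ ⟨x, hx, rfl⟩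
  have h1 := (extendOdd_coe f ⟨x, oddPow_le_oddAlg hx⟩).trans (hf _)
  refine Eq.trans ?_ h1
  change g (relProj φ p x : RelStd φ) = g ((relations φ).mkQ x)
  rw [relProj_eq_mkQ φ (oddPow_le_degree hx)]

end RelDegree
end StdAlg

section Main
open AlgGroup CategoryTheory

/-! ### Complements and equivariant lifts over a reductive group. -/

section Reductive
variable {T : Type u} [Group T] [AlgGroup T]

/-- Complete reducibility, stated for ℂⁿ, is transported to Z through a basis; inside Z one
complements its intersection with Z₀. -/
theorem IsReductive.exists_complement (hT : IsReductive T) {X : Type*} [AddCommGroup X]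
    [Module ℂ X] {ν : Representation ℂ T X} (hν : IsAlgebraicRep ν) {Z Z₀ : Submodule ℂ X}
    [FiniteDimensional ℂ Z] (hZ : ∀ g, ∀ z ∈ Z, ν g z ∈ Z) (hZ₀ : ∀ g, ∀ z ∈ Z₀, ν g z ∈ Z₀) :
    ∃ Z' ≤ Z, (∀ g, ∀ z ∈ Z', ν g z ∈ Z') ∧ Z₀ ⊓ Z' = ⊥ ∧ Z ≤ Z₀ ⊔ Z' := by
  let e := (Module.finBasis ℂ Z).equivFun
  let ν' : Representation ℂ T (Fin (Module.finrank ℂ Z) → ℂ) :=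
    { toFun := fun g => e.toLinearMap ∘ₗ (ν g).restrict (hZ g) ∘ₗ e.symm.toLinearMap
      map_one' := by
        refine LinearMap.ext fun v => ?_
        have : (ν 1).restrict (hZ 1) (e.symm v) = e.symm v := Subtype.ext (by simp)
        change e ((ν 1).restrict (hZ 1) (e.symm v)) = v
        rw [this, e.apply_symm_apply]
      map_mul' := fun g h => by
        refine LinearMap.ext fun v => ?_
        have : (ν (g * h)).restrict (hZ (g * h)) (e.symm v) =
          (ν g).restrict (hZ g) ((ν h).restrict (hZ h) (e.symm v)) := Subtype.ext (by simp)
        change e ((ν (g * h)).restrict (hZ (g * h)) (e.symm v)) = e ((ν g).restrict (hZ g)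
          (e.symm (e ((ν h).restrict (hZ h) (e.symm v)))))
        rw [this, e.symm_apply_apply] }
  have hν' : ∀ g (z : Z), ν' g (e z) = e ⟨ν g z, hZ g z z.2⟩ := by
    intro g z
    change e ((ν g).restrict (hZ g) (e.symm (e z))) = _
    rw [e.symm_apply_apply]; rfl
  have halg : IsAlgebraicRep ν' := by
    refine fun v => ⟨⊤, trivial, inferInstance, fun _ _ _ => trivial, fun w _ l => ?_⟩
    obtain ⟨z, rfl⟩ := e.surjective w
    -- Matrix coefficients are regular for linear forms on the ambient X, so the form on Z is first
    -- extended.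
    obtain ⟨l', hl'⟩ := LinearMap.exists_extend (l ∘ₗ e.toLinearMap)
    obtain ⟨W, hzW, -, -, hW⟩ := hν z
    convert hW z hzW l' using 2 with g
    rw [hν']
    exact (DFunLike.congr_fun hl' (⟨ν g z, hZ g z z.2⟩ : Z)).symm
  obtain ⟨W', hW', hc⟩ := hT _ ν' halg ((Z₀.comap Z.subtype).map e.toLinearMap) (by
    rintro g _ ⟨z, hz, rfl⟩
    exact ⟨_, hZ₀ g z hz, (hν' g z).symm⟩)
  refine ⟨(W'.comap e.toLinearMap).map Z.subtype, ?_, ?_, ?_, ?_⟩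
  · rintro _ ⟨z, -, rfl⟩; exact z.2
  · rintro g _ ⟨z, hz, rfl⟩
    refine ⟨⟨ν g z, hZ g z z.2⟩, ?_, rfl⟩
    have := hW' g _ hz
    change ν' g (e z) ∈ W' at this
    rwa [hν'] at this
  · rw [eq_bot_iff]
    rintro _ ⟨h0, z, hz, rfl⟩
    have : e z ∈ ((Z₀.comap Z.subtype).map e.toLinearMap) ⊓ W' := ⟨⟨z, h0, rfl⟩, hz⟩
    rw [hc.inf_eq_bot, Submodule.mem_bot, LinearEquiv.map_eq_zero_iff] at this
    rw [this]; simp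
  · intro x hx
    have : e ⟨x, hx⟩ ∈ ((Z₀.comap Z.subtype).map e.toLinearMap) ⊔ W' := by
      rw [hc.sup_eq_top]; trivial
    obtain ⟨_, ⟨z, hz, rfl⟩, w, hw, h⟩ := Submodule.mem_sup.1 this
    obtain ⟨y, rfl⟩ := e.surjective w
    have h2 : z + y = ⟨x, hx⟩ := e.injective (by rw [map_add]; exact h)
    have h3 : x = z + y := (congrArg Subtype.val h2).symm
    rw [h3]
    exact Submodule.add_mem_sup hz ⟨y, hw, rfl⟩

variable {P M N : Type*} [AddCommGroup P] [Module ℂ P] [AddCommGroup M] [Module ℂ M]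
  [AddCommGroup N] [Module ℂ N]

theorem IsAlgebraicRep.prod {ν : Representation ℂ T P} {ν' : Representation ℂ T M}
    (h : IsAlgebraicRep ν) (h' : IsAlgebraicRep ν') : IsAlgebraicRep (ν.prod ν') := by
  rintro ⟨x, y⟩
  obtain ⟨W, hx, _, hW, hc⟩ := h x
  obtain ⟨W', hy, _, hW', hc'⟩ := h' y
  refine ⟨W.prod W', ⟨hx, hy⟩, ?_, fun g w hw => ⟨hW g _ hw.1, hW' g _ hw.2⟩, fun w hw l => ?_⟩
  · exact Module.Finite.iff_fg.2 (Submodule.FG.prod (Module.Finite.iff_fg.1 ‹_›)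
      (Module.Finite.iff_fg.1 ‹_›))
  · have h1 := hc w.1 hw.1 (l ∘ₗ LinearMap.inl ℂ P M)
    have h2 := hc' w.2 hw.2 (l ∘ₗ LinearMap.inr ℂ P M)
    convert Subalgebra.add_mem _ h1 h2 using 1
    funext g
    change l (ν g w.1, ν' g w.2) = l (ν g w.1, 0) + l (0, ν' g w.2)
    rw [← map_add]; simp

theorem IsAlgebraicRep.exists_finiteDimensional {ν : Representation ℂ T M} (h : IsAlgebraicRep ν)
    {n : ℕ} (m : Fin n → M) : ∃ W : Submodule ℂ M, FiniteDimensional ℂ W ∧ (∀ i, m i ∈ W) ∧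
      ∀ g, ∀ w ∈ W, ν g w ∈ W := by
  choose W hm hfin hinv _ using fun i => h (m i)
  refine ⟨⨆ i, W i, inferInstance, fun i => Submodule.mem_iSup_of_mem i (hm i), fun g => ?_⟩
  change (⨆ i, W i) ≤ (⨆ i, W i).comap (ν g)
  exact iSup_le fun i w hw => Submodule.mem_iSup_of_mem i (hinv i g w hw)

/-- Over a reductive group, an equivariant map on a finite-dimensional invariant subspace lifts
along equivariant surjections. -/
theorem IsReductive.exists_lift (hT : IsReductive T) {νP : Representation ℂ T P}
    {νM : Representation ℂ T M} {νN : Representation ℂ T N} (hP : IsAlgebraicRep νP)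
    (hM : IsAlgebraicRep νM) {f : M →ₗ[ℂ] N} (hf : Function.Surjective f)
    (hfν : ∀ t m, f (νM t m) = νN t (f m)) {g : P →ₗ[ℂ] N}
    (hgν : ∀ t x, g (νP t x) = νN t (g x)) {V : Submodule ℂ P} [FiniteDimensional ℂ V]
    (hV : ∀ t, ∀ v ∈ V, νP t v ∈ V) :
    ∃ s : P →ₗ[ℂ] M, ∀ v ∈ V, f (s v) = g v ∧ ∀ t, s (νP t v) = νM t (s v) := by
  let b := Module.finBasis ℂ V
  choose m hm using fun i => hf (g (b i))
  obtain ⟨W, _, hmW, hWν⟩ := hM.exists_finiteDimensional m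
  have hVW : ∀ v ∈ V, ∃ w ∈ W, f w = g v := by
    intro v hv
    have h : (⟨v, hv⟩ : V) ∈ Submodule.span ℂ (Set.range b) := by rw [b.span_eq]; trivial
    have h2 : Submodule.span ℂ (Set.range b) ≤ (W.map f).comap (g ∘ₗ V.subtype) := by
      rw [Submodule.span_le]
      rintro _ ⟨i, rfl⟩
      exact ⟨m i, hmW i, hm i⟩
    exact h2 h
  -- The fibre product of V and W over N. It projects onto V, and an invariant complement to the
  -- kernel of this projection is the graph of an equivariant lift.
  let Z : Submodule ℂ (P × M) :=
    V.prod W ⊓ LinearMap.ker (g ∘ₗ LinearMap.fst ℂ P M - f ∘ₗ LinearMap.snd ℂ P M)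
  have hZ : ∀ z, z ∈ Z ↔ (z.1 ∈ V ∧ z.2 ∈ W) ∧ g z.1 = f z.2 := by
    intro z
    simp only [Z, Submodule.mem_inf, Submodule.mem_prod, LinearMap.mem_ker, LinearMap.sub_apply,
      LinearMap.comp_apply, LinearMap.fst_apply, LinearMap.snd_apply, sub_eq_zero]
  have hZfin : FiniteDimensional ℂ Z := by
    have : FiniteDimensional ℂ (V.prod W) :=
      Module.Finite.iff_fg.2 (Submodule.FG.prod (Module.Finite.iff_fg.1 ‹_›)
        (Module.Finite.iff_fg.1 ‹_›))
    exact Submodule.finiteDimensional_of_le (inf_le_left : Z ≤ V.prod W)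
  have hZν : ∀ t, ∀ z ∈ Z, νP.prod νM t z ∈ Z := by
    intro t z hz
    rw [hZ] at hz ⊢
    refine ⟨⟨hV t _ hz.1.1, hWν t _ hz.1.2⟩, ?_⟩
    change g (νP t z.1) = f (νM t z.2)
    rw [hgν, hfν, hz.2]
  obtain ⟨Z', hle, hZ'ν, hbot, hsup⟩ := hT.exists_complement (hP.prod hM) (Z := Z)
    (Z₀ := Z ⊓ LinearMap.ker (LinearMap.fst ℂ P M)) hZν (by
      rintro t z ⟨h1, h2⟩
      refine ⟨hZν t z h1, ?_⟩
      change νP t z.1 = 0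
      have : z.1 = 0 := h2
      rw [this, map_zero])
  let q : Z' →ₗ[ℂ] P := LinearMap.fst ℂ P M ∘ₗ Z'.subtype
  have hq : LinearMap.ker q = ⊥ := by
    rw [LinearMap.ker_eq_bot']
    intro z hz
    have : (z : P × M) ∈ Z ⊓ LinearMap.ker (LinearMap.fst ℂ P M) ⊓ Z' := ⟨⟨hle z.2, hz⟩, z.2⟩
    rw [hbot, Submodule.mem_bot] at this
    exact Subtype.ext this
  -- Outside V the left inverse is an arbitrary linear extension; equivariance is claimed only on V.
  obtain ⟨r, hr⟩ := LinearMap.exists_leftInverse_of_injective q hq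
  have hrq : ∀ z, r (q z) = z := DFunLike.congr_fun hr
  refine ⟨LinearMap.snd ℂ P M ∘ₗ Z'.subtype ∘ₗ r, fun v hv => ?_⟩
  obtain ⟨z, rfl⟩ : ∃ z, q z = v := by
    obtain ⟨w, hw, hfw⟩ := hVW v hv
    have : (v, w) ∈ Z := (hZ _).2 ⟨⟨hv, hw⟩, hfw.symm⟩
    obtain ⟨z₀, hz₀, z, hz, h⟩ := Submodule.mem_sup.1 (hsup this)
    refine ⟨⟨z, hz⟩, ?_⟩
    have h1 : z₀.1 = 0 := hz₀.2
    have h2 := congrArg Prod.fst h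
    rw [Prod.fst_add, h1, zero_add] at h2
    exact h2
  constructor
  · change f (r (q z)).1.2 = g z.1.1
    rw [hrq, ((hZ _).1 (hle z.2)).2]
  · intro t
    have : νP t (q z) = q ⟨νP.prod νM t z, hZ'ν t z z.2⟩ := rfl
    rw [this]
    change (r (q _)).1.2 = νM t (r (q z)).1.2
    rw [hrq, hrq]
    rfl

end Reductive

/-! ### Quotients of (𝔨, T)-modules, epimorphisms, and differentiation of equivariance. -/

section Quotient
variable {T K : Type u} [Group T] [AlgGroup T] [Group K] [AlgGroup K] {γ : AlgGroup.Hom T K}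

namespace HCMod

theorem linearMap_comm {M N : HCMod γ} (f : M ⟶ N) (t : T) (m : M) :
    linearMap f (M.ν t m) = N.ν t (linearMap f m) := Hom.comm f t m

section
variable (N : HCMod γ) (R : Submodule (Env K) N) (hR : ∀ t, ∀ x ∈ R, N.ν t x ∈ R)

/-- The action of `T` on the quotient of a `(𝔨, T)`-module. -/
noncomputable def quotientAct (t : T) : (N ⧸ R) →ₗ[ℂ] (N ⧸ R) where
  toFun := Submodule.mapQ R R
    ({ toFun := N.ν t
       map_add' := map_add _
       map_smul' := N.isHC.equivariant t } :
      N →ₛₗ[(StdAlg.envMap (adj (γ t))).toRingHom] N) (hR t)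
  map_add' := map_add _
  map_smul' c x := by
    rw [← algebraMap_smul (Env K) c x, LinearMap.map_smulₛₗ]
    simp

theorem quotientAct_mk (t : T) (x : N) :
    quotientAct N R hR t (R.mkQ x) = R.mkQ (N.ν t x) := rfl

/-- The representation of `T` on the quotient of a `(𝔨, T)`-module. -/
noncomputable def quotientRep : Representation ℂ T (N ⧸ R) where
  toFun := quotientAct N R hR
  map_one' := by
    refine LinearMap.ext fun x => ?_
    obtain ⟨x, rfl⟩ := R.mkQ_surjective x
    rw [quotientAct_mk, map_one]; rfl
  map_mul' s t := by
    refine LinearMap.ext fun x => ?_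
    obtain ⟨x, rfl⟩ := R.mkQ_surjective x
    rw [quotientAct_mk, map_mul]; rfl

theorem isAlgebraicRep_quotientRep : IsAlgebraicRep (quotientRep N R hR) := by
  intro v
  obtain ⟨x, rfl⟩ := R.mkQ_surjective v
  obtain ⟨W, hx, _, hW, hc⟩ := N.isHC.algebraic x
  refine ⟨W.map (R.mkQ.restrictScalars ℂ), ⟨x, hx, rfl⟩, inferInstance, ?_, ?_⟩
  · rintro g _ ⟨w, hw, rfl⟩
    exact ⟨N.ν g w, hW g w hw, rfl⟩
  · rintro _ ⟨w, hw, rfl⟩ l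
    exact hc w hw (l ∘ₗ R.mkQ.restrictScalars ℂ)

theorem isHCModule_quotientRep : IsHCModule γ (quotientRep N R hR) where
  algebraic := isAlgebraicRep_quotientRep N R hR
  equivariant t a v := by
    obtain ⟨x, rfl⟩ := R.mkQ_surjective v
    exact (congrArg R.mkQ (N.isHC.equivariant t a x)).trans (R.mkQ.map_smul _ _)
  differential ξ v l c hc := by
    obtain ⟨x, rfl⟩ := R.mkQ_surjective v
    have h := N.isHC.differential ξ x (l ∘ₗ R.mkQ.restrictScalars ℂ) c hc
    rw [h]
    exact congrArg l (R.mkQ.map_smul _ _)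

/-- The quotient of a `(𝔨, T)`-module by a submodule. -/
noncomputable def quotient : HCMod γ where
  carrier := N ⧸ R
  ν := quotientRep N R hR
  isHC := isHCModule_quotientRep N R hR

/-- The quotient morphism. -/
noncomputable def quotientMk : N ⟶ quotient N R hR where
  toLinearMap := R.mkQ
  comm _ _ := rfl

end

/-- The cokernel is again a (𝔨, T)-module. The quotient morphism and zero agree after f, so they are
equal and the cokernel vanishes. -/
theorem surjective_of_epi {M N : HCMod γ} (f : M ⟶ N) [Epi f] :
    Function.Surjective (linearMap f) := by
  let R := LinearMap.range (linearMap f)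
  have hR : ∀ t, ∀ x ∈ R, N.ν t x ∈ R := by
    rintro t _ ⟨m, rfl⟩
    exact ⟨M.ν t m, linearMap_comm f t m⟩
  let z : N ⟶ quotient N R hR := ⟨0, fun t m => (map_zero _).symm⟩
  have h : f ≫ quotientMk N R hR = f ≫ z := by
    apply HCMod.Hom.ext
    refine LinearMap.ext fun m => ?_
    exact (Submodule.Quotient.mk_eq_zero R).2 ⟨m, rfl⟩
  have h2 := (cancel_epi f).1 h
  intro n
  have h3 : R.mkQ n = 0 := DFunLike.congr_fun (congrArg Hom.toLinearMap h2) n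
  exact (Submodule.Quotient.mk_eq_zero R).1 h3

end HCMod

/-- For every linear form l the two matrix coefficients t ↦ l(s(tv)) and t ↦ l(t s(v)) are the same
regular function; differentiating it at 1 computes both sides. Equivariance at the single vector v
suffices. -/
theorem IsHCModule.map_smul_of_comm {P M : Type*} [AddCommGroup P] [Module ℂ P] [Module (Env K) P]
    [AddCommGroup M] [Module ℂ M] [Module (Env K) M] {νP : Representation ℂ T P}
    {νM : Representation ℂ T M} (hP : IsHCModule γ νP) (hM : IsHCModule γ νM) {s : P →ₗ[ℂ] M}
    {v : P} (hs : ∀ t, s (νP t v) = νM t (s v)) (τ : LieAlg T) :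
    s (UniversalEnvelopingAlgebra.ι ℂ (γ.differential τ) • v) =
      UniversalEnvelopingAlgebra.ι ℂ (γ.differential τ) • s v := by
  rw [← sub_eq_zero, ← Module.forall_dual_apply_eq_zero_iff ℂ]
  intro l
  obtain ⟨W, hv, -, -, hW⟩ := hP.algebraic v
  let c : Coord T := ⟨_, hW v hv (l ∘ₗ s)⟩
  have h1 := hP.differential τ v (l ∘ₗ s) c fun _ => rfl
  have h2 := hM.differential τ (s v) l c fun t => congrArg l (hs t)
  rw [map_sub, ← h2, h1]
  exact sub_self _

end Quotient

end Main

section Main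
open AlgGroup CategoryTheory

/-! ### Projectivity and exactness of the resolution. -/

section Resolution
open StdAlg
variable {T K : Type u} [Group T] [AlgGroup T] [Group K] [AlgGroup K] (γ : AlgGroup.Hom T K)

theorem relRep_mem_relOdd (p : ℕ) (t : T) (v : relDegree γ.differential p)
    (hv : v ∈ relOdd γ.differential p) : relRep γ p t v ∈ relOdd γ.differential p := by
  obtain ⟨x, hx, rfl⟩ := hv
  have h := map_mem_oddPow (adj (γ t)) hx
  refine ⟨_, h, Subtype.ext ?_⟩
  refine (relProj_eq_mkQ _ (oddPow_le_degree h)).trans ?_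
  exact (congrArg (relAct γ t) (relProj_eq_mkQ γ.differential (oddPow_le_degree hx))).symm

theorem relDegree_induction {p : ℕ} {P : relDegree γ.differential p → Prop}
    (mem : ∀ x ∈ relOdd γ.differential p, P x) (zero : P 0) (add : ∀ x y, P x → P y → P (x + y))
    (smul : ∀ (u : Env K) x, P x → P (u • x)) (x : relDegree γ.differential p) : P x := by
  have hx : x ∈ Submodule.span (Env K)
      (relOdd γ.differential p : Set (relDegree γ.differential p)) := by
    rw [span_relOdd]; trivial
  induction hx using Submodule.span_induction with
  | mem x hx => exact mem x hx
  | zero => exact zero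
  | add x y _ _ hx hy => exact add x y hx hy
  | smul u x _ hx => exact smul u x hx

/-- The given map is lifted T-equivariantly on the image of ⋀^p 𝔨 only and then extended
U(𝔨)-linearly. Equivariance of the extension and the lifting identity are compatible with the action
of U(𝔨), so it is enough to check them on this generating space. -/
theorem projective_relStd (hT : IsReductive T) (p : ℕ) : Projective (relStd γ p) := by
  refine ⟨fun {M N} g f _ => ?_⟩
  have hf := HCMod.surjective_of_epi f
  have hfin : FiniteDimensional ℂ (relOdd γ.differential p) := finiteDimensional_relOdd _ p
  obtain ⟨s, hs⟩ := hT.exists_lift (νP := relRep γ p) (νM := M.ν) (νN := N.ν)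
    (isHCModule_relRep γ p).algebraic M.isHC.algebraic
    (f := (HCMod.linearMap f).restrictScalars ℂ) hf (HCMod.linearMap_comm f)
    (g := (HCMod.linearMap g).restrictScalars ℂ) (HCMod.linearMap_comm g)
    (V := relOdd γ.differential p) (relRep_mem_relOdd γ p)
  obtain ⟨e, he⟩ := exists_extend_relOdd s fun x hx τ =>
    IsHCModule.map_smul_of_comm (isHCModule_relRep γ p) M.isHC (hs x hx).2 τ
  refine ⟨⟨e, fun t => ?_⟩, ?_⟩
  · refine relDegree_induction γ ?_ ?_ ?_ ?_
    · intro x hx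
      exact (he _ (relRep_mem_relOdd γ p t x hx)).trans
        (((hs x hx).2 t).trans (congrArg (M.ν t) (he x hx).symm))
    · exact (congrArg e (map_zero (relRep γ p t))).trans
        ((map_zero e).trans ((congrArg (M.ν t) (map_zero e)).trans (map_zero (M.ν t))).symm)
    · intro x y hx hy
      exact (congrArg e (map_add (relRep γ p t) x y)).trans ((map_add e _ _).trans
        ((congrArg₂ (· + ·) hx hy).trans
          ((congrArg (M.ν t) (map_add e x y)).trans (map_add (M.ν t) _ _)).symm))
    · intro u x hx
      exact (congrArg e ((isHCModule_relRep γ p).equivariant t u x)).trans ((e.map_smul _ _).trans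
        ((congrArg (envMap (adj (γ t)) u • ·) hx).trans
          ((congrArg (M.ν t) (e.map_smul u x)).trans (M.isHC.equivariant t u _)).symm))
  · apply HCMod.Hom.ext
    refine LinearMap.ext ?_
    change ∀ x, HCMod.linearMap f (e x) = HCMod.linearMap g x
    refine relDegree_induction γ ?_ ?_ ?_ ?_
    · intro x hx
      rw [he x hx]
      exact (hs x hx).1
    · rw [map_zero, map_zero]; exact (map_zero (HCMod.linearMap g)).symm
    · intro x y hx hy
      rw [map_add, map_add, hx, hy]; exact (map_add (HCMod.linearMap g) x y).symm
    · intro u x hx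
      rw [map_smul, map_smul, hx]; exact (map_smul (HCMod.linearMap g) u x).symm

theorem surjective_relStdAug : Function.Surjective (HCMod.linearMap (relStdAug γ)) := by
  rintro ⟨c⟩
  have h : c • (1 : StdAlg (LieAlg K)) ∈ degree 0 :=
    oddPow_le_degree (Submodule.smul_mem _ c one_mem_oddPow_zero)
  refine ⟨⟨(relations γ.differential).mkQ (c • 1), ⟨_, h, rfl⟩⟩, ?_⟩
  change (ULift.up (counit (c • (1 : StdAlg (LieAlg K)))) : ULift.{u} ℂ) = ULift.up c
  rw [map_smul, map_one, smul_eq_mul, mul_one]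

variable {γ}

/-- The acyclicity of `N(𝔨) ⊗_{N(𝔱)} ℂ → ℂ` in terms of representatives. -/
theorem exists_mem_degree_sub_d_mem (hγ : Function.Injective γ.differential) {p : ℕ}
    {x : StdAlg (LieAlg K)} (hx : x ∈ degree p) (hd : d x ∈ relations γ.differential)
    (hε : counit x = 0) :
    ∃ y ∈ degree (p + 1), x - d y ∈ relations γ.differential := by
  obtain ⟨π, h1, hmul, hι⟩ := exists_linearMap_env γ.differential hγ
  obtain ⟨y, hy⟩ := exists_sub_d_mem_relations h1 hmul hι hd hε
  -- The homotopy argument ignores degrees; projecting the identity x ≡ d y to degree -p leaves the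
  -- component of y of degree -(p + 1).
  refine ⟨proj (p + 1) y, proj_mem_degree _ y, ?_⟩
  have h := proj_mem_relations p hy
  rwa [map_sub, proj_eq_self hx, proj_d] at h

theorem mkQ_eq_of_sub_mem {x y : StdAlg (LieAlg K)} (h : x - y ∈ relations γ.differential) :
    (relations γ.differential).mkQ y = (relations γ.differential).mkQ x :=
  ((Submodule.Quotient.eq _).2 h).symm

theorem exact_relStdD_relStdAug (hγ : Function.Injective γ.differential) :
    Function.Exact (HCMod.linearMap (relStdD γ 0)) (HCMod.linearMap (relStdAug γ)) := by
  rintro ⟨_, x, hx, rfl⟩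
  constructor
  · intro h
    have hε : counit x = 0 := congrArg ULift.down h
    have hd : d x ∈ relations γ.differential := by
      rw [d_eq_zero_of_mem_degree_zero hx]; exact Submodule.zero_mem _
    obtain ⟨y, hy, hxy⟩ := exists_mem_degree_sub_d_mem hγ hx hd hε
    exact ⟨⟨(relations γ.differential).mkQ y, ⟨y, hy, rfl⟩⟩, Subtype.ext (mkQ_eq_of_sub_mem hxy)⟩
  · rintro ⟨⟨_, y, hy, rfl⟩, h⟩
    have h2 : (relations γ.differential).mkQ (d y) = (relations γ.differential).mkQ x :=
      congrArg Subtype.val h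
    have h3 := relations_le_ker_counit γ.differential ((Submodule.Quotient.eq _).1 h2)
    rw [map_sub, counit_d, zero_sub, neg_eq_zero] at h3
    exact congrArg ULift.up h3

theorem exact_relStdD (hγ : Function.Injective γ.differential) (p : ℕ) :
    Function.Exact (HCMod.linearMap (relStdD γ (p + 1))) (HCMod.linearMap (relStdD γ p)) := by
  rintro ⟨_, x, hx, rfl⟩
  constructor
  · intro h
    have hd : d x ∈ relations γ.differential :=
      (Submodule.Quotient.mk_eq_zero _).1 (congrArg Subtype.val h)
    obtain ⟨y, hy, hxy⟩ := exists_mem_degree_sub_d_mem hγ hx hd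
      (counit_eq_zero_of_mem_degree_succ hx)
    exact ⟨⟨(relations γ.differential).mkQ y, ⟨y, hy, rfl⟩⟩, Subtype.ext (mkQ_eq_of_sub_mem hxy)⟩
  · rintro ⟨⟨_, y, hy, rfl⟩, h⟩
    have h2 : (relations γ.differential).mkQ (d y) = (relations γ.differential).mkQ x :=
      congrArg Subtype.val h
    have h3 := d_mem_relations ((Submodule.Quotient.eq _).1 h2)
    rw [map_sub, d_d, zero_sub] at h3
    exact Subtype.ext ((Submodule.Quotient.mk_eq_zero _).2 ((Submodule.neg_mem_iff _).1 h3))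

end Resolution
end Main

theorem mainTheorem8 {T K : Type u} [Group T] [AlgGroup T] [Group K] [AlgGroup K]
    (γ : AlgGroup.Hom T K) (hγ : Function.Injective γ.differential) (hT : IsReductive T) :
    (∀ p : ℕ, CategoryTheory.Projective (relStd γ p)) ∧
    (∀ p : ℕ, Module.Finite (Env K) (relStd γ p)) ∧
    Function.Surjective (HCMod.linearMap (relStdAug γ)) ∧
    Function.Exact (HCMod.linearMap (relStdD γ 0)) (HCMod.linearMap (relStdAug γ)) ∧
    (∀ p : ℕ, Function.Exact (HCMod.linearMap (relStdD γ (p + 1)))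
      (HCMod.linearMap (relStdD γ p))) :=
  ⟨projective_relStd γ hT, StdAlg.finite_relDegree γ.differential, surjective_relStdAug γ,
    exact_relStdD_relStdAug hγ, exact_relStdD hγ⟩
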